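/- Let $X$ be a complex manifold (Hausdorff and second countable, not necessarily compact) with $\dim_{\mathbb C}X=n\ge 2$, let $\omega$ be a Hermitian metric on $X$, identified with its fundamental positive $(1,1)$-form, and let $\eta$ be a real-valued $C^\infty$ function on $X$ with $\eta>0$ everywhere or $\eta<0$ everywhere. Consider the following operators on the $C^\infty$ complex-valued differential forms on $X$. The operator $D^{0,1}_\eta$ is given on forms of bidegree $(p,q)$ by $$D^{0,1}_\eta=\bar\partial-\frac{p}{\eta}\,\bar\partial\eta\wedge\cdot\,.$$ For an operator $A$, the conjugate operator is $\overline{A}\,u:=\overline{A\,\bar u}$, and $A^\star$ is the formal adjoint with respect to the $L^2$ inner product $\langle\langle u,v\rangle\rangle=\int_X\langle u,v\rangle_\omega\,dV_\omega$ defined by $\omega$, i.e. $\langle\langle Au,v\rangle\rangle=\langle\langle u,A^\star v\rangle\rangle$ for all smooth forms $u,v$ with $u$ compactly supported (here $\langle\cdot,\cdot\rangle_\omega$ is the pointwise inner product in which, for every orthonormal real coframe $e^1,\dots,e^{2n}$ of the metric $\omega(\cdot,i\,\cdot)$, the forms $e^{j_1}\wedge\dots\wedge e^{j_k}$, $j_1<\dots<j_k$,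 are orthonormal, and $dV_\omega=\omega^n/n!$). Put $\Lambda:=(\omega\wedge\cdot)^\star$ and $$\tau^{0,1}_\eta:=\big[\Lambda,\,(D^{0,1}_\eta\omega)\wedge\cdot\,\big],\qquad \Delta''_\eta:=\big[D^{0,1}_\eta,(D^{0,1}_\eta)^\star\big],\qquad \Delta'_\eta:=\big[\overline{D^{0,1}_\eta},\overline{D^{0,1}_\eta}^{\,\star}\big],$$ where $[A,B]=AB-(-1)^{ab}BA$ is the graded commutator of operators of degrees $a$ and $b$. Then the formal adjoints of $\omega\wedge\cdot$, $D^{0,1}_\eta$, $\overline{D^{0,1}_\eta}$, $\tau^{0,1}_\eta$ and $\overline{\tau^{0,1}_\eta}$ exist and are unique, and the following rough $\eta$-Bochner-Kodaira-Nakano identity holds on the $C^\infty$ forms of any degree on $X$: $$\Delta''_\eta=\Delta'_\eta+i\Big[\big[D^{0,1}_\eta,\overline{D^{0,1}_\eta}\big],\Lambda\Big]+\Big[\overline{D^{0,1}_\eta},\overline{\tau^{0,1}_\eta}^{\,\star}\Big]-\Big[D^{0,1}_\eta,(\tau^{0,1}_\eta)^\star\Big]+n\Big[D^{0,1}_\eta,\frac{i}{\eta}\,[\partial\eta\wedge\cdot\,,\Lambda]\Big]+n\Big[\overline{D^{0,1}_\eta},\frac{i}{\eta}\,[\bar\partial\eta\wedge\cdot\,,\Lambda]\Big].$$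 -/

import Mathlib

open scoped Manifold ContDiff

noncomputable section

namespace TwistedBKN

/-- Complex valued, real multilinear alternating `k`-forms on the complex vector space `E`:
the fibre of the bundle of `k`-forms in a chart. -/
abbrev Alt (E : Type*) [NormedAddCommGroup E] [NormedSpace ℂ E] (k : ℕ) : Type _ :=
  E [⋀^Fin k]→L[ℝ] ℂ

section Fibre
variable {E : Type*} [NormedAddCommGroup E] [NormedSpace ℂ E]

instance [FiniteDimensional ℂ E] (k : ℕ) : FiniteDimensional ℝ (Alt E k) := by
  let f : Alt E k →ₗ[ℝ] MultilinearMap ℝ (fun _ : Fin k => E) ℂ :=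
    { toFun := fun α => α.toContinuousMultilinearMap.toMultilinearMap
      map_add' := fun _ _ => rfl
      map_smul' := fun _ _ => rfl }
  refine Module.Finite.of_injective f fun α β h => ?_
  ext v
  exact congrArg (fun m : MultilinearMap ℝ (fun _ : Fin k => E) ℂ => m v) h

/-- Pull-back `A^*α` of an alternating form along a real linear map. -/
def altPullback (k : ℕ) (A : E →L[ℝ] E) : Alt E k →ₗ[ℂ] Alt E k where
  toFun α := α.compContinuousLinearMap A
  map_add' _ _ := rfl
  map_smul' _ _ := rfl

/-- Complex conjugation `α ↦ ᾱ` of an alternating form. -/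
def altConj (k : ℕ) : Alt E k →ₛₗ[starRingEnd ℂ] Alt E k where
  toFun α := (Complex.conjCLE : ℂ →L[ℝ] ℂ).compContinuousAlternatingMap α
  map_add' _ _ := by ext; simp
  map_smul' _ _ := by ext; simp

/-- The summand of the wedge product that belongs to a shuffle class `σ`; see `wedgeSummand_mk`. -/
def wedgeSummand {a b : ℕ} (α : Alt E a) (β : Alt E b)
    (σ : Equiv.Perm.ModSumCongr (Fin a) (Fin b)) (v : Fin a ⊕ Fin b → E) : ℂ :=
  LinearMap.mul' ℝ ℂ
    (AlternatingMap.domCoprod.summand α.toAlternatingMap β.toAlternatingMap σ v)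

theorem wedgeSummand_mk {a b : ℕ} (α : Alt E a) (β : Alt E b)
    (σ : Equiv.Perm (Fin a ⊕ Fin b)) (v : Fin a ⊕ Fin b → E) :
    wedgeSummand α β (Quotient.mk'' σ) v =
      (Equiv.Perm.sign σ : ℤ) • (α (fun i => v (σ (Sum.inl i))) * β fun j => v (σ (Sum.inr j))) := by
  simp only [wedgeSummand, AlternatingMap.domCoprod.summand_mk'']
  rw [smul_apply, Units.smul_def, map_zsmul]
  rfl

/-- The wedge product of alternating forms,
`(α ∧ β)(v) = ∑_σ sgn(σ) α(v_{σ(1)}, …, v_{σ(a)}) β(v_{σ(a+1)}, …, v_{σ(a+b)})`, where `σ` runs through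
the permutations modulo those of the two blocks (shuffles); see `altWedge_apply`. -/
def altWedge {a b k : ℕ} (h : a + b = k) : Alt E a →ₗ[ℂ] Alt E b →ₗ[ℂ] Alt E k :=
  have key : ∀ (α : Alt E a) (β : Alt E b) (v : Fin k → E),
      (((LinearMap.mul' ℝ ℂ).compAlternatingMap
            (α.toAlternatingMap.domCoprod β.toAlternatingMap)).domDomCongr
              (finSumFinEquiv.trans (finCongr h))) v =
        ∑ σ, wedgeSummand α β σ (fun i => v ((finSumFinEquiv.trans (finCongr h)) i)) := by
    intro α β v
    simp only [AlternatingMap.domDomCongr_apply, LinearMap.compAlternatingMap_apply,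
      AlternatingMap.domCoprod_apply, sum_apply, map_sum]
    rfl
  LinearMap.mk₂ ℂ
    (fun α β =>
      { toAlternatingMap :=
          ((LinearMap.mul' ℝ ℂ).compAlternatingMap
            (α.toAlternatingMap.domCoprod β.toAlternatingMap)).domDomCongr
              (finSumFinEquiv.trans (finCongr h))
        cont := by
          change Continuous fun v => (((LinearMap.mul' ℝ ℂ).compAlternatingMap
            (α.toAlternatingMap.domCoprod β.toAlternatingMap)).domDomCongr
              (finSumFinEquiv.trans (finCongr h))) v
          simp only [key]
          refine continuous_finsetSum _ fun σ _ => ?_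
          induction σ using Quotient.inductionOn' with
          | h σ =>
            simp only [wedgeSummand_mk]
            exact ((α.cont.comp (by fun_prop)).mul (β.cont.comp (by fun_prop))).const_smul _ })
    (fun α α' β => by
      ext v
      refine (key _ _ v).trans ?_
      refine Eq.trans ?_ (congrArg₂ (· + ·) (key α β v) (key α' β v)).symm
      rw [← Finset.sum_add_distrib]
      refine Finset.sum_congr rfl fun σ _ => ?_
      induction σ using Quotient.inductionOn' with
      | h σ => simp only [wedgeSummand_mk, ContinuousAlternatingMap.add_apply]; rw [add_mul, smul_add])
    (fun c α β => by
      ext v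
      refine (key _ _ v).trans ?_
      refine Eq.trans ?_ (congrArg (c * ·) (key α β v)).symm
      rw [Finset.mul_sum]
      refine Finset.sum_congr rfl fun σ _ => ?_
      induction σ using Quotient.inductionOn' with
      | h σ =>
        simp only [wedgeSummand_mk, ContinuousAlternatingMap.smul_apply, smul_eq_mul, zsmul_eq_mul]
        ring)
    (fun α β β' => by
      ext v
      refine (key _ _ v).trans ?_
      refine Eq.trans ?_ (congrArg₂ (· + ·) (key α β v) (key α β' v)).symm
      rw [← Finset.sum_add_distrib]
      refine Finset.sum_congr rfl fun σ _ => ?_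
      induction σ using Quotient.inductionOn' with
      | h σ => simp only [wedgeSummand_mk, ContinuousAlternatingMap.add_apply]; rw [mul_add, smul_add])
    (fun c α β => by
      ext v
      refine (key _ _ v).trans ?_
      refine Eq.trans ?_ (congrArg (c * ·) (key α β v)).symm
      rw [Finset.mul_sum]
      refine Finset.sum_congr rfl fun σ _ => ?_
      induction σ using Quotient.inductionOn' with
      | h σ =>
        simp only [wedgeSummand_mk, ContinuousAlternatingMap.smul_apply, smul_eq_mul, zsmul_eq_mul]
        ring)

theorem altWedge_apply {a b k : ℕ} (h : a + b = k) (α : Alt E a) (β : Alt E b) (v : Fin k → E) :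
    altWedge h α β v =
      ∑ σ, wedgeSummand α β σ (fun i => v ((finSumFinEquiv.trans (finCongr h)) i)) := by
  change (((LinearMap.mul' ℝ ℂ).compAlternatingMap
            (α.toAlternatingMap.domCoprod β.toAlternatingMap)).domDomCongr
              (finSumFinEquiv.trans (finCongr h))) v = _
  simp only [AlternatingMap.domDomCongr_apply, LinearMap.compAlternatingMap_apply,
    AlternatingMap.domCoprod_apply, sum_apply, map_sum]
  rfl

theorem altPullback_wedge {a b k : ℕ} (h : a + b = k) (A : E →L[ℝ] E) (α : Alt E a) (β : Alt E b) :
    altPullback k A (altWedge h α β) = altWedge h (altPullback a A α) (altPullback b A β) := by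
  ext v
  change altWedge h α β (fun i => A (v i)) = _
  rw [altWedge_apply, altWedge_apply]
  refine Finset.sum_congr rfl fun σ _ => ?_
  induction σ using Quotient.inductionOn' with
  | h σ => simp only [wedgeSummand_mk]; rfl

theorem contDiffOn_altWedge [FiniteDimensional ℂ E] {a b k : ℕ} (h : a + b = k) {s : Set E}
    {u : E → Alt E a} {v : E → Alt E b} (hu : ContDiffOn ℝ ∞ u s) (hv : ContDiffOn ℝ ∞ v s) :
    ContDiffOn ℝ ∞ (fun z => altWedge h (u z) (v z)) s := by
  let B : Alt E a →ₗ[ℝ] (Alt E b →L[ℝ] Alt E k) :=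
    { toFun := fun α => LinearMap.toContinuousLinearMap ((altWedge h α).restrictScalars ℝ)
      map_add' := fun α α' => by
        ext β v; simp
      map_smul' := fun c α => by
        ext β v
        have : altWedge h (c • α) = c • altWedge h α := ((altWedge h).restrictScalars ℝ).map_smul c α
        simp [this] }
  exact ((LinearMap.toContinuousLinearMap B).contDiff.comp_contDiffOn hu).clm_apply hv

/-- The action `(c · α)(v₁, …, v_k) = α(c v₁, …, c v_k)` of complex scalars on `k`-forms. -/
def altScale (k : ℕ) (c : ℂ) : Alt E k →ₗ[ℂ] Alt E k :=
  altPullback k ((c • ContinuousLinearMap.id ℂ E).restrictScalars ℝ)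

/-- The projection of `k`-forms onto the component of type `(p,q)`, obtained by averaging over
the `(2k+1)`-th roots of unity. It is `0` unless `p + q = k`. That it is the projection onto the
`(p,q)`-part is the content of `isOfBidegree_altBidegree`, `sum_altBidegree` and
`altBidegree_of_isOfBidegree` below. -/
def altBidegree (p q k : ℕ) : Alt E k →ₗ[ℂ] Alt E k :=
  if p + q = k then
    ((2 * k + 1 : ℂ))⁻¹ • ∑ j ∈ Finset.range (2 * k + 1),
      Complex.exp (2 * Real.pi * Complex.I / (2 * k + 1)) ^ ((j : ℤ) * (q - p)) •
        altScale k (Complex.exp (2 * Real.pi * Complex.I / (2 * k + 1)) ^ j)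
  else 0

theorem exists_type_expansion {k : ℕ} (α : Alt E k) (v : Fin k → E) : ∃ β : ℕ → ℂ, ∀ c : ℂ,
    α (fun i => c • v i) = ∑ m ∈ Finset.range (k + 1), c ^ m * (starRingEnd ℂ c) ^ (k - m) * β m := by
  classical
  let C : Finset (Fin k) → Finset (Fin k) → ℂ := fun s t =>
    (∏ i ∈ t, (if i ∈ s then 1 / 2 else 1 / (2 * Complex.I))) *
      (∏ i ∈ Finset.univ \ t, (if i ∈ s then 1 / 2 else -1 / (2 * Complex.I))) *
      α (s.piecewise v fun i => Complex.I • v i)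
  refine ⟨fun m => ∑ s : Finset (Fin k), ∑ t : Finset (Fin k) with t.card = m, C s t, fun c => ?_⟩
  have h1 : (fun i => c • v i) = (fun i => c.re • v i) + fun i => c.im • Complex.I • v i := by
    funext i
    conv_lhs => rw [← Complex.re_add_im c, add_smul, mul_smul]
    simp
  have h2 : ∀ s : Finset (Fin k),
      α (s.piecewise (fun i => c.re • v i) fun i => c.im • Complex.I • v i) =
        ∑ t : Finset (Fin k), c ^ t.card * (starRingEnd ℂ c) ^ (k - t.card) * C s t := by
    intro s
    have h3 : (s.piecewise (fun i => c.re • v i) fun i => c.im • Complex.I • v i) =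
        fun i => (if i ∈ s then c.re else c.im) • (s.piecewise v fun i => Complex.I • v i) i := by
      funext i
      by_cases hi : i ∈ s <;> simp [hi]
    rw [h3, ContinuousAlternatingMap.map_smul_univ]
    have h4 : ((∏ i, (if i ∈ s then c.re else c.im) : ℝ) : ℂ) =
        ∏ i : Fin k, ((if i ∈ s then 1 / 2 else 1 / (2 * Complex.I)) * c +
          (if i ∈ s then 1 / 2 else -1 / (2 * Complex.I)) * starRingEnd ℂ c) := by
      push_cast
      refine Finset.prod_congr rfl fun i _ => ?_
      split_ifs
      · rw [Complex.re_eq_add_conj]; ring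
      · rw [Complex.im_eq_sub_conj]; ring
    rw [Complex.real_smul, h4, Finset.prod_add, Finset.sum_mul, Finset.powerset_univ]
    refine Finset.sum_congr rfl fun t _ => ?_
    rw [Finset.prod_mul_distrib, Finset.prod_mul_distrib, Finset.prod_const, Finset.prod_const,
      Finset.card_sdiff_of_subset (Finset.subset_univ t), Finset.card_univ, Fintype.card_fin]
    simp only [C]
    ring
  rw [h1, ContinuousAlternatingMap.map_add_univ]
  simp only [h2, Finset.mul_sum]
  rw [Finset.sum_comm]
  simp_rw [Finset.sum_comm (s := Finset.range (k + 1))]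
  rw [Finset.sum_comm]
  refine Finset.sum_congr rfl fun s _ => ?_
  have hm : ∀ t ∈ (Finset.univ : Finset (Finset (Fin k))), t.card ∈ Finset.range (k + 1) := by
    intro t _
    have := Finset.card_le_univ t
    simp only [Fintype.card_fin] at this
    simp; omega
  rw [← Finset.sum_fiberwise_of_maps_to hm]
  refine Finset.sum_congr rfl fun m _ => Finset.sum_congr rfl fun t ht => ?_
  rw [(Finset.mem_filter.1 ht).2]

theorem altBidegree_apply {p q k : ℕ} (hpq : p + q = k) (α : Alt E k) (v : Fin k → E) (β : ℕ → ℂ)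
    (hβ : ∀ c : ℂ, α (fun i => c • v i) =
      ∑ m ∈ Finset.range (k + 1), c ^ m * (starRingEnd ℂ c) ^ (k - m) * β m) :
    altBidegree p q k α v = β p := by
  set N : ℕ := 2 * k + 1 with hN
  set ζ : ℂ := Complex.exp (2 * Real.pi * Complex.I / (2 * k + 1)) with hζ
  have hprim : IsPrimitiveRoot ζ N := by
    have := Complex.isPrimitiveRoot_exp N (by omega)
    rw [hN] at this ⊢
    push_cast at this
    exact this
  have hζ0 : ζ ≠ 0 := Complex.exp_ne_zero _
  have hconj : starRingEnd ℂ ζ = ζ⁻¹ := by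
    rw [hζ, ← Complex.exp_conj, ← Complex.exp_neg]
    congr 1
    simp only [map_div₀, map_mul, Complex.conj_ofReal, Complex.conj_I, map_add, map_one,
      map_ofNat, map_natCast]
    ring
  have hterm : ∀ j : ℕ, ζ ^ ((j : ℤ) * (q - p)) * α (fun i => ζ ^ j • v i) =
      ∑ m ∈ Finset.range (k + 1), (ζ ^ (2 * ((m : ℤ) - p))) ^ j * β m := by
    intro j
    rw [hβ, Finset.mul_sum]
    refine Finset.sum_congr rfl fun m hm => ?_
    have hm' : m ≤ k := by simp at hm; omega
    rw [← mul_assoc]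
    congr 1
    rw [map_pow, hconj, ← zpow_natCast ζ j, ← zpow_natCast _ m, ← zpow_natCast ζ⁻¹ j,
      ← zpow_natCast _ (k - m), ← zpow_natCast _ j, inv_zpow', ← zpow_mul, ← zpow_mul, ← zpow_mul,
      ← zpow_add₀ hζ0, ← zpow_add₀ hζ0]
    congr 1
    push_cast [hm']
    subst hpq
    push_cast
    ring
  have hsum : ∀ m ∈ Finset.range (k + 1),
      ∑ j ∈ Finset.range N, (ζ ^ (2 * ((m : ℤ) - p))) ^ j = if m = p then (N : ℂ) else 0 := by
    intro m hm
    have hm' : m ≤ k := by simp at hm; omega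
    split_ifs with h
    · simp [h]
    · have hne : ζ ^ (2 * ((m : ℤ) - p)) ≠ 1 := by
        intro h1
        obtain ⟨r, hr⟩ := (hprim.zpow_eq_one_iff_dvd _).1 h1
        have hr0 : r = 0 := by
          rw [hN] at hr
          push_cast at hr
          by_contra h0
          rcases lt_or_gt_of_ne h0 with h2 | h2 <;> nlinarith
        rw [hr0] at hr
        omega
      rw [geom_sum_eq hne, ← zpow_natCast, ← zpow_mul, mul_comm, zpow_mul, zpow_natCast,
        hprim.pow_eq_one]
      simp
  have hN0 : (2 * k + 1 : ℂ) = (N : ℂ) := by rw [hN]; push_cast; ring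
  have : altBidegree p q k α v = (N : ℂ)⁻¹ * ∑ j ∈ Finset.range N,
      ζ ^ ((j : ℤ) * (q - p)) * α (fun i => ζ ^ j • v i) := by
    rw [altBidegree, if_pos hpq, ← hN0]
    simp only [LinearMap.smul_apply, LinearMap.sum_apply, ContinuousAlternatingMap.smul_apply,
      ContinuousAlternatingMap.sum_apply, smul_eq_mul]
    rfl
  rw [this]
  simp only [hterm]
  rw [Finset.sum_comm]
  simp only [← Finset.sum_mul]
  rw [Finset.sum_congr rfl fun m hm => by rw [hsum m hm]]
  have hN1 : (N : ℂ) ≠ 0 := by rw [hN]; exact_mod_cast (by omega : 2 * k + 1 ≠ 0)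
  simp only [ite_mul, zero_mul]
  rw [Finset.sum_ite_eq' (Finset.range (k + 1)) p, if_pos (by simp; omega)]
  field_simp

/-- A form `α` is of type `(p,q)` if `p + q = k` and
`α(c v₁, …, c v_k) = c^p c̄^q α(v₁, …, v_k)` for all complex `c`. -/
def IsOfBidegree (p q : ℕ) {k : ℕ} (α : Alt E k) : Prop :=
  p + q = k ∧ ∀ (c : ℂ) (v : Fin k → E),
    α (fun i => c • v i) = c ^ p * (starRingEnd ℂ c) ^ q * α v

theorem isOfBidegree_altBidegree {p q k : ℕ} (hpq : p + q = k) (α : Alt E k) :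
    IsOfBidegree p q (altBidegree p q k α) := by
  refine ⟨hpq, fun c v => ?_⟩
  obtain ⟨β, hβ⟩ := exists_type_expansion α v
  rw [altBidegree_apply hpq α v β hβ, altBidegree_apply hpq α (fun i => c • v i)
    (fun m => c ^ m * (starRingEnd ℂ c) ^ (k - m) * β m)]
  · rw [show k - p = q by omega]
  · intro d
    simp only [smul_smul, hβ, map_mul, mul_pow]
    exact Finset.sum_congr rfl fun m _ => by ring

theorem sum_altBidegree {k : ℕ} (α : Alt E k) :
    ∑ p ∈ Finset.range (k + 1), altBidegree p (k - p) k α = α := by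
  ext v
  obtain ⟨β, hβ⟩ := exists_type_expansion α v
  rw [ContinuousAlternatingMap.sum_apply]
  refine Eq.trans ?_ ((hβ 1).symm.trans (by simp))
  refine Finset.sum_congr rfl fun p hp => ?_
  rw [altBidegree_apply (by simp at hp; omega) α v β hβ]
  simp

theorem altBidegree_of_isOfBidegree {p q k : ℕ} {α : Alt E k} (h : IsOfBidegree p q α)
    (p' q' : ℕ) : altBidegree p' q' k α = if p' = p ∧ q' = q then α else 0 := by
  by_cases hk : p' + q' = k
  · ext v
    rw [altBidegree_apply hk α v (fun m => if m = p then α v else 0)]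
    · have := h.1
      split_ifs with h1 h2 h2
      · rfl
      · exact absurd ⟨h1, by omega⟩ h2
      · exact absurd h2.1 h1
      · rfl
    · intro c
      have := h.1
      rw [h.2 c v]
      simp only [mul_ite, mul_zero]
      rw [Finset.sum_ite_eq' (Finset.range (k + 1)) p, if_pos (by simp; omega),
        show k - p = q by omega]
  · have h1 : ¬ (p' = p ∧ q' = q) := fun h2 => hk (by rw [h2.1, h2.2]; exact h.1)
    rw [altBidegree, if_neg hk, if_neg h1]
    rfl

end Fibre

section Forms
variable (E X : Type*) [NormedAddCommGroup E] [NormedSpace ℂ E] [TopologicalSpace X]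
  [ChartedSpace E X]

/-- A complex manifold is a smooth real manifold. -/
theorem realManifold [IsManifold 𝓘(ℂ, E) ∞ X] : IsManifold 𝓘(ℝ, E) ∞ X := by
  refine isManifold_of_contDiffOn _ _ _ fun e e' he he' => ?_
  have := (contDiffGroupoid ∞ 𝓘(ℂ, E)).compatible he he'
  rw [contDiffGroupoid, mem_groupoid_of_pregroupoid] at this
  simpa [contDiffPregroupoid] using this.1.restrict_scalars ℝ

variable {E X} in
/-- Coordinate changes of a complex manifold are holomorphic. -/
theorem contDiffOn_transition [IsManifold 𝓘(ℂ, E) ∞ X] (e e' : atlas E X) :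
    ContDiffOn ℂ ∞ (e'.1 ∘ e.1.symm) (e.1.symm ≫ₕ e'.1).source := by
  have := (contDiffGroupoid ∞ 𝓘(ℂ, E)).compatible e.2 e'.2
  rw [contDiffGroupoid, mem_groupoid_of_pregroupoid] at this
  simpa [contDiffPregroupoid] using this.1

variable {E X} in
theorem fderiv_transition [IsManifold 𝓘(ℂ, E) ∞ X] (e e' : atlas E X) {z : E}
    (hz : z ∈ (e.1.symm ≫ₕ e'.1).source) :
    fderiv ℝ (e'.1 ∘ e.1.symm) z = (fderiv ℂ (e'.1 ∘ e.1.symm) z).restrictScalars ℝ :=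
  (((contDiffOn_transition e e').contDiffAt
    ((e.1.symm ≫ₕ e'.1).open_source.mem_nhds hz)).differentiableAt
      (by simp)).fderiv_restrictScalars ℝ

/-- Smooth complex valued `k`-forms on the complex manifold `X`: families of smooth
alternating `k`-forms `u e` on the targets of the charts `e` of the atlas, compatible under the
coordinate changes, `u_e = (e′ ∘ e⁻¹)^* u_{e′}`. (Off the target of `e` the function `u e` is `0`, so
that equality of forms is equality of families.) -/
def DiffForm (k : ℕ) : Submodule ℂ (atlas E X → E → Alt E k) where
  carrier := {u |
    (∀ e, ∀ z ∉ e.1.target, u e z = 0) ∧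
    (∀ e, ContDiffOn ℝ ∞ (u e) e.1.target) ∧
    ∀ e e', ∀ z ∈ (e.1.symm ≫ₕ e'.1).source,
      u e z = altPullback k (fderiv ℝ (e'.1 ∘ e.1.symm) z) (u e' (e'.1 (e.1.symm z)))}
  zero_mem' := ⟨fun _ _ _ => rfl, fun _ => contDiffOn_const, fun _ _ _ _ => (map_zero _).symm⟩
  add_mem' := by
    rintro u v ⟨hu₁, hu₂, hu₃⟩ ⟨hv₁, hv₂, hv₃⟩
    refine ⟨fun e z hz => ?_, fun e => (hu₂ e).add (hv₂ e), fun e e' z hz => ?_⟩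
    · simp [hu₁ e z hz, hv₁ e z hz]
    · simp only [Pi.add_apply, map_add, ← hu₃ e e' z hz, ← hv₃ e e' z hz]
  smul_mem' := by
    rintro c u ⟨hu₁, hu₂, hu₃⟩
    refine ⟨fun e z hz => ?_, fun e => (hu₂ e).const_smul c, fun e e' z hz => ?_⟩
    · simp [hu₁ e z hz]
    · simp only [Pi.smul_apply, map_smul, ← hu₃ e e' z hz]

/-- Smooth complex valued differential forms of all degrees on `X`. -/
def Forms : Type _ := (k : ℕ) → DiffForm E X k

instance : AddCommGroup (Forms E X) := inferInstanceAs (AddCommGroup ((k : ℕ) → DiffForm E X k))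

instance : Module ℂ (Forms E X) := inferInstanceAs (Module ℂ ((k : ℕ) → DiffForm E X k))

variable {E X} in
@[simp] theorem Forms.add_apply (u v : Forms E X) (k : ℕ) : (u + v) k = u k + v k := rfl

variable {E X} in
@[simp] theorem Forms.smul_apply (c : ℂ) (u : Forms E X) (k : ℕ) : (c • u) k = c • u k := rfl

variable {E X} in
/-- A `k`-form, regarded as a form of mixed degree. -/
def Forms.single (k : ℕ) (u : DiffForm E X k) : Forms E X := Pi.single k u

variable {E X}

/-- The operator on smooth forms given by a (conjugate-)linear map `T` between the fibres that
commutes with complex linear changes of coordinates. -/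
def mapFibre [FiniteDimensional ℂ E] [IsManifold 𝓘(ℂ, E) ∞ X] {k l : ℕ} {σ : ℂ →+* ℂ}
    (T : Alt E k →ₛₗ[σ] Alt E l) (hσ : ∀ r : ℝ, σ r = r)
    (hT : ∀ (A : E →L[ℂ] E) (α : Alt E k),
      altPullback l (A.restrictScalars ℝ) (T α) = T (altPullback k (A.restrictScalars ℝ) α)) :
    DiffForm E X k →ₛₗ[σ] DiffForm E X l where
  toFun u := ⟨fun e z => T (u.1 e z), by
    refine ⟨fun e z hz => ?_, fun e => ?_, fun e e' z hz => ?_⟩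
    · change T (u.1 e z) = 0
      rw [u.2.1 e z hz, map_zero]
    · let T' : Alt E k →ₗ[ℝ] Alt E l :=
        { toFun := T
          map_add' := T.map_add
          map_smul' := fun c α => by
            have h1 : c • α = (c : ℂ) • α := by ext v; simp
            have h2 : c • T α = (c : ℂ) • T α := by ext v; simp
            rw [RingHom.id_apply, h1, h2, T.map_smulₛₗ, hσ] }
      exact (LinearMap.toContinuousLinearMap T').contDiff.comp_contDiffOn (u.2.2.1 e)
    · change T (u.1 e z) = altPullback l _ (T (u.1 e' _))
      rw [u.2.2.2 e e' z hz, fderiv_transition e e' hz, hT]⟩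
  map_add' u v := by ext e z w; simp
  map_smul' c u := by ext e z w; simp

/-- The exterior derivative `d` on `k`-forms, computed in charts. -/
def formExtDeriv [IsManifold 𝓘(ℂ, E) ∞ X] (k : ℕ) : DiffForm E X k →ₗ[ℂ] DiffForm E X (k + 1) where
  toFun u := ⟨fun e => e.1.target.indicator (extDeriv (u.1 e)), by
    refine ⟨fun e z hz => Set.indicator_of_notMem hz _, fun e => ?_, fun e e' z hz => ?_⟩
    · refine ContDiffOn.congr ?_ fun z hz => Set.indicator_of_mem hz _
      exact (ContinuousAlternatingMap.alternatizeUncurryFinCLM ℝ E ℂ).contDiff.comp_contDiffOn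
        ((u.2.2.1 e).fderiv_of_isOpen e.1.open_target (m := ∞) (by rfl))
    · have hz' := hz
      rw [OpenPartialHomeomorph.trans_source] at hz'
      have hz₂ : e'.1 (e.1.symm z) ∈ e'.1.target := e'.1.map_source hz'.2
      change e.1.target.indicator (extDeriv (u.1 e)) z = altPullback (k + 1) _
        (e'.1.target.indicator (extDeriv (u.1 e')) (e'.1 (e.1.symm z)))
      rw [Set.indicator_of_mem (by simpa using hz'.1), Set.indicator_of_mem hz₂]
      have hev : u.1 e =ᶠ[nhds z] fun w => (u.1 e' ((e'.1 ∘ e.1.symm) w)).compContinuousLinearMap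
          (fderiv ℝ (e'.1 ∘ e.1.symm) w) :=
        Filter.eventuallyEq_of_mem ((e.1.symm ≫ₕ e'.1).open_source.mem_nhds hz)
          fun w hw => u.2.2.2 e e' w hw
      rw [hev.extDeriv_eq]
      refine extDeriv_pullback (r := ∞) ?_ ?_ ?_
      · exact ((u.2.2.1 e').contDiffAt (e'.1.open_target.mem_nhds hz₂)).differentiableAt (by simp)
      · exact ((contDiffOn_transition e e').contDiffAt
          ((e.1.symm ≫ₕ e'.1).open_source.mem_nhds hz)).restrict_scalars ℝ
      · simpa using (WithTop.coe_le_coe.2 le_top : ((2 : ℕ∞) : WithTop ℕ∞) ≤ ∞)⟩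
  map_add' u v := by
    ext1
    funext e z
    by_cases hz : z ∈ e.1.target
    · have hd : ∀ w : DiffForm E X k, DifferentiableAt ℝ (w.1 e) z := fun w =>
        ((w.2.2.1 e).contDiffAt (e.1.open_target.mem_nhds hz)).differentiableAt (by simp)
      simp only [Submodule.coe_add, Pi.add_apply, Set.indicator_of_mem hz]
      exact extDeriv_add (hd u) (hd v)
    · simp [Set.indicator_of_notMem hz]
  map_smul' c u := by
    ext1
    funext e z
    by_cases hz : z ∈ e.1.target
    · simp only [RingHom.id_apply, Submodule.coe_smul, Pi.smul_apply, Set.indicator_of_mem hz]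
      have hd := ((u.2.2.1 e).contDiffAt (e.1.open_target.mem_nhds hz)).differentiableAt
        (n := ∞) (by simp)
      rw [extDeriv, fderiv_const_smul hd]
      exact ContinuousAlternatingMap.alternatizeUncurryFin_smul c _
    · simp only [RingHom.id_apply, Submodule.coe_smul, Pi.smul_apply,
        Set.indicator_of_notMem hz]
      exact (smul_zero (A := Alt E (k + 1)) c).symm

theorem altPullback_altScale {k : ℕ} (A : E →L[ℂ] E) (c : ℂ) (α : Alt E k) :
    altPullback k (A.restrictScalars ℝ) (altScale k c α) =
      altScale k c (altPullback k (A.restrictScalars ℝ) α) := by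
  ext v
  change α (fun i => c • A (v i)) = α (fun i => A (c • v i))
  simp

/-- The wedge product of smooth forms of degrees `a` and `b`. -/
def wedgeForm [FiniteDimensional ℂ E] {a b k : ℕ} (h : a + b = k) :
    DiffForm E X a →ₗ[ℂ] DiffForm E X b →ₗ[ℂ] DiffForm E X k :=
  LinearMap.mk₂ ℂ
    (fun α β => ⟨fun e z => altWedge h (α.1 e z) (β.1 e z), by
      refine ⟨fun e z hz => ?_, fun e => ?_, fun e e' z hz => ?_⟩
      · change altWedge h (α.1 e z) (β.1 e z) = 0
        rw [α.2.1 e z hz, map_zero, LinearMap.zero_apply]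
      · exact contDiffOn_altWedge h (α.2.2.1 e) (β.2.2.1 e)
      · change altWedge h (α.1 e z) (β.1 e z) =
          altPullback k _ (altWedge h (α.1 e' _) (β.1 e' _))
        rw [α.2.2.2 e e' z hz, β.2.2.2 e e' z hz, altPullback_wedge]⟩)
    (fun α α' β => by ext e z v; simp)
    (fun c α β => by ext e z v; simp)
    (fun α β β' => by ext e z v; simp)
    (fun c α β => by ext e z v; simp)

/-- The operator `β ↦ α ∧ β` of left wedge multiplication by a form `α`. -/
def wedge [FiniteDimensional ℂ E] (α : Forms E X) : Module.End ℂ (Forms E X) where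
  toFun β := fun k => ∑ p ∈ (Finset.HasAntidiagonal.antidiagonal k).attach,
    wedgeForm (Finset.HasAntidiagonal.mem_antidiagonal.1 p.2) (α p.1.1) (β p.1.2)
  map_add' β β' := funext fun k => by
    refine Eq.trans ?_ (Finset.sum_add_distrib (M := DiffForm E X k))
    exact Finset.sum_congr rfl fun p _ => map_add (wedgeForm _ (α p.1.1)) (β p.1.2) (β' p.1.2)
  map_smul' c β := funext fun k => by
    refine Eq.trans ?_ (Finset.smul_sum (N := DiffForm E X k) (r := c)).symm
    exact Finset.sum_congr rfl fun p _ => map_smul (wedgeForm _ (α p.1.1)) c (β p.1.2)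

/-- The exterior derivative `d` on forms of all degrees. -/
def extD [IsManifold 𝓘(ℂ, E) ∞ X] : Module.End ℂ (Forms E X) where
  toFun u := fun
    | 0 => 0
    | k + 1 => formExtDeriv k (u k)
  map_add' u v := funext fun
    | 0 => (add_zero (0 : DiffForm E X 0)).symm
    | k + 1 => map_add (formExtDeriv k) (u k) (v k)
  map_smul' c u := funext fun
    | 0 => (smul_zero (A := DiffForm E X 0) c).symm
    | k + 1 => map_smul (formExtDeriv k) c (u k)

section
variable [FiniteDimensional ℂ E] [IsManifold 𝓘(ℂ, E) ∞ X]

variable (E X) in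
/-- Complex conjugation `u ↦ ū` of forms. -/
def conjForm : Forms E X →ₛₗ[starRingEnd ℂ] Forms E X where
  toFun u := fun k => mapFibre (altConj k) (fun r => Complex.conj_ofReal r)
    (fun _ _ => rfl) (u k)
  map_add' u v := funext fun k => (mapFibre _ _ _).map_add (u k) (v k)
  map_smul' c u := funext fun k => (mapFibre _ _ _).map_smulₛₗ c (u k)

/-- The conjugate operator `Ā`, defined by `Ā u = conj (A ū)`. -/
def conjOp (A : Module.End ℂ (Forms E X)) : Module.End ℂ (Forms E X) :=
  (conjForm E X).comp (LinearMap.comp A (conjForm E X))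

variable (E X) in
/-- The projection of forms onto their component of bidegree `(p,q)`. -/
def bidegree (p q : ℕ) : Module.End ℂ (Forms E X) where
  toFun u := fun k => mapFibre (altBidegree p q k) (fun _ => rfl)
    (fun A α => by
      unfold altBidegree
      split_ifs with h
      · simp [altPullback_altScale]
      · simp) (u k)
  map_add' u v := funext fun k => (mapFibre _ _ _).map_add (u k) (v k)
  map_smul' c u := funext fun k => (mapFibre _ _ _).map_smulₛₗ c (u k)

end

/-- A smooth function is smooth in every chart. -/
theorem contDiffOn_comp_chart_symm [IsManifold 𝓘(ℂ, E) ∞ X] (f : C^∞⟮𝓘(ℝ, E), X; 𝓘(ℝ, ℝ), ℝ⟯)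
    (e : atlas E X) : ContDiffOn ℝ ∞ (fun z => f (e.1.symm z)) e.1.target := by
  have := realManifold E X
  have h := contMDiffOn_symm_of_mem_maximalAtlas (I := 𝓘(ℝ, E)) (n := ∞)
    (IsManifold.subset_maximalAtlas e.2)
  exact contMDiffOn_iff_contDiffOn.1 (f.contMDiff.comp_contMDiffOn h)

/-- Multiplication of forms by a smooth real function. -/
def mulFn [IsManifold 𝓘(ℂ, E) ∞ X] (f : C^∞⟮𝓘(ℝ, E), X; 𝓘(ℝ, ℝ), ℝ⟯) :
    Module.End ℂ (Forms E X) where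
  toFun u := fun k => ⟨fun e z => f (e.1.symm z) • (u k).1 e z, by
    refine ⟨fun e z hz => ?_, fun e => ?_, fun e e' z hz => ?_⟩
    · change f (e.1.symm z) • (u k).1 e z = 0
      rw [(u k).2.1 e z hz]
      exact smul_zero (A := Alt E k) (f (e.1.symm z))
    · exact (contDiffOn_comp_chart_symm f e).smul ((u k).2.2.1 e)
    · change f (e.1.symm z) • (u k).1 e z =
        altPullback k _ (f (e'.1.symm (e'.1 (e.1.symm z))) • (u k).1 e' _)
      rw [e'.1.left_inv (by simpa using hz.2), (u k).2.2.2 e e' z hz]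
      rfl⟩
  map_add' u v := by
    funext k
    ext e z w
    change f (e.1.symm z) • ((u k).1 e z w + (v k).1 e z w) =
      f (e.1.symm z) • (u k).1 e z w + f (e.1.symm z) • (v k).1 e z w
    exact smul_add _ _ _
  map_smul' c u := by
    funext k
    ext e z w
    change f (e.1.symm z) • (c • (u k).1 e z w) = c • (f (e.1.symm z) • (u k).1 e z w)
    exact smul_comm _ _ _

/-- A smooth real function, regarded as a `0`-form. -/
def fnForm [IsManifold 𝓘(ℂ, E) ∞ X] (f : C^∞⟮𝓘(ℝ, E), X; 𝓘(ℝ, ℝ), ℝ⟯) : Forms E X :=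
  Forms.single 0 ⟨fun e => e.1.target.indicator fun z =>
      ContinuousAlternatingMap.constOfIsEmpty ℝ E (Fin 0) (f (e.1.symm z) : ℂ), by
    refine ⟨fun e z hz => Set.indicator_of_notMem hz _, fun e => ?_, fun e e' z hz => ?_⟩
    · refine ContDiffOn.congr ?_ fun z hz => Set.indicator_of_mem hz _
      exact (ContinuousAlternatingMap.constOfIsEmptyLIE ℝ E ℂ (Fin 0)).contDiff.comp_contDiffOn
        (Complex.ofRealCLM.contDiff.comp_contDiffOn (contDiffOn_comp_chart_symm f e))
    · have hz' := hz
      rw [OpenPartialHomeomorph.trans_source] at hz'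
      change e.1.target.indicator _ z = altPullback 0 _
        (e'.1.target.indicator _ (e'.1 (e.1.symm z)))
      rw [Set.indicator_of_mem (by simpa using hz'.1),
        Set.indicator_of_mem (e'.1.map_source hz'.2), e'.1.left_inv hz'.2]
      rfl⟩

theorem ne_zero_of_sign {η : C^∞⟮𝓘(ℝ, E), X; 𝓘(ℝ, ℝ), ℝ⟯}
    (hη : (∀ x, 0 < η x) ∨ ∀ x, η x < 0) (x : X) : η x ≠ 0 :=
  hη.elim (fun h => (h x).ne') fun h => (h x).ne

/-- The function `1 / f` for a nowhere vanishing smooth function `f`. -/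
def invFn (f : C^∞⟮𝓘(ℝ, E), X; 𝓘(ℝ, ℝ), ℝ⟯) (hf : ∀ x, f x ≠ 0) :
    C^∞⟮𝓘(ℝ, E), X; 𝓘(ℝ, ℝ), ℝ⟯ :=
  ⟨fun x => (f x)⁻¹, f.contMDiff.inv₀ hf⟩

section
variable [FiniteDimensional ℂ E] [IsManifold 𝓘(ℂ, E) ∞ X]

variable (E X) in
/-- The operator `∂`: on forms of bidegree `(p,q)`, the component of bidegree `(p+1,q)`
of `d`. -/
def del : Module.End ℂ (Forms E X) :=
  ∑ p ∈ Finset.range (Module.finrank ℂ E + 1), ∑ q ∈ Finset.range (Module.finrank ℂ E + 1),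
    bidegree E X (p + 1) q * extD * bidegree E X p q

variable (E X) in
/-- The operator `∂̄`: on forms of bidegree `(p,q)`, the component of bidegree `(p,q+1)`
of `d`. -/
def delbar : Module.End ℂ (Forms E X) :=
  ∑ p ∈ Finset.range (Module.finrank ℂ E + 1), ∑ q ∈ Finset.range (Module.finrank ℂ E + 1),
    bidegree E X p (q + 1) * extD * bidegree E X p q

/-- The twisted operator `D^{0,1}_η`, which on forms of bidegree `(p,q)` is
`∂̄ - (p/η) ∂̄η ∧ ·`. -/
def twistedDelbar (η : C^∞⟮𝓘(ℝ, E), X; 𝓘(ℝ, ℝ), ℝ⟯)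
    (hη : (∀ x, 0 < η x) ∨ ∀ x, η x < 0) :
    Module.End ℂ (Forms E X) :=
  ∑ p ∈ Finset.range (Module.finrank ℂ E + 1), ∑ q ∈ Finset.range (Module.finrank ℂ E + 1),
    (delbar E X - (p : ℂ) • (mulFn (invFn η (ne_zero_of_sign hη)) * wedge (delbar E X (fnForm η)))) *
      bidegree E X p q
end

end Forms

/-- A Hermitian metric on the complex manifold `X`, given by its fundamental form `ω`: a
smooth, real, positive definite form of type `(1,1)`. -/
structure HermitianMetric (E X : Type*) [NormedAddCommGroup E] [NormedSpace ℂ E]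
    [TopologicalSpace X] [ChartedSpace E X] where
  /-- The fundamental form `ω`. -/
  form : DiffForm E X 2
  /-- The form is real. -/
  real : ∀ e z v, (form.1 e z v).im = 0
  /-- The form is of type `(1,1)`, i.e. invariant under the complex structure. -/
  type_one_one : ∀ e z (v w : E),
    form.1 e z ![Complex.I • v, Complex.I • w] = form.1 e z ![v, w]
  /-- The form is positive definite: `ω(v, i v) > 0` for `v ≠ 0`. -/
  pos : ∀ e, ∀ z ∈ e.1.target, ∀ v : E, v ≠ 0 → 0 < (form.1 e z ![v, Complex.I • v]).re

/-- The graded commutator `[A, B] = A B - (-1)^{ab} B A` of operators `A`, `B` of degrees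
`a`, `b`. -/
def gradedBracket {V : Type*} [AddCommGroup V] [Module ℂ V] (a b : ℤ) (A B : Module.End ℂ V) :
    Module.End ℂ V :=
  A * B - (-1 : ℂ) ^ (a * b) • (B * A)

section Hermitian
variable {E X : Type*} [NormedAddCommGroup E] [NormedSpace ℂ E] [FiniteDimensional ℂ E]
  [MeasurableSpace E] [BorelSpace E]
  [TopologicalSpace X] [ChartedSpace E X] [IsManifold 𝓘(ℂ, E) ∞ X]
  [MeasurableSpace X] [BorelSpace X] (g : HermitianMetric E X)

/-- The Lefschetz operator `L = ω ∧ ·`. -/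
def lefschetz : Module.End ℂ (Forms E X) := wedge (Forms.single 2 g.form)

/-- The Gram matrix, in the real coordinates of a chart given by a fixed real basis of `E`, of
the Riemannian metric `g(v,w) = ω(v, i w)`. -/
def gram (e : atlas E X) (z : E) :
    Matrix (Fin (Module.finrank ℝ E)) (Fin (Module.finrank ℝ E)) ℝ :=
  Matrix.of fun i j =>
    (g.form.1 e z ![Module.finBasis ℝ E i, Complex.I • Module.finBasis ℝ E j]).re

/-- The pointwise Hermitian inner product of `k`-forms induced by the metric,
`⟨α, β⟩ = (1/k!) ∑ g^{i₁j₁} ⋯ g^{i_kj_k} α_{i₁…i_k} conj β_{j₁…j_k}`; with respect to a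
`g`-orthonormal real coframe the forms `e^{i₁} ∧ ⋯ ∧ e^{i_k}`, `i₁ < ⋯ < i_k`, are orthonormal. -/
def altInner (e : atlas E X) (z : E) (k : ℕ) (α β : Alt E k) : ℂ :=
  (k.factorial : ℂ)⁻¹ * ∑ i : Fin k → Fin (Module.finrank ℝ E),
    ∑ j : Fin k → Fin (Module.finrank ℝ E),
      (∏ l, ((gram g e z)⁻¹ (i l) (j l) : ℂ)) *
        (α (fun l => Module.finBasis ℝ E (i l)) *
          starRingEnd ℂ (β fun l => Module.finBasis ℝ E (j l)))

/-- The Riemannian volume `√(det g) dx` on the domain of a chart, as a measure on `X` that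
vanishes outside this domain. -/
def chartVolume (e : atlas E X) : MeasureTheory.Measure X :=
  (((Module.finBasis ℝ E).addHaar.restrict e.1.target).withDensity fun z =>
    ENNReal.ofReal (Real.sqrt (gram g e z).det)).map e.1.symm

/-- The volume measure `dV_ω = ω^n / n!`. The measures of the individual charts agree on the
overlaps, so that their supremum is the measure that restricts to each of them. -/
def volumeMeasure : MeasureTheory.Measure X := ⨆ e : atlas E X, chartVolume g e

/-- The preferred chart at a point, as an element of the atlas. -/
def prefChart (x : X) : atlas E X := ⟨chartAt E x, chart_mem_atlas E x⟩

/-- The pointwise inner product `⟨u, v⟩_ω(x)` of forms, forms of different degrees being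
orthogonal (there are no nonzero forms of degree greater than `2n`). -/
def pointInner (u v : Forms E X) (x : X) : ℂ :=
  ∑ k ∈ Finset.range (2 * Module.finrank ℂ E + 1),
    altInner g (prefChart x) (chartAt E x x) k
      ((u k).1 (prefChart x) (chartAt E x x)) ((v k).1 (prefChart x) (chartAt E x x))

/-- The `L²` inner product `⟪u, v⟫_ω = ∫_X ⟨u, v⟩_ω dV_ω`. -/
def l2Inner (u v : Forms E X) : ℂ := ∫ x, pointInner g u v x ∂(volumeMeasure g)

/-- The support of a form. -/
def formSupport (u : Forms E X) : Set X :=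
  closure {x | ∃ k, (u k).1 (prefChart x) (chartAt E x x) ≠ 0}

/-- `B` is the formal adjoint of `A`: `⟪A u, v⟫ = ⟪u, B v⟫` for all smooth forms `u`, `v` with
`u` compactly supported. -/
def IsFormalAdjoint (A B : Module.End ℂ (Forms E X)) : Prop :=
  ∀ u v : Forms E X, IsCompact (formSupport u) → l2Inner g (A u) v = l2Inner g u (B v)

open Classical in
/-- The formal adjoint `A⋆` of an operator `A` (and `0` if `A` has none). -/
def formalAdjoint (A : Module.End ℂ (Forms E X)) : Module.End ℂ (Forms E X) :=
  if h : ∃ B, IsFormalAdjoint g A B then h.choose else 0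

/-- The operator `Λ = L⋆`. -/
def lefschetzAdjoint : Module.End ℂ (Forms E X) := formalAdjoint g (lefschetz g)

/-- The twisted torsion operator `τ^{0,1}_η = [Λ, D^{0,1}_η ω ∧ ·]`. -/
def twistedTorsion (η : C^∞⟮𝓘(ℝ, E), X; 𝓘(ℝ, ℝ), ℝ⟯)
    (hη : (∀ x, 0 < η x) ∨ ∀ x, η x < 0) :
    Module.End ℂ (Forms E X) :=
  gradedBracket (-2) 3 (lefschetzAdjoint g) (wedge (twistedDelbar η hη (Forms.single 2 g.form)))

/-- The Laplacian `Δ″_η = [D, D⋆]` of the twisted operator `D = D^{0,1}_η`. -/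
def twistedLaplacianDelbar (η : C^∞⟮𝓘(ℝ, E), X; 𝓘(ℝ, ℝ), ℝ⟯)
    (hη : (∀ x, 0 < η x) ∨ ∀ x, η x < 0) : Module.End ℂ (Forms E X) :=
  gradedBracket 1 (-1) (twistedDelbar η hη) (formalAdjoint g (twistedDelbar η hη))

/-- The Laplacian `Δ′_η = [D̄, D̄⋆]` of the conjugate `D̄` of the twisted operator
`D = D^{0,1}_η`. -/
def twistedLaplacianDel (η : C^∞⟮𝓘(ℝ, E), X; 𝓘(ℝ, ℝ), ℝ⟯)
    (hη : (∀ x, 0 < η x) ∨ ∀ x, η x < 0) : Module.End ℂ (Forms E X) :=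
  gradedBracket 1 (-1) (conjOp (twistedDelbar η hη)) (formalAdjoint g (conjOp (twistedDelbar η hη)))

end Hermitian

end TwistedBKN

end

open TwistedBKN

open scoped Manifold ContDiff
open TwistedBKN

noncomputable section
set_option linter.unusedSectionVars false
set_option linter.unusedSimpArgs false
set_option maxSynthPendingDepth 3

namespace TwistedBKN

/-! ### Exterior multiplication by covectors and contraction with vectors. -/

section FibreAlgebra
variable {E : Type*} [NormedAddCommGroup E] [NormedSpace ℂ E]

/-! Write D for the twisted operator, L = ω ∧ ·, θ = η⁻¹ ∂̄η ∧ ·, P for the operator that multiplies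
(p,q)-forms by p, and Q for its conjugate, which multiplies them by q. Then D = ∂̄ - θP, and the
theorem is a formal consequence of one commutation relation, `twistedDelbarAdj_eq`: D⋆ = -i[Λ, D̄] -
τ⋆ + n i[θ̄, Λ], with τ the twisted torsion. Its conjugate is D̄⋆ = i[Λ, D] - τ̄⋆ - n i[θ, Λ]. When
both are inserted into [D, D⋆] - [D̄, D̄⋆], the torsion terms and the terms with n appear as stated,
and the rest, -i[D, [Λ, D̄]] - i[D̄, [Λ, D]], equals i[[D, D̄], Λ] by the Jacobi identity.

The analytic core is the untwisted relation ∂̄⋆ = -i[Λ, ∂] - [(∂̄ω ∧ ·)⋆, L], proved in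
`isFormalAdjoint_delbar` without normal coordinates. At a given point of a chart, choose a complex
basis of `E` that is unitary there. Multiplications by dz_a, dz̄_a and contractions with ∂/∂z_a,
∂/∂z̄_a satisfy the canonical anticommutation relations. The flux θ ↦ √(det g)⟨θ ∧ u, v⟩, restricted
to antilinear covectors, has a divergence of integral zero. Its expansion in the frame is ⟨∂̄u, v⟩
minus ⟨u, Bv⟩ up to the density, where B contains first derivatives of v, of the metric on forms and
of the density (`sum_antiPart_fderiv_flux`). That B is the asserted commutator is an algebraic
identity, linear in the first derivatives of the metric coefficients (`CAR.kahler_identity`). No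
symmetry among these derivatives is needed: what would vanish for a Kähler metric is carried by ∂̄ω.

The twist is then pure algebra. Pointwise one has [Λ, θ̄] = -iθ⋆, [θ⋆, L] = -iθ̄ and [Λ, L] = n - P
- Q. The form ω has type (1,1), so Dω = ∂̄ω - θω, and the twisted torsion gains the term with θ ∧ ω.
Moving L through Λθ⋆ produces the summand nθ⋆ that the last term of the relation cancels.

Operators of order zero have adjoints on each fibre, smooth by linear algebra and independent of the
chart by uniqueness (`exists_wedge_adjoint`). For ∂̄ the divergence theorem is applied in charts
after a partition of unity. A formal adjoint is unique because a form orthogonal to all compactly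
supported forms vanishes, as is seen by testing it against itself times a bump function. -/

@[simp] theorem alt_zero_smul {k : ℕ} (α : Alt E k) : (0 : ℂ) • α = 0 := zero_smul ℂ α
@[simp] theorem alt_smul_zero {k : ℕ} (c : ℂ) : c • (0 : Alt E k) = 0 := smul_zero (A := Alt E k) c

variable (E) in
/-- The fibre of the bundle of forms of all degrees. -/
def Fib : Type _ := (k : ℕ) → Alt E k

instance : AddCommGroup (Fib E) := inferInstanceAs (AddCommGroup ((k : ℕ) → Alt E k))
instance : Module ℂ (Fib E) := inferInstanceAs (Module ℂ ((k : ℕ) → Alt E k))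
instance : Module ℝ (Fib E) := Module.complexToReal _

@[simp] theorem Fib.zero_apply (k : ℕ) : (0 : Fib E) k = 0 := rfl
@[simp] theorem Fib.add_apply (u v : Fib E) (k : ℕ) : (u + v) k = u k + v k := rfl
@[simp] theorem Fib.neg_apply (u : Fib E) (k : ℕ) : (-u) k = -u k := rfl
@[simp] theorem Fib.sub_apply (u v : Fib E) (k : ℕ) : (u - v) k = u k - v k := rfl
@[simp] theorem Fib.smul_apply (c : ℂ) (u : Fib E) (k : ℕ) : (c • u) k = c • u k := rfl

@[simp] theorem Fib.sum_apply {ι : Type*} (s : Finset ι) (f : ι → Fib E) (k : ℕ) :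
    (∑ i ∈ s, f i) k = ∑ i ∈ s, f i k :=
  Finset.sum_apply (M := fun k => Alt E k) k s f

theorem Fib.ext {u v : Fib E} (h : ∀ k, u k = v k) : u = v := funext h

/-- A `k`-form, regarded as a form of mixed degree. -/
def Fib.single (k : ℕ) (α : Alt E k) : Fib E := Pi.single k α

@[simp] theorem Fib.single_same (k : ℕ) (α : Alt E k) : Fib.single k α k = α := Pi.single_eq_same ..

theorem Fib.single_ne {k l : ℕ} (h : l ≠ k) (α : Alt E k) : Fib.single k α l = 0 :=
  Pi.single_eq_of_ne h _

/-- Exterior multiplication `θ ∧ ·` of `k`-forms by a covector. -/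
def altExt (θ : E →L[ℝ] ℂ) (k : ℕ) : Alt E k →ₗ[ℂ] Alt E (k + 1) where
  toFun α := ContinuousAlternatingMap.alternatizeUncurryFin (θ.smulRight α)
  map_add' α β := by
    rw [← ContinuousAlternatingMap.alternatizeUncurryFin_add]
    congr 1; ext v w; simp
  map_smul' c α := by
    rw [RingHom.id_apply, ← ContinuousAlternatingMap.alternatizeUncurryFin_smul]
    congr 1; ext v w; simp; ring

theorem altExt_apply (θ : E →L[ℝ] ℂ) {k : ℕ} (α : Alt E k) (v : Fin (k + 1) → E) :
    altExt θ k α v = ∑ i : Fin (k + 1), (-1 : ℂ) ^ (i : ℕ) * (θ (v i) * α (i.removeNth v)) := by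
  change ContinuousAlternatingMap.alternatizeUncurryFin _ v = _
  rw [ContinuousAlternatingMap.alternatizeUncurryFin_apply]
  refine Finset.sum_congr rfl fun i _ => ?_
  simp [zsmul_eq_mul]

/-- Contraction of `k + 1`-forms with a vector. -/
def altInt (v : E) (k : ℕ) : Alt E (k + 1) →ₗ[ℂ] Alt E k where
  toFun α := α.curryLeft v
  map_add' _ _ := rfl
  map_smul' _ _ := rfl

theorem altInt_apply (v : E) {k : ℕ} (α : Alt E (k + 1)) (w : Fin k → E) :
    altInt v k α w = α (Matrix.vecCons v w) := rfl

/-- Contraction lowers the degree by one, so identities between forms can be proved by induction on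
the degree. The anticommutation of two exterior multiplications follows in this way from the
antiderivation rule `altInt_altExt_succ`. -/
theorem alt_ext_int {k : ℕ} {α β : Alt E (k + 1)} (h : ∀ v, altInt v k α = altInt v k β) :
    α = β := by
  ext w
  have := congrArg (fun γ : Alt E k => γ (Fin.tail w)) (h (w 0))
  simp only [altInt_apply] at this
  rwa [show Matrix.vecCons (w 0) (Fin.tail w) = w from Fin.cons_self_tail w] at this

theorem altInt_altExt_zero (v : E) (θ : E →L[ℝ] ℂ) (α : Alt E 0) :
    altInt v 0 (altExt θ 0 α) = θ v • α := by
  ext w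
  rw [altInt_apply, altExt_apply]
  simp

/-- In the expansion of θ ∧ α, one term feeds v to θ. In all others v stays in the first slot of α,
and the position of the argument of θ is shifted by one, whence the minus sign. -/
theorem altInt_altExt_succ (v : E) (θ : E →L[ℝ] ℂ) {k : ℕ} (α : Alt E (k + 1)) :
    altInt v (k + 1) (altExt θ (k + 1) α) = θ v • α - altExt θ k (altInt v k α) := by
  ext w
  rw [altInt_apply, altExt_apply, Fin.sum_univ_succ, ContinuousAlternatingMap.sub_apply,
    altExt_apply, sub_eq_add_neg, ← Finset.sum_neg_distrib]
  congr 1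
  · simp
  · refine Finset.sum_congr rfl fun i _ => ?_
    rw [altInt_apply]
    have : (i.succ).removeNth (Matrix.vecCons v w) = Matrix.vecCons v (i.removeNth w) := by
      funext j
      refine Fin.cases ?_ (fun j => ?_) j
      · simp [Fin.removeNth]
      · simp [Fin.removeNth]
    rw [this]
    simp [pow_succ]

theorem altInt_altInt (v w : E) {k : ℕ} (α : Alt E (k + 2)) :
    altInt v k (altInt w (k + 1) α) = -altInt w k (altInt v (k + 1) α) := by
  ext x
  rw [ContinuousAlternatingMap.neg_apply]
  simp only [altInt_apply]
  have : α _ = -α _ := α.toAlternatingMap.map_swap (Matrix.vecCons w (Matrix.vecCons v x)) (i := 0) (j := 1) (by simp)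
  rw [← neg_eq_iff_eq_neg, ← this]
  congr 1
  funext j
  refine Fin.cases ?_ (fun j => ?_) j
  · simp
  · refine Fin.cases ?_ (fun j => ?_) j
    · simp
    · rw [Function.comp_apply, Equiv.swap_apply_of_ne_of_ne]
      · rfl
      · exact Fin.succ_ne_zero _
      · intro h
        have := congrArg Fin.val h
        simp at this

theorem altExt_altExt (θ φ : E →L[ℝ] ℂ) {k : ℕ} (α : Alt E k) :
    altExt θ (k + 1) (altExt φ k α) + altExt φ (k + 1) (altExt θ k α) = 0 := by
  induction k with
  | zero =>
    refine alt_ext_int fun v => ?_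
    rw [map_add, altInt_altExt_succ, altInt_altExt_succ, altInt_altExt_zero, altInt_altExt_zero]
    simp
  | succ k ih =>
    refine alt_ext_int fun v => ?_
    rw [map_add, altInt_altExt_succ, altInt_altExt_succ, altInt_altExt_succ, altInt_altExt_succ]
    simp only [map_sub, map_smul, map_zero]
    have h := ih (altInt v k α)
    rw [add_eq_zero_iff_eq_neg] at h
    rw [h]
    abel

theorem altExt_add (θ φ : E →L[ℝ] ℂ) {k : ℕ} (α : Alt E k) :
    altExt (θ + φ) k α = altExt θ k α + altExt φ k α := by
  ext v
  simp only [altExt_apply, ContinuousAlternatingMap.add_apply, _root_.add_apply,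
    ← Finset.sum_add_distrib]
  exact Finset.sum_congr rfl fun i _ => by ring

theorem altExt_smul (c : ℂ) (θ : E →L[ℝ] ℂ) {k : ℕ} (α : Alt E k) :
    altExt (c • θ) k α = c • altExt θ k α := by
  ext v
  simp only [altExt_apply, ContinuousAlternatingMap.smul_apply, _root_.smul_apply,
    smul_eq_mul, Finset.mul_sum]
  exact Finset.sum_congr rfl fun i _ => by ring

/-- Exterior multiplication by a covector on forms of all degrees. -/
def fibExt : (E →L[ℝ] ℂ) →ₗ[ℂ] Module.End ℂ (Fib E) where
  toFun θ :=
    { toFun := fun u k => match k with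
        | 0 => 0
        | k + 1 => altExt θ k (u k)
      map_add' := fun u v => funext fun k => match k with
        | 0 => (add_zero (0 : Alt E 0)).symm
        | k + 1 => map_add (altExt θ k) (u k) (v k)
      map_smul' := fun c u => funext fun k => match k with
        | 0 => (smul_zero (A := Alt E 0) c).symm
        | k + 1 => map_smul (altExt θ k) c (u k) }
  map_add' θ φ := by
    refine LinearMap.ext fun u => funext fun k => ?_
    cases k with
    | zero => exact (add_zero (0 : Alt E 0)).symm
    | succ k => exact altExt_add θ φ (u k)
  map_smul' c θ := by
    refine LinearMap.ext fun u => funext fun k => ?_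
    cases k with
    | zero => exact (smul_zero (A := Alt E 0) c).symm
    | succ k => exact altExt_smul c θ (u k)

@[simp] theorem fibExt_zero (θ : E →L[ℝ] ℂ) (u : Fib E) : fibExt θ u 0 = 0 := rfl
@[simp] theorem fibExt_succ (θ : E →L[ℝ] ℂ) (u : Fib E) (k : ℕ) :
    fibExt θ u (k + 1) = altExt θ k (u k) := rfl

/-- Contraction with a vector on forms of all degrees. -/
def fibInt : E →ₗ[ℝ] Module.End ℂ (Fib E) where
  toFun v :=
    { toFun := fun u k => altInt v k (u (k + 1))
      map_add' := fun u w => funext fun k => map_add (altInt v k) (u (k + 1)) (w (k + 1))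
      map_smul' := fun c u => funext fun k => map_smul (altInt v k) c (u (k + 1)) }
  map_add' v w := by
    refine LinearMap.ext fun u => funext fun k => ?_
    exact (u (k + 1)).curryLeft.map_add v w
  map_smul' c v := by
    refine LinearMap.ext fun u => funext fun k => ?_
    refine ((u (k + 1)).curryLeft.map_smul c v).trans ?_
    ext w
    exact Complex.real_smul

@[simp] theorem fibInt_apply (v : E) (u : Fib E) (k : ℕ) :
    fibInt v u k = altInt v k (u (k + 1)) := rfl

theorem fibInt_mul_fibExt (v : E) (θ : E →L[ℝ] ℂ) :
    fibInt v * fibExt θ + fibExt θ * fibInt v = θ v • (1 : Module.End ℂ (Fib E)) := by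
  refine LinearMap.ext fun u => funext fun k => ?_
  cases k with
  | zero =>
    change altInt v 0 (altExt θ 0 (u 0)) + 0 = θ v • u 0
    rw [altInt_altExt_zero, add_zero]
  | succ k =>
    change altInt v (k + 1) (altExt θ (k + 1) (u (k + 1))) + altExt θ k (altInt v k (u (k + 1))) =
      θ v • u (k + 1)
    rw [altInt_altExt_succ, sub_add_cancel]

theorem fibInt_mul_fibInt (v w : E) :
    fibInt v * fibInt w + fibInt w * fibInt v = (0 : Module.End ℂ (Fib E)) := by
  refine LinearMap.ext fun u => funext fun k => ?_
  change altInt v k (altInt w (k + 1) (u (k + 2))) + altInt w k (altInt v (k + 1) (u (k + 2))) =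
    (0 : Alt E k)
  rw [altInt_altInt, neg_add_cancel]

theorem fibExt_mul_fibExt (θ φ : E →L[ℝ] ℂ) :
    fibExt θ * fibExt φ + fibExt φ * fibExt θ = (0 : Module.End ℂ (Fib E)) := by
  refine LinearMap.ext fun u => funext fun k => ?_
  match k with
  | 0 => exact add_zero (0 : Alt E 0)
  | 1 =>
    change altExt θ 0 0 + altExt φ 0 0 = (0 : Alt E 1)
    rw [map_zero, map_zero, add_zero]
  | k + 2 => exact altExt_altExt θ φ (u k)

/-- Euler's formula `∑ⱼ bʲ ∧ ι_{bⱼ} α = k α`. -/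
theorem sum_altExt_altInt {ι : Type*} [Fintype ι] (b : Module.Basis ι ℝ E)
    (β : ι → E →L[ℝ] ℂ) (hβ : ∀ i v, β i v = (b.repr v i : ℂ)) {k : ℕ} (α : Alt E (k + 1)) :
    ∑ i, altExt (β i) k (altInt (b i) k α) = ((k + 1 : ℕ) : ℂ) • α := by
  -- Expanding the argument that is split off in the basis shows that the sum antisymmetrizes v ↦
  -- ι_v α. Since α is alternating already, all k + 1 terms of that antisymmetrization agree.
  have h1 : ∑ i, altExt (β i) k (altInt (b i) k α) =
      ContinuousAlternatingMap.alternatizeUncurryFin α.curryLeft := by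
    ext v
    rw [ContinuousAlternatingMap.sum_apply, ContinuousAlternatingMap.alternatizeUncurryFin_apply]
    simp only [altExt_apply]
    rw [Finset.sum_comm]
    refine Finset.sum_congr rfl fun i _ => ?_
    conv_rhs => rw [← b.sum_repr (v i)]
    rw [map_sum, ContinuousAlternatingMap.sum_apply, Finset.smul_sum]
    refine Finset.sum_congr rfl fun j _ => ?_
    rw [map_smul, ContinuousAlternatingMap.smul_apply, hβ]
    simp [zsmul_eq_mul, altInt_apply]
  rw [h1, ContinuousAlternatingMap.alternatizeUncurryFin_curryLeft]
  ext v
  simp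
end FibreAlgebra

/-! ### The wedge product as a signed sum over permutations, and its associativity with covectors.
-/

section Wedge
variable {E : Type*} [NormedAddCommGroup E] [NormedSpace ℂ E]

/-- The signed sum of a function of `k` vectors over all permutations of its arguments. -/
def signedSum {V : Type*} {k : ℕ} (F : (Fin k → V) → ℂ) (v : Fin k → V) : ℂ :=
  ∑ σ : Equiv.Perm (Fin k), (Equiv.Perm.sign σ : ℤ) • F (fun i => v (σ i))

theorem signedSum_comp_perm {V : Type*} {k : ℕ} (F : (Fin k → V) → ℂ) (v : Fin k → V)
    (π : Equiv.Perm (Fin k)) :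
    signedSum (fun w => F fun i => w (π i)) v = (Equiv.Perm.sign π : ℤ) • signedSum F v := by
  unfold signedSum
  rw [Finset.smul_sum]
  refine Fintype.sum_equiv (Equiv.mulRight π) _ _ fun σ => ?_
  rw [smul_smul, Equiv.coe_mulRight, Equiv.Perm.sign_mul]
  congr 1
  rcases Int.units_eq_one_or (Equiv.Perm.sign π) with h | h <;> simp [h]

/-- The permutation that sends `0` to `i` and `j + 1` to `i.succAbove (e j)`. -/
def permInsert {k : ℕ} (i : Fin (k + 1)) (e : Equiv.Perm (Fin k)) : Equiv.Perm (Fin (k + 1)) :=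
  Equiv.Perm.decomposeFin.symm (0, e) |>.trans i.cycleRange.symm

theorem permInsert_zero {k : ℕ} (i : Fin (k + 1)) (e : Equiv.Perm (Fin k)) :
    permInsert i e 0 = i := by
  simp [permInsert]

theorem permInsert_succ {k : ℕ} (i : Fin (k + 1)) (e : Equiv.Perm (Fin k)) (j : Fin k) :
    permInsert i e j.succ = i.succAbove (e j) := by
  simp [permInsert]

/-- The inverse of `i.cycleRange` carries `0` to `i` by a cycle of length i + 1, which contributes
the sign (-1)^i. -/
theorem sign_permInsert {k : ℕ} (i : Fin (k + 1)) (e : Equiv.Perm (Fin k)) :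
    Equiv.Perm.sign (permInsert i e) = (-1) ^ (i : ℕ) * Equiv.Perm.sign e := by
  rw [permInsert, Equiv.Perm.sign_trans, Equiv.Perm.sign_symm]
  simp [Fin.sign_cycleRange]

theorem permInsert_bijective (k : ℕ) :
    Function.Bijective fun p : Fin (k + 1) × Equiv.Perm (Fin k) => permInsert p.1 p.2 := by
  rw [Fintype.bijective_iff_injective_and_card]
  constructor
  · rintro ⟨i, e⟩ ⟨j, f⟩ h
    have h0 : i = j := by
      have := congrArg (fun σ : Equiv.Perm (Fin (k + 1)) => σ 0) h
      simpa [permInsert_zero] using this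
    subst h0
    congr 1
    ext1 l
    have := congrArg (fun σ : Equiv.Perm (Fin (k + 1)) => σ l.succ) h
    simpa [permInsert_succ] using this
  · simp [Fintype.card_perm, Nat.factorial_succ]

/-- Laplace expansion: the permutations are sorted by the image of `0`. -/
theorem signedSum_cons {V : Type*} {k : ℕ} (θ : V → ℂ) (G : (Fin k → V) → ℂ)
    (v : Fin (k + 1) → V) :
    signedSum (fun w => θ (w 0) * G fun j => w j.succ) v =
      ∑ i : Fin (k + 1), (-1 : ℂ) ^ (i : ℕ) * (θ (v i) * signedSum G (i.removeNth v)) := by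
  unfold signedSum
  rw [← (permInsert_bijective k).sum_comp, Fintype.sum_prod_type]
  refine Finset.sum_congr rfl fun i _ => ?_
  rw [Finset.mul_sum, Finset.mul_sum]
  refine Finset.sum_congr rfl fun e _ => ?_
  simp only [permInsert_zero, permInsert_succ, sign_permInsert, zsmul_eq_mul]
  push_cast
  simp only [Fin.removeNth]
  ring

/-- Each shuffle class contains a! b! permutations with equal contributions. Summing over all
permutations avoids the quotient by the two blocks. -/
theorem altWedge_eq_signedSum {a b k : ℕ} (h : a + b = k) (α : Alt E a) (β : Alt E b)
    (v : Fin k → E) :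
    ((a.factorial * b.factorial : ℕ) : ℂ) * altWedge h α β v =
      signedSum (fun w => α (fun i => w (Fin.cast h (Fin.castAdd b i))) *
        β fun j => w (Fin.cast h (Fin.natAdd a j))) v := by
  subst h
  have h1 := MultilinearMap.domCoprod_alternization_eq α.toAlternatingMap β.toAlternatingMap
  have h2 := congrArg (fun m : E [⋀^Fin a ⊕ Fin b]→ₗ[ℝ] (TensorProduct ℝ ℂ ℂ) =>
    LinearMap.mul' ℝ ℂ (m fun i => v (finSumFinEquiv i))) h1
  simp only [Fintype.card_fin] at h2
  have h3 : altWedge rfl α β v = LinearMap.mul' ℝ ℂ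
      ((α.toAlternatingMap.domCoprod β.toAlternatingMap) fun i => v (finSumFinEquiv i)) := rfl
  rw [h3, ← nsmul_eq_mul, ← map_nsmul]
  refine h2.symm.trans ?_
  rw [MultilinearMap.alternatization_apply, map_sum, signedSum,
    ← Equiv.sum_comp (finSumFinEquiv (m := a) (n := b)).permCongr]
  refine Finset.sum_congr rfl fun σ _ => ?_
  rw [Equiv.Perm.sign_permCongr, Units.smul_def, map_zsmul]
  congr 1
  simp [MultilinearMap.domDomCongr_apply, MultilinearMap.domCoprod_apply, Equiv.permCongr_apply]

/-- Associativity of the wedge product in the case where the first factor is a covector; together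
with Euler's formula this reduces multiplication by arbitrary forms to multiplication by covectors.
-/
theorem altWedge_altExt {a b k : ℕ} (h : a + b = k) (h' : a + 1 + b = k + 1) (θ : E →L[ℝ] ℂ)
    (α : Alt E a) (β : Alt E b) :
    altWedge h' (altExt θ a α) β = altExt θ k (altWedge h α β) := by
  ext v
  have hne : (((a + 1).factorial * b.factorial : ℕ) : ℂ) ≠ 0 := by
    exact_mod_cast (Nat.mul_pos (Nat.factorial_pos _) (Nat.factorial_pos _)).ne'
  refine mul_left_cancel₀ hne ?_
  rw [altWedge_eq_signedSum]
  -- The a + 1 terms of θ ∧ α all contribute the same signed sum: the i-th differs from the one with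
  -- θ in front by `permInsert i' 1`, whose sign cancels (-1)^i. The factor a + 1 turns a! into (a +
  -- 1)!.
  have h1 : ∀ i : Fin (a + 1), signedSum (fun w : Fin (k + 1) → E =>
        (-1 : ℂ) ^ (i : ℕ) * (θ (w (Fin.cast h' (Fin.castAdd b i))) *
          α (i.removeNth fun i => w (Fin.cast h' (Fin.castAdd b i)))) *
        β fun j => w (Fin.cast h' (Fin.natAdd (a + 1) j))) v =
      signedSum (fun w : Fin (k + 1) → E => θ (w 0) *
        (α (fun i => w (Fin.cast h (Fin.castAdd b i)).succ) *
          β fun j => w (Fin.cast h (Fin.natAdd a j)).succ)) v := by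
    intro i
    let i' : Fin (k + 1) := Fin.cast h' (Fin.castAdd b i)
    have h2 := signedSum_comp_perm (fun w : Fin (k + 1) → E => θ (w 0) *
        (α (fun i => w (Fin.cast h (Fin.castAdd b i)).succ) *
          β fun j => w (Fin.cast h (Fin.natAdd a j)).succ)) v (permInsert i' 1)
    rw [sign_permInsert] at h2
    simp only [permInsert_zero, permInsert_succ] at h2
    have h3 : ∀ w : Fin (k + 1) → E, (-1 : ℂ) ^ (i : ℕ) *
        (θ (w (Fin.cast h' (Fin.castAdd b i))) *
          α (i.removeNth fun i => w (Fin.cast h' (Fin.castAdd b i)))) *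
        (β fun j => w (Fin.cast h' (Fin.natAdd (a + 1) j))) = (-1 : ℂ) ^ (i : ℕ) *
        (θ (w i') * (α (fun l => w (i'.succAbove
          ((1 : Equiv.Perm (Fin k)) (Fin.cast h (Fin.castAdd b l))))) *
          β fun j => w (i'.succAbove ((1 : Equiv.Perm (Fin k)) (Fin.cast h (Fin.natAdd a j)))))) := by
      intro w
      have hα : (i.removeNth fun i => w (Fin.cast h' (Fin.castAdd b i))) =
          fun l => w (i'.succAbove ((1 : Equiv.Perm (Fin k)) (Fin.cast h (Fin.castAdd b l)))) := by
        funext l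
        simp only [Fin.removeNth, Equiv.Perm.one_apply]
        congr 1
        ext
        simp only [Fin.succAbove, i', Fin.lt_def]
        simp
        split_ifs <;> simp
      have hβ : (fun j => w (Fin.cast h' (Fin.natAdd (a + 1) j))) =
          fun j => w (i'.succAbove ((1 : Equiv.Perm (Fin k)) (Fin.cast h (Fin.natAdd a j)))) := by
        funext j
        congr 1
        ext
        have := i.2
        simp only [Fin.succAbove, i', Fin.lt_def, Equiv.Perm.one_apply]
        rw [if_neg (by simp; omega)]
        simp; omega
      rw [hα, hβ]; ring
    simp only [h3]
    have h4 : ∀ (c : ℂ) (F : (Fin (k + 1) → E) → ℂ),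
        signedSum (fun w => c * F w) v = c * signedSum F v := by
      intro c F
      simp only [signedSum, Finset.mul_sum, zsmul_eq_mul]
      exact Finset.sum_congr rfl fun _ _ => by ring
    rw [h4, h2]
    simp only [zsmul_eq_mul]
    rw [← mul_assoc]
    push_cast
    simp [i', ← mul_pow]
  have h5 : signedSum (fun w : Fin (k + 1) → E =>
      altExt θ a α (fun i => w (Fin.cast h' (Fin.castAdd b i))) *
        β fun j => w (Fin.cast h' (Fin.natAdd (a + 1) j))) v =
      ∑ i : Fin (a + 1), signedSum (fun w : Fin (k + 1) → E =>
        (-1 : ℂ) ^ (i : ℕ) * (θ (w (Fin.cast h' (Fin.castAdd b i))) *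
          α (i.removeNth fun i => w (Fin.cast h' (Fin.castAdd b i)))) *
        β fun j => w (Fin.cast h' (Fin.natAdd (a + 1) j))) v := by
    simp only [signedSum]
    rw [Finset.sum_comm]
    refine Finset.sum_congr rfl fun σ _ => ?_
    rw [← Finset.smul_sum, altExt_apply, Finset.sum_mul]
  rw [h5, Finset.sum_congr rfl fun i _ => h1 i, signedSum_cons (fun x => θ x)
    (fun w => α (fun i => w (Fin.cast h (Fin.castAdd b i))) *
          β fun j => w (Fin.cast h (Fin.natAdd a j)))]
  simp only [← altWedge_eq_signedSum h]
  rw [altExt_apply, Finset.sum_const, Finset.card_univ, Fintype.card_fin, nsmul_eq_mul,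
    Finset.mul_sum, Finset.mul_sum]
  refine Finset.sum_congr rfl fun i _ => ?_
  rw [Nat.factorial_succ]
  push_cast
  ring

theorem altWedge_zero {b k : ℕ} (h : 0 + b = k) (α : Alt E 0) (β : Alt E b) (v : Fin k → E) :
    altWedge h α β v = α ![] * β fun j => v (Fin.cast (by omega) j) := by
  have h1 := altWedge_eq_signedSum h α β v
  have hne : ((b.factorial : ℕ) : ℂ) ≠ 0 := by exact_mod_cast (Nat.factorial_pos _).ne'
  rw [Nat.factorial_zero, one_mul] at h1
  refine mul_left_cancel₀ hne (h1.trans ?_)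
  subst h
  have h2 : ∀ w : Fin (0 + b) → E, (α fun i => w (Fin.cast rfl (Fin.castAdd b i))) = α ![] :=
    fun w => congrArg α (Subsingleton.elim _ _)
  simp only [h2]
  -- The sign from permuting the arguments of β cancels the sign in the signed sum, so all b!
  -- summands are equal.
  have h3 : ∀ σ : Equiv.Perm (Fin (0 + b)),
      (β fun j => v (σ (Fin.cast rfl (Fin.natAdd 0 j)))) =
        (Equiv.Perm.sign σ : ℤ) • β fun j => v (Fin.cast (Nat.zero_add b).symm j) := by
    intro σ
    have h4 := β.toAlternatingMap.map_perm (fun j => v (Fin.cast (Nat.zero_add b).symm j))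
      ((finCongr (Nat.zero_add b)).permCongr σ)
    rw [Equiv.Perm.sign_permCongr, Units.smul_def] at h4
    refine Eq.trans ?_ h4
    change β _ = β _
    congr 1
    funext j
    simp only [Function.comp_apply, Equiv.permCongr_apply]
    congr 1
    ext
    simp
  simp only [signedSum, h3, zsmul_eq_mul]
  have h5 : ∀ σ : Equiv.Perm (Fin (0 + b)),
      (((Equiv.Perm.sign σ : ℤ) : ℤ) : ℂ) * (((Equiv.Perm.sign σ : ℤ) : ℤ) : ℂ) = 1 := by
    intro σ
    rcases Int.units_eq_one_or (Equiv.Perm.sign σ) with h | h <;> simp [h]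
  rw [Finset.sum_congr rfl fun σ _ => show _ = α ![] * β fun j => v (Fin.cast (Nat.zero_add b).symm j)
    by linear_combination (α ![] * β fun j => v (Fin.cast (Nat.zero_add b).symm j)) * h5 σ]
  rw [Finset.sum_const, Finset.card_univ, Fintype.card_perm, Fintype.card_fin, nsmul_eq_mul,
    show (0 + b).factorial = b.factorial by rw [Nat.zero_add]]

/-- The wedge product `γ ∧ u` of an `m`-form and a form of mixed degree. -/
def fibWedgeFun {m : ℕ} (γ : Alt E m) (u : Fib E) : Fib E := fun k =>
  if h : m ≤ k then altWedge (Nat.add_sub_cancel' h) γ (u (k - m)) else 0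

theorem fibWedgeFun_apply {m : ℕ} (γ : Alt E m) (u : Fib E) (k : ℕ) : fibWedgeFun γ u k =
  if h : m ≤ k then altWedge (Nat.add_sub_cancel' h) γ (u (k - m)) else 0 := rfl

/-- Exterior multiplication `γ ∧ ·` by an `m`-form on forms of all degrees. -/
def fibWedge (m : ℕ) : Alt E m →ₗ[ℂ] Module.End ℂ (Fib E) :=
  LinearMap.mk₂ ℂ fibWedgeFun
    (fun γ γ' u => Fib.ext fun k => by
      rw [Fib.add_apply]
      simp only [fibWedgeFun_apply]
      split_ifs with h
      · rw [map_add, LinearMap.add_apply]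
      · exact (add_zero (0 : Alt E k)).symm)
    (fun c γ u => Fib.ext fun k => by
      rw [Fib.smul_apply]
      simp only [fibWedgeFun_apply]
      split_ifs with h
      · rw [map_smul, LinearMap.smul_apply]
      · exact (smul_zero (A := Alt E k) c).symm)
    (fun γ u w => Fib.ext fun k => by
      rw [Fib.add_apply]
      simp only [fibWedgeFun_apply]
      split_ifs with h
      · rw [Fib.add_apply, map_add]
      · exact (add_zero (0 : Alt E k)).symm)
    (fun c γ u => Fib.ext fun k => by
      rw [Fib.smul_apply]
      simp only [fibWedgeFun_apply]
      split_ifs with h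
      · rw [Fib.smul_apply, map_smul]
      · exact (smul_zero (A := Alt E k) c).symm)

theorem altWedge_cast {a b b' k : ℕ} (h : a + b = k) (h' : a + b' = k) (γ : Alt E a)
    (u : Fib E) : altWedge h γ (u b) = altWedge h' γ (u b') := by
  obtain rfl : b = b' := by omega
  rfl

theorem fibWedge_of_add {m j k : ℕ} (h : m + j = k) (γ : Alt E m) (u : Fib E) :
    fibWedge m γ u k = altWedge h γ (u j) := by
  have h' : m ≤ k := by omega
  change (if h : m ≤ k then altWedge (Nat.add_sub_cancel' h) γ (u (k - m)) else 0) = _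
  rw [dif_pos h']
  exact altWedge_cast _ _ _ _

theorem fibWedge_of_lt {m k : ℕ} (h : k < m) (γ : Alt E m) (u : Fib E) :
    fibWedge m γ u k = 0 := dif_neg (by omega)

/-- This is what lets wedge operators be written as polynomials in the operators `fibExt`, so that
later computations take place in the algebra of creation and annihilation operators. -/
theorem fibWedge_altExt {m : ℕ} (θ : E →L[ℝ] ℂ) (γ : Alt E m) :
    fibWedge (m + 1) (altExt θ m γ) = fibExt θ * fibWedge m γ := by
  refine LinearMap.ext fun u => funext fun k => ?_
  change _ = fibExt θ (fibWedge m γ u) k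
  by_cases h : m + 1 ≤ k
  · obtain ⟨j, rfl⟩ := Nat.exists_eq_add_of_le h
    obtain ⟨k, hk⟩ : ∃ k, m + 1 + j = k + 1 := ⟨m + j, by omega⟩
    rw [hk, fibWedge_of_add hk, fibExt_succ, fibWedge_of_add (show m + j = k by omega),
      altWedge_altExt]
  · rw [fibWedge_of_lt (by omega)]
    cases k with
    | zero => rfl
    | succ k => rw [fibExt_succ, fibWedge_of_lt (by omega), map_zero]

theorem fibWedge_zero (γ : Alt E 0) : fibWedge 0 γ = γ ![] • (1 : Module.End ℂ (Fib E)) := by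
  refine LinearMap.ext fun u => funext fun k => ?_
  rw [fibWedge_of_add (Nat.zero_add k)]
  ext v
  rw [altWedge_zero]
  rfl

end Wedge

/-! ### Number operators in an algebra with canonical anticommutation relations. -/

/-- The canonical anticommutation relations. -/
structure CAR {s R : Type*} [DecidableEq s] [Ring R] (e i : s → R) : Prop where
  ee : ∀ a b, e a * e b = -(e b * e a)
  ii : ∀ a b, i a * i b = -(i b * i a)
  ie : ∀ a b, i a * e b = (if a = b then 1 else 0) - e b * i a

namespace CAR
variable {s R : Type*} [DecidableEq s] [Ring R] {e i : s → R} (H : CAR e i)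
include H

theorem num_mul_e (a c : s) :
    e a * i a * e c = e c * (e a * i a) + if a = c then e c else 0 := by
  rw [mul_assoc, H.ie, mul_sub, ← mul_assoc (e a) (e c), H.ee a c]
  split_ifs with h
  · subst h; noncomm_ring
  · noncomm_ring

theorem num_mul_i (a c : s) :
    e a * i a * i c = i c * (e a * i a) - if a = c then i c else 0 := by
  rw [← mul_assoc (i c), H.ie c a, mul_assoc, H.ii a c]
  split_ifs with h1 h2 h2
  · subst h1; noncomm_ring
  · exact absurd h1.symm h2
  · exact absurd h2.symm h1
  · noncomm_ring

theorem i_mul_self [Algebra ℂ R] (a : s) : i a * i a = 0 := by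
  have h : (2 : ℂ) • (i a * i a) = 0 := by
    rw [two_smul, ← neg_add_cancel (i a * i a), ← H.ii a a]
  exact (smul_eq_zero_iff_right two_ne_zero).1 h

/-- By `i_mul_self` the correction term in moving one number operator past the other vanishes; each
mode is occupied at most once. -/
theorem num_mul_num [Algebra ℂ R] (a : s) : e a * i a * (e a * i a) = e a * i a := by
  have h1 : i a * i a = 0 := H.i_mul_self a
  rw [← mul_assoc, H.num_mul_e]
  simp only [if_true]
  rw [add_mul, mul_assoc (e a), mul_assoc (e a) (i a) (i a), h1]
  simp

theorem num_comm (a c : s) : e a * i a * (e c * i c) = e c * i c * (e a * i a) := by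
  rw [← mul_assoc, H.num_mul_e, add_mul, mul_assoc (e c), H.num_mul_i]
  split_ifs <;> noncomm_ring

/-- The eigenvalues of a number operator `∑_{a ∈ t} eₐ iₐ` are at most the cardinality of `t`. -/
theorem eq_zero_of_num_eq [Algebra ℂ R] {M : Type*} [AddCommGroup M]
    [Module ℂ M] [Module R M] [IsScalarTower ℂ R M] (t : Finset s) (m : ℕ) (hm : t.card < m) (u : M)
    (hu : (∑ a ∈ t, e a * i a) • u = (m : ℂ) • u) : u = 0 := by
  induction t using Finset.induction_on generalizing m u with
  | empty =>
    simp only [Finset.sum_empty, zero_smul] at hu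
    refine (smul_eq_zero.1 hu.symm).resolve_left ?_
    simp at hm
    exact_mod_cast hm.ne'
  | insert b t hb ih =>
    rw [Finset.card_insert_of_notMem hb] at hm
    rw [Finset.sum_insert hb, add_smul] at hu
    have hcomm : (e b * i b) * (∑ a ∈ t, e a * i a) = (∑ a ∈ t, e a * i a) * (e b * i b) := by
      rw [Finset.mul_sum, Finset.sum_mul]
      exact Finset.sum_congr rfl fun a _ => H.num_comm b a
    have hsc : ∀ (r : R) (c : ℂ) (w : M), r • c • w = c • r • w := fun r c w => by
      rw [← smul_one_smul R c w, ← smul_one_smul R c (r • w), smul_smul, smul_smul]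
      congr 1
      simp
    -- The number operator of b is a projection that commutes with the others. On its image the
    -- remaining sum over t has eigenvalue m - 1, still larger than the cardinality of t, so the
    -- induction hypothesis kills that part of u. What is left of u has eigenvalue m for t alone.
    have h1 : (e b * i b) • u = 0 := by
      obtain ⟨m, rfl⟩ : ∃ l, m = l + 1 := ⟨m - 1, by omega⟩
      refine ih m (by omega) _ ?_
      have := congrArg (fun w => (e b * i b) • w) hu
      simp only [smul_add, smul_smul, hcomm, H.num_mul_num, hsc] at this
      rw [← mul_smul] 
      push_cast at this
      rw [add_smul, one_smul, add_comm] at this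
      exact add_right_cancel this
    rw [h1, zero_add] at hu
    exact ih m (by omega) u hu
end CAR

/-! ### Creation and annihilation operators of a complex frame, and forms of pure type. -/

section Frame
variable {E : Type*} [NormedAddCommGroup E] [NormedSpace ℂ E]

variable [FiniteDimensional ℂ E]
  {ι : Type*} [Fintype ι] [DecidableEq ι] (b : Module.Basis ι ℂ E)

/-- The coordinate form `dz_a`. -/
def dz (a : ι) : E →L[ℝ] ℂ :=
  (LinearMap.toContinuousLinearMap (b.coord a)).restrictScalars ℝ

theorem dz_apply (a : ι) (v : E) : dz b a v = b.repr v a := rfl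

/-- The coordinate form `dz̄_a`. -/
def dzBar (a : ι) : E →L[ℝ] ℂ := (Complex.conjCLE : ℂ →L[ℝ] ℂ).comp (dz b a)

theorem dzBar_apply (a : ι) (v : E) : dzBar b a v = starRingEnd ℂ (b.repr v a) := rfl

/-- The exterior multiplications by `dz_a` and `dz̄_a`. -/
def creation : ι ⊕ ι → Module.End ℂ (Fib E) :=
  Sum.elim (fun a => fibExt (dz b a)) fun a => fibExt (dzBar b a)

/-- The contractions with `∂/∂z_a` and `∂/∂z̄_a`. -/
def annihilation : ι ⊕ ι → Module.End ℂ (Fib E) :=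
  Sum.elim (fun a => (1 / 2 : ℂ) • (fibInt (b a) - Complex.I • fibInt (Complex.I • b a)))
    fun a => (1 / 2 : ℂ) • (fibInt (b a) + Complex.I • fibInt (Complex.I • b a))

theorem fibInt_mul_fibExt' (v : E) (θ : E →L[ℝ] ℂ) :
    fibInt v * fibExt θ = θ v • (1 : Module.End ℂ (Fib E)) - fibExt θ * fibInt v :=
  eq_sub_of_add_eq (fibInt_mul_fibExt v θ)

theorem fibInt_mul_fibInt' (v w : E) :
    fibInt v * fibInt w = -(fibInt w * fibInt v : Module.End ℂ (Fib E)) :=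
  eq_neg_of_add_eq_zero_left (fibInt_mul_fibInt v w)

theorem fibExt_mul_fibExt' (θ φ : E →L[ℝ] ℂ) :
    fibExt θ * fibExt φ = -(fibExt φ * fibExt θ : Module.End ℂ (Fib E)) :=
  eq_neg_of_add_eq_zero_left (fibExt_mul_fibExt θ φ)

theorem car_frame : CAR (creation b) (annihilation b) where
  ee := by
    rintro (a | a) (c | c) <;> exact fibExt_mul_fibExt' _ _
  ii := by
    have key : ∀ (v w v' w' : E) (c c' : ℂ),
        ((1 / 2 : ℂ) • (fibInt v + c • fibInt w)) * ((1 / 2 : ℂ) • (fibInt v' + c' • fibInt w')) =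
        -(((1 / 2 : ℂ) • (fibInt v' + c' • fibInt w')) *
          ((1 / 2 : ℂ) • (fibInt v + c • fibInt w)) : Module.End ℂ (Fib E)) := by
      intro v w v' w' c c'
      simp only [smul_mul_assoc, mul_smul_comm, add_mul, mul_add, smul_add, smul_smul]
      rw [fibInt_mul_fibInt' v' v, fibInt_mul_fibInt' v' w, fibInt_mul_fibInt' w' v,
        fibInt_mul_fibInt' w' w]
      module
    rintro (a | a) (c | c) <;>
      simp only [annihilation, Sum.elim_inl, Sum.elim_inr, sub_eq_add_neg, ← neg_smul] <;>
      exact key _ _ _ _ _ _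
  ie := by
    have key : ∀ (v w : E) (c : ℂ) (θ : E →L[ℝ] ℂ),
        ((1 / 2 : ℂ) • (fibInt v + c • fibInt w)) * fibExt θ =
        ((1 / 2 : ℂ) * (θ v + c * θ w)) • (1 : Module.End ℂ (Fib E)) -
          fibExt θ * ((1 / 2 : ℂ) • (fibInt v + c • fibInt w)) := by
      intro v w c θ
      simp only [smul_mul_assoc, mul_smul_comm, add_mul, mul_add]
      rw [fibInt_mul_fibExt', fibInt_mul_fibExt']
      module
    have h2 : ∀ (p : Prop) [Decidable p] (c : ℂ), c = (if p then 1 else 0) →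
        c • (1 : Module.End ℂ (Fib E)) = if p then 1 else 0 := by
      intro p _ c hc
      rw [hc]; split_ifs <;> simp
    rintro (a | a) (c | c) <;>
      simp only [annihilation, creation, Sum.elim_inl, Sum.elim_inr, sub_eq_add_neg, ← neg_smul] <;>
      rw [key, sub_eq_add_neg] <;> congr 1 <;> apply h2 <;>
      simp [dz_apply, dzBar_apply, Finsupp.single_apply, ← mul_assoc] <;>
      split_ifs <;> norm_num

/-- The real basis `b_a, i b_a` of `E` that belongs to a complex basis `b_a`. -/
def realFrame : Module.Basis (Fin 2 × ι) ℝ E := Complex.basisOneI.smulTower b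

theorem realFrame_zero (a : ι) : realFrame b (0, a) = b a := by
  simp [realFrame, Module.Basis.smulTower_apply]

theorem realFrame_one (a : ι) : realFrame b (1, a) = Complex.I • b a := by
  simp [realFrame, Module.Basis.smulTower_apply]

theorem realFrame_repr_zero (v : E) (a : ι) : (realFrame b).repr v (0, a) = (b.repr v a).re := by
  simp [realFrame, Module.Basis.smulTower_repr]

theorem realFrame_repr_one (v : E) (a : ι) : (realFrame b).repr v (1, a) = (b.repr v a).im := by
  simp [realFrame, Module.Basis.smulTower_repr]

/-- The complex valued dual basis of a real basis. -/
def dualCovector {μ : Type*} (f : Module.Basis μ ℝ E) (m : μ) : E →L[ℝ] ℂ :=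
  haveI : FiniteDimensional ℝ E := FiniteDimensional.complexToReal E
  Complex.ofRealCLM.comp (LinearMap.toContinuousLinearMap (f.coord m))

theorem dualCovector_apply {μ : Type*} (f : Module.Basis μ ℝ E) (m : μ) (v : E) :
    dualCovector f m v = (f.repr v m : ℂ) := rfl

theorem dualCovector_realFrame_zero (a : ι) :
    dualCovector (realFrame b) (0, a) = (1 / 2 : ℂ) • (dz b a + dzBar b a) := by
  ext v
  rw [dualCovector_apply, realFrame_repr_zero]
  simp only [_root_.smul_apply, _root_.add_apply, dz_apply, dzBar_apply, smul_eq_mul]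
  rw [Complex.re_eq_add_conj]; ring

theorem dualCovector_realFrame_one (a : ι) :
    dualCovector (realFrame b) (1, a) = (-Complex.I / 2 : ℂ) • (dz b a - dzBar b a) := by
  ext v
  rw [dualCovector_apply, realFrame_repr_one]
  simp only [_root_.smul_apply, _root_.sub_apply, dz_apply, dzBar_apply, smul_eq_mul]
  rw [Complex.im_eq_sub_conj]
  field_simp
  rw [Complex.I_sq]; ring

/-- The identity dx ⊗ ∂/∂x + dy ⊗ ∂/∂y = dz ⊗ ∂/∂z + dz̄ ⊗ ∂/∂z̄ in each coordinate. It transfers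
Euler's formula from real to complex frames. -/
theorem sum_realFrame :
    ∑ m, fibExt (dualCovector (realFrame b) m) * fibInt (realFrame b m) =
      ∑ s, creation b s * annihilation b s := by
  rw [Fintype.sum_prod_type, Fintype.sum_sum_type, Fin.sum_univ_two, ← Finset.sum_add_distrib,
    ← Finset.sum_add_distrib]
  refine Finset.sum_congr rfl fun a _ => ?_
  rw [dualCovector_realFrame_zero, dualCovector_realFrame_one, realFrame_zero, realFrame_one]
  simp only [creation, annihilation, Sum.elim_inl, Sum.elim_inr, map_smul, map_add, map_sub,
    mul_add, mul_sub, add_mul, sub_mul, smul_mul_assoc, mul_smul_comm]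
  module

theorem sum_fibExt_fibInt {μ : Type*} [Fintype μ] (f : Module.Basis μ ℝ E) (u : Fib E) (k : ℕ) :
    (∑ m, fibExt (dualCovector f m) * fibInt (f m)) u k = (k : ℂ) • u k := by
  rw [LinearMap.sum_apply, Fib.sum_apply]
  cases k with
  | zero =>
    refine (Finset.sum_eq_zero fun m _ => rfl).trans ?_
    simp
  | succ k => exact sum_altExt_altInt f _ (dualCovector_apply f) (u (k + 1))

/-- Euler's formula in a complex frame. -/
theorem sum_creation_annihilation (u : Fib E) (k : ℕ) :
    ((∑ a, creation b a * annihilation b a) u) k = (k : ℂ) • u k := by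
  rw [← sum_realFrame, sum_fibExt_fibInt]

/-- The operator that multiplies forms of type `(p,q)` by `p`. -/
def numP : Module.End ℂ (Fib E) := ∑ a, creation b (Sum.inl a) * annihilation b (Sum.inl a)

/-- The operator that multiplies forms of type `(p,q)` by `q`. -/
def numQ : Module.End ℂ (Fib E) := ∑ a, creation b (Sum.inr a) * annihilation b (Sum.inr a)

theorem numP_mul_creation_inl (c : ι) : numP b * creation b (Sum.inl c) =
    creation b (Sum.inl c) * numP b + creation b (Sum.inl c) := by
  simp only [numP, Finset.sum_mul, Finset.mul_sum, (car_frame b).num_mul_e, Sum.inl.injEq,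
    Finset.sum_add_distrib]
  simp

theorem numP_mul_creation_inr (c : ι) : numP b * creation b (Sum.inr c) =
    creation b (Sum.inr c) * numP b := by
  simp [numP, Finset.sum_mul, Finset.mul_sum, (car_frame b).num_mul_e]

theorem numQ_mul_creation_inr (c : ι) : numQ b * creation b (Sum.inr c) =
    creation b (Sum.inr c) * numQ b + creation b (Sum.inr c) := by
  simp only [numQ, Finset.sum_mul, Finset.mul_sum, (car_frame b).num_mul_e, Sum.inr.injEq,
    Finset.sum_add_distrib]
  simp

theorem numQ_mul_creation_inl (c : ι) : numQ b * creation b (Sum.inl c) =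
    creation b (Sum.inl c) * numQ b := by
  simp [numQ, Finset.sum_mul, Finset.mul_sum, (car_frame b).num_mul_e]

/-- The covector that belongs to `creation`. -/
def frameCovector : ι ⊕ ι → E →L[ℝ] ℂ := Sum.elim (dz b) (dzBar b)

theorem creation_eq (s : ι ⊕ ι) : creation b s = fibExt (frameCovector b s) := by
  cases s <;> rfl

theorem fibExt_single (θ : E →L[ℝ] ℂ) {k : ℕ} (α : Alt E k) :
    fibExt θ (Fib.single k α) = Fib.single (k + 1) (altExt θ k α) := by
  refine Fib.ext fun l => ?_
  cases l with
  | zero => rw [fibExt_zero, Fib.single_ne (by omega)]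
  | succ l =>
    rw [fibExt_succ]
    by_cases h : l = k
    · subst h; rw [Fib.single_same, Fib.single_same]
    · rw [Fib.single_ne h, Fib.single_ne (by omega), map_zero]

theorem fibInt_single_zero (v : E) (α : Alt E 0) : fibInt v (Fib.single 0 α) = 0 := by
  refine Fib.ext fun l => ?_
  rw [fibInt_apply, Fib.single_ne (by omega), map_zero, Fib.zero_apply]

theorem annihilation_single_zero (s : ι ⊕ ι) (α : Alt E 0) :
    annihilation b s (Fib.single 0 α) = 0 := by
  cases s <;> simp [annihilation, fibInt_single_zero]

/-- The component of degree `k` of `annihilation`. -/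
def altAnnihilation (s : ι ⊕ ι) (k : ℕ) (α : Alt E (k + 1)) : Alt E k :=
  annihilation b s (Fib.single (k + 1) α) k

theorem annihilation_apply (s : ι ⊕ ι) (u : Fib E) (k : ℕ) :
    annihilation b s u k = altAnnihilation b s k (u (k + 1)) := by
  cases s <;> simp [altAnnihilation, annihilation]

theorem altScale_altExt (c : ℂ) (θ : E →L[ℝ] ℂ) (d : ℂ) (hθ : ∀ v, θ (c • v) = d * θ v) {k : ℕ}
    (α : Alt E k) : altScale (k + 1) c (altExt θ k α) = d • altExt θ k (altScale k c α) := by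
  ext v
  change altExt θ k α (fun i => c • v i) = d * altExt θ k (altScale k c α) v
  rw [altExt_apply, altExt_apply, Finset.mul_sum]
  refine Finset.sum_congr rfl fun i _ => ?_
  rw [hθ]
  change _ = d * (_ * (_ * α fun j => c • i.removeNth v j))
  rw [show (i.removeNth fun i => c • v i) = fun j => c • i.removeNth v j from rfl]
  ring

theorem isOfBidegree_altExt_dz (a : ι) {p q k : ℕ} {α : Alt E k} (h : IsOfBidegree p q α) :
    IsOfBidegree (p + 1) q (altExt (dz b a) k α) := by
  refine ⟨by have := h.1; omega, fun c v => ?_⟩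
  have h1 := altScale_altExt c (dz b a) c (fun v => by simp [dz_apply]) α
  have h2 : altScale k c α = (c ^ p * (starRingEnd ℂ c) ^ q) • α := by
    ext w; exact h.2 c w
  rw [h2, map_smul] at h1
  refine (congrArg (fun γ : Alt E (k + 1) => γ v) h1).trans ?_
  simp only [ContinuousAlternatingMap.smul_apply, smul_eq_mul]
  ring

theorem isOfBidegree_altExt_dzBar (a : ι) {p q k : ℕ} {α : Alt E k} (h : IsOfBidegree p q α) :
    IsOfBidegree p (q + 1) (altExt (dzBar b a) k α) := by
  refine ⟨by have := h.1; omega, fun c v => ?_⟩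
  have h1 := altScale_altExt c (dzBar b a) (starRingEnd ℂ c) (fun v => by simp [dzBar_apply]) α
  have h2 : altScale k c α = (c ^ p * (starRingEnd ℂ c) ^ q) • α := by
    ext w; exact h.2 c w
  rw [h2, map_smul] at h1
  refine (congrArg (fun γ : Alt E (k + 1) => γ v) h1).trans ?_
  simp only [ContinuousAlternatingMap.smul_apply, smul_eq_mul]
  ring

/-- The forms of a type `(p,q)` with `p, q ≤ n` on which `numP` and `numQ` act as `p` and `q`. -/
def pureForms (k : ℕ) : Set (Alt E k) :=
  {β | ∃ p q, p ≤ Module.finrank ℂ E ∧ q ≤ Module.finrank ℂ E ∧ IsOfBidegree p q β ∧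
    numP b (Fib.single k β) = (p : ℂ) • Fib.single k β ∧
    numQ b (Fib.single k β) = (q : ℂ) • Fib.single k β}

/-- Only n of the covectors are of type (1,0), so `CAR.eq_zero_of_num_eq` bounds the eigenvalues of
`numP` by n. This justifies cutting the type decomposition off at n. -/
theorem eq_zero_of_numP {m : ℕ} (hm : Module.finrank ℂ E < m) (u : Fib E)
    (hu : numP b u = (m : ℂ) • u) : u = 0 := by
  refine (car_frame b).eq_zero_of_num_eq (Finset.univ.map Function.Embedding.inl) m ?_ u ?_
  · rw [Finset.card_map, Finset.card_univ, ← Module.finrank_eq_card_basis b]; exact hm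
  · rw [Finset.sum_map]; exact hu

theorem eq_zero_of_numQ {m : ℕ} (hm : Module.finrank ℂ E < m) (u : Fib E)
    (hu : numQ b u = (m : ℂ) • u) : u = 0 := by
  refine (car_frame b).eq_zero_of_num_eq (Finset.univ.map Function.Embedding.inr) m ?_ u ?_
  · rw [Finset.card_map, Finset.card_univ, ← Module.finrank_eq_card_basis b]; exact hm
  · rw [Finset.sum_map]; exact hu

/-- Multiplication by dz_a or dz̄_a raises p or q by one, both as a type and as an eigenvalue of the
number operator. -/
theorem altExt_mem_span_pureForms (s : ι ⊕ ι) {k : ℕ} {α : Alt E k}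
    (hα : α ∈ Submodule.span ℂ (pureForms b k)) :
    altExt (frameCovector b s) k α ∈ Submodule.span ℂ (pureForms b (k + 1)) := by
  refine (Submodule.map_span_le (altExt (frameCovector b s) k) _ _).2 ?_
    (Submodule.mem_map_of_mem hα)
  rintro β ⟨p, q, hp, hq, hβ, hP, hQ⟩
  have hs : Fib.single (k + 1) (altExt (frameCovector b s) k β) = creation b s (Fib.single k β) := by
    rw [creation_eq, fibExt_single]
  -- If the raised index exceeds n, the product is an eigenvector for a forbidden eigenvalue and
  -- hence zero.
  have hz : Fib.single (k + 1) (altExt (frameCovector b s) k β) = 0 →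
      altExt (frameCovector b s) k β ∈ Submodule.span ℂ (pureForms b (k + 1)) := by
    intro h0
    have := congrArg (fun u : Fib E => u (k + 1)) h0
    simp only [Fib.single_same, Fib.zero_apply] at this
    rw [this]
    exact Submodule.zero_mem _
  cases s with
  | inl a =>
    have h1 : numP b (creation b (Sum.inl a) (Fib.single k β)) =
        ((p + 1 : ℕ) : ℂ) • creation b (Sum.inl a) (Fib.single k β) := by
      have := congrArg (fun T : Module.End ℂ (Fib E) => T (Fib.single k β))
        (numP_mul_creation_inl b a)
      simp only [Module.End.mul_apply, LinearMap.add_apply, hP, map_smul] at this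
      rw [this]; push_cast; module
    have h2 : numQ b (creation b (Sum.inl a) (Fib.single k β)) =
        (q : ℂ) • creation b (Sum.inl a) (Fib.single k β) := by
      have := congrArg (fun T : Module.End ℂ (Fib E) => T (Fib.single k β))
        (numQ_mul_creation_inl b a)
      simp only [Module.End.mul_apply, LinearMap.add_apply, hQ, map_smul] at this
      exact this
    by_cases hpn : p + 1 ≤ Module.finrank ℂ E
    · refine Submodule.subset_span ⟨p + 1, q, hpn, hq, isOfBidegree_altExt_dz b a hβ, ?_, ?_⟩
      · rw [hs]; exact h1
      · rw [hs]; exact h2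
    · exact hz (hs.trans (eq_zero_of_numP b (by omega) _ h1))
  | inr a =>
    have h1 : numQ b (creation b (Sum.inr a) (Fib.single k β)) =
        ((q + 1 : ℕ) : ℂ) • creation b (Sum.inr a) (Fib.single k β) := by
      have := congrArg (fun T : Module.End ℂ (Fib E) => T (Fib.single k β))
        (numQ_mul_creation_inr b a)
      simp only [Module.End.mul_apply, LinearMap.add_apply, hQ, map_smul] at this
      rw [this]; push_cast; module
    have h2 : numP b (creation b (Sum.inr a) (Fib.single k β)) =
        (p : ℂ) • creation b (Sum.inr a) (Fib.single k β) := by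
      have := congrArg (fun T : Module.End ℂ (Fib E) => T (Fib.single k β))
        (numP_mul_creation_inr b a)
      simp only [Module.End.mul_apply, LinearMap.add_apply, hP, map_smul] at this
      exact this
    by_cases hpn : q + 1 ≤ Module.finrank ℂ E
    · refine Submodule.subset_span ⟨p, q + 1, hp, hpn, isOfBidegree_altExt_dzBar b a hβ, ?_, ?_⟩
      · rw [hs]; exact h2
      · rw [hs]; exact h1
    · exact hz (hs.trans (eq_zero_of_numQ b (by omega) _ h1))

/-- By Euler's formula a form of degree k + 1 is, up to the factor k + 1, a sum of covectors of the
frame times forms of degree k, so induction on the degree applies. -/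
theorem mem_span_pureForms {k : ℕ} (α : Alt E k) : α ∈ Submodule.span ℂ (pureForms b k) := by
  induction k with
  | zero =>
    refine Submodule.subset_span ⟨0, 0, Nat.zero_le _, Nat.zero_le _, ⟨rfl, fun c v => ?_⟩, ?_, ?_⟩
    · rw [pow_zero, pow_zero, one_mul, one_mul]
      exact congrArg α (Subsingleton.elim _ _)
    · simp [numP, annihilation_single_zero]
    · simp [numQ, annihilation_single_zero]
  | succ k ih =>
    have h1 := sum_creation_annihilation b (Fib.single (k + 1) α) (k + 1)
    rw [Fib.single_same, LinearMap.sum_apply, Fib.sum_apply] at h1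
    have h2 : α = ((k + 1 : ℕ) : ℂ)⁻¹ • ∑ s, altExt (frameCovector b s) k
        (altAnnihilation b s k α) := by
      rw [eq_inv_smul_iff₀ (by exact_mod_cast Nat.succ_ne_zero k), ← h1]
      refine Finset.sum_congr rfl fun s _ => ?_
      rw [Module.End.mul_apply, creation_eq, fibExt_succ]
      rfl
    rw [h2]
    exact Submodule.smul_mem _ _ (Submodule.sum_mem _ fun s _ => altExt_mem_span_pureForms b s (ih _))

end Frame

/-! ### The type projections, expressed by number operators and creation operators. -/

section Bidegree
variable {E : Type*} [NormedAddCommGroup E] [NormedSpace ℂ E] [FiniteDimensional ℂ E]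
  {ι : Type*} [Fintype ι] [DecidableEq ι] (b : Module.Basis ι ℂ E)

theorem alt_hom_ext {k : ℕ} {M : Type*} [AddCommGroup M] [Module ℂ M] {f g : Alt E k →ₗ[ℂ] M}
    (h : ∀ β ∈ pureForms b k, f β = g β) : f = g :=
  LinearMap.ext fun α => LinearMap.eqOn_span h (mem_span_pureForms b α)

variable (E) in
/-- Forms of degree greater than `2n` vanish. -/
theorem alt_subsingleton {k : ℕ} (hk : 2 * Module.finrank ℂ E < k) : Subsingleton (Alt E k) := by
  have h : (LinearMap.id : Alt E k →ₗ[ℂ] Alt E k) = 0 := by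
    refine alt_hom_ext (Module.finBasis ℂ E) ?_
    rintro β ⟨p, q, hp, hq, hβ, -⟩
    have := hβ.1
    omega
  exact ⟨fun x y => (LinearMap.congr_fun h x).trans (LinearMap.congr_fun h y).symm⟩

/-- The operator on forms of all degrees with the components `T k`. -/
def fibDiag (T : ∀ k, Alt E k →ₗ[ℂ] Alt E k) : Module.End ℂ (Fib E) where
  toFun u := fun k => T k (u k)
  map_add' u v := Fib.ext fun k => map_add (T k) (u k) (v k)
  map_smul' c u := Fib.ext fun k => map_smul (T k) c (u k)

variable (E) in
/-- The projection to the component of bidegree `(p,q)`. -/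
def fibBidegree (p q : ℕ) : Module.End ℂ (Fib E) := fibDiag (altBidegree p q)

theorem fibBidegree_apply (p q : ℕ) (u : Fib E) (k : ℕ) :
    fibBidegree E p q u k = altBidegree p q k (u k) := rfl

theorem sum_bidegree_ite {M : Type*} [AddCommGroup M] {n p q : ℕ} (hp : p ≤ n) (hq : q ≤ n)
    (f : ℕ → ℕ → M) :
    ∑ p' ∈ Finset.range (n + 1), ∑ q' ∈ Finset.range (n + 1),
      (if p' = p ∧ q' = q then f p' q' else 0) = f p q := by
  rw [Finset.sum_eq_single p, Finset.sum_eq_single q]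
  · simp
  · intro q' _ h; simp [h]
  · intro h; simp at h; omega
  · intro p' _ h; simp [h]
  · intro h; simp at h; omega

theorem numP_apply (u : Fib E) (k : ℕ) : numP b u k = numP b (Fib.single k (u k)) k := by
  simp only [numP, LinearMap.sum_apply, Fib.sum_apply, Module.End.mul_apply, creation_eq]
  refine Finset.sum_congr rfl fun a _ => ?_
  cases k with
  | zero => rfl
  | succ k => rw [fibExt_succ, fibExt_succ, annihilation_apply, annihilation_apply, Fib.single_same]

/-- For c = 1 this gives the decomposition of the identity into types, and for c = p the operator
`numP`. The hypothesis `hT` says that T does not mix degrees, so that it suffices to test on pure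
forms of one degree. -/
theorem fib_sum_bidegree (c : ℕ → ℕ → ℂ) (T : Module.End ℂ (Fib E))
    (hT : ∀ u k, T u k = T (Fib.single k (u k)) k)
    (h : ∀ p q k (β : Alt E k), IsOfBidegree p q β →
      numP b (Fib.single k β) = (p : ℂ) • Fib.single k β →
      numQ b (Fib.single k β) = (q : ℂ) • Fib.single k β →
      T (Fib.single k β) = c p q • Fib.single k β) :
    ∑ p ∈ Finset.range (Module.finrank ℂ E + 1), ∑ q ∈ Finset.range (Module.finrank ℂ E + 1),
      c p q • fibBidegree E p q = T := by
  refine LinearMap.ext fun u => Fib.ext fun k => ?_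
  rw [hT]
  let S : Alt E k →ₗ[ℂ] Alt E k :=
    { toFun := fun α => T (Fib.single k α) k
      map_add' := fun α β => by
        have : Fib.single k (α + β) = Fib.single k α + Fib.single k β := Pi.single_add ..
        rw [this, map_add]; rfl
      map_smul' := fun d α => by
        have : Fib.single k (d • α) = d • Fib.single k α := Pi.single_smul ..
        rw [this, map_smul]; rfl }
  have key : ∑ p ∈ Finset.range (Module.finrank ℂ E + 1),
      ∑ q ∈ Finset.range (Module.finrank ℂ E + 1), c p q • altBidegree p q k = S := by
    refine alt_hom_ext b ?_
    rintro β ⟨p, q, hp, hq, hβ, hP, hQ⟩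
    change _ = T (Fib.single k β) k
    rw [h p q k β hβ hP hQ]
    simp only [LinearMap.sum_apply, LinearMap.smul_apply, altBidegree_of_isOfBidegree hβ, smul_ite,
      smul_zero]
    rw [sum_bidegree_ite hp hq fun p q => c p q • β]
    simp
  have := LinearMap.congr_fun key (u k)
  refine Eq.trans ?_ this
  simp only [LinearMap.sum_apply, Fib.sum_apply, LinearMap.smul_apply, Fib.smul_apply]
  rfl

theorem sum_fibBidegree : ∑ p ∈ Finset.range (Module.finrank ℂ E + 1),
    ∑ q ∈ Finset.range (Module.finrank ℂ E + 1), fibBidegree E p q = 1 := by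
  have := fib_sum_bidegree (Module.finBasis ℂ E) (fun _ _ => 1) 1
    (fun u k => by simp) fun p q k β _ _ _ => by simp
  simpa using this

theorem sum_smul_fibBidegree_left : ∑ p ∈ Finset.range (Module.finrank ℂ E + 1),
    ∑ q ∈ Finset.range (Module.finrank ℂ E + 1), (p : ℂ) • fibBidegree E p q = numP b :=
  fib_sum_bidegree b (fun p _ => p) _ (numP_apply b) fun _ _ _ _ _ h _ => h

/-- The part of an exterior multiplication that shifts the type by (r,t) is all of it or nothing,
according to the type of the covector. Below, d is 1 or 0 accordingly, which is how ∂ and ∂̄ are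
read off from d. -/
theorem fib_sum_bidegree_creation (r t : ℕ) (s : ι ⊕ ι) (d : ℂ)
    (h : ∀ p q k (β : Alt E k), IsOfBidegree p q β →
      altBidegree (p + r) (q + t) (k + 1) (altExt (frameCovector b s) k β) =
        d • altExt (frameCovector b s) k β) :
    ∑ p ∈ Finset.range (Module.finrank ℂ E + 1), ∑ q ∈ Finset.range (Module.finrank ℂ E + 1),
      fibBidegree E (p + r) (q + t) * creation b s * fibBidegree E p q = d • creation b s := by
  refine LinearMap.ext fun u => Fib.ext fun k => ?_
  simp only [LinearMap.sum_apply, Fib.sum_apply, LinearMap.smul_apply, Fib.smul_apply,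
    Module.End.mul_apply, fibBidegree_apply, creation_eq]
  cases k with
  | zero =>
    simp
  | succ k =>
    simp only [fibExt_succ, fibBidegree_apply]
    have key : ∑ p ∈ Finset.range (Module.finrank ℂ E + 1),
        ∑ q ∈ Finset.range (Module.finrank ℂ E + 1), altBidegree (p + r) (q + t) (k + 1) ∘ₗ
          altExt (frameCovector b s) k ∘ₗ altBidegree p q k = d • altExt (frameCovector b s) k := by
      refine alt_hom_ext b ?_
      rintro β ⟨p, q, hp, hq, hβ, -⟩
      simp only [LinearMap.sum_apply, LinearMap.comp_apply, altBidegree_of_isOfBidegree hβ,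
        LinearMap.smul_apply]
      have : ∀ p' q', altBidegree (p' + r) (q' + t) (k + 1) (altExt (frameCovector b s) k
          (if p' = p ∧ q' = q then β else 0)) = if p' = p ∧ q' = q then
            altBidegree (p' + r) (q' + t) (k + 1) (altExt (frameCovector b s) k β) else 0 := by
        intro p' q'
        split_ifs <;> simp
      simp only [this]
      rw [sum_bidegree_ite hp hq fun p' q' => altBidegree (p' + r) (q' + t) (k + 1)
        (altExt (frameCovector b s) k β), h p q k β hβ]
    have := LinearMap.congr_fun key (u k)
    simpa only [LinearMap.sum_apply, LinearMap.comp_apply, LinearMap.smul_apply] using this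

theorem sum_bidegree_creation_left (s : ι ⊕ ι) :
    ∑ p ∈ Finset.range (Module.finrank ℂ E + 1), ∑ q ∈ Finset.range (Module.finrank ℂ E + 1),
      fibBidegree E (p + 1) q * creation b s * fibBidegree E p q =
      (Sum.elim (fun _ => 1) (fun _ => 0) s : ℂ) • creation b s := by
  refine fib_sum_bidegree_creation b 1 0 s _ fun p q k β hβ => ?_
  cases s with
  | inl a =>
    refine (altBidegree_of_isOfBidegree (isOfBidegree_altExt_dz b a hβ) _ _).trans ?_
    simp [frameCovector]
  | inr a =>
    refine (altBidegree_of_isOfBidegree (isOfBidegree_altExt_dzBar b a hβ) _ _).trans ?_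
    simp

theorem sum_bidegree_creation_right (s : ι ⊕ ι) :
    ∑ p ∈ Finset.range (Module.finrank ℂ E + 1), ∑ q ∈ Finset.range (Module.finrank ℂ E + 1),
      fibBidegree E p (q + 1) * creation b s * fibBidegree E p q =
      (Sum.elim (fun _ => 0) (fun _ => 1) s : ℂ) • creation b s := by
  refine fib_sum_bidegree_creation b 0 1 s _ fun p q k β hβ => ?_
  cases s with
  | inl a =>
    refine (altBidegree_of_isOfBidegree (isOfBidegree_altExt_dz b a hβ) _ _).trans ?_
    simp
  | inr a =>
    refine (altBidegree_of_isOfBidegree (isOfBidegree_altExt_dzBar b a hβ) _ _).trans ?_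
    simp [frameCovector]

end Bidegree

/-! ### Inner products of forms induced by a matrix on covectors. -/

section MatInner
variable {E : Type*} [NormedAddCommGroup E] [NormedSpace ℂ E]
  {μ ν : Type*} [Fintype μ] [Fintype ν]

/-- The sesquilinear form on `k`-forms that is induced by a matrix `M` with respect to a real basis
`f` of `E`. -/
def matInner (f : Module.Basis μ ℝ E) (M : Matrix μ μ ℝ) (k : ℕ) :
    Alt E k →ₗ[ℂ] Alt E k →ₛₗ[starRingEnd ℂ] ℂ :=
  LinearMap.mk₂'ₛₗ (RingHom.id ℂ) (starRingEnd ℂ)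
    (fun α β => (k.factorial : ℂ)⁻¹ * ∑ i : Fin k → μ, ∑ j : Fin k → μ,
      (∏ l, (M (i l) (j l) : ℂ)) * (α (fun l => f (i l)) * starRingEnd ℂ (β fun l => f (j l))))
    (fun α α' β => by
      simp only [← mul_add, ← Finset.sum_add_distrib, ContinuousAlternatingMap.add_apply, add_mul])
    (fun c α β => by
      simp only [ContinuousAlternatingMap.smul_apply, smul_eq_mul, Finset.mul_sum, RingHom.id_apply]
      refine Finset.sum_congr rfl fun i _ => Finset.sum_congr rfl fun j _ => ?_
      ring)
    (fun α β β' => by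
      simp only [← mul_add, ← Finset.sum_add_distrib, ContinuousAlternatingMap.add_apply, map_add])
    (fun c α β => by
      simp only [ContinuousAlternatingMap.smul_apply, smul_eq_mul, Finset.mul_sum, map_mul]
      refine Finset.sum_congr rfl fun i _ => Finset.sum_congr rfl fun j _ => ?_
      ring)

theorem matInner_apply (f : Module.Basis μ ℝ E) (M : Matrix μ μ ℝ) (k : ℕ) (α β : Alt E k) :
    matInner f M k α β = (k.factorial : ℂ)⁻¹ * ∑ i : Fin k → μ, ∑ j : Fin k → μ,
      (∏ l, (M (i l) (j l) : ℂ)) * (α (fun l => f (i l)) * starRingEnd ℂ (β fun l => f (j l))) := rfl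

theorem matInner_zero (f : Module.Basis μ ℝ E) (M : Matrix μ μ ℝ) (α β : Alt E 0) :
    matInner f M 0 α β = α ![] * starRingEnd ℂ (β ![]) := by
  rw [matInner_apply]
  simp [Matrix.empty_eq]

/-- Splitting off the first index gives a recursion in the degree; the factor 1/(k + 1) comes from
(k + 1)!. The algebra and the calculus of the inner product both rest on it. -/
theorem matInner_succ (f : Module.Basis μ ℝ E) (M : Matrix μ μ ℝ) (k : ℕ) (α β : Alt E (k + 1)) :
    matInner f M (k + 1) α β = ((k + 1 : ℕ) : ℂ)⁻¹ * ∑ a, ∑ c, (M a c : ℂ) *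
      matInner f M k (altInt (f a) k α) (altInt (f c) k β) := by
  rw [matInner_apply, Nat.factorial_succ, Nat.cast_mul, mul_inv, mul_assoc]
  congr 1
  rw [← (Fin.consEquiv fun _ => μ).sum_comp, Fintype.sum_prod_type, Finset.mul_sum]
  refine Finset.sum_congr rfl fun a _ => ?_
  have h1 : ∀ i : Fin k → μ, ∀ F : (Fin (k + 1) → μ) → ℂ, ∑ j, F j = ∑ c, ∑ j, F (Fin.cons c j) := by
    intro i F
    rw [← (Fin.consEquiv fun _ => μ).sum_comp, Fintype.sum_prod_type]
    rfl
  rw [Finset.sum_congr rfl fun i _ => h1 i _, Finset.sum_comm, Finset.mul_sum]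
  refine Finset.sum_congr rfl fun c _ => ?_
  rw [matInner_apply, mul_left_comm]
  congr 1
  rw [Finset.mul_sum]
  refine Finset.sum_congr rfl fun i _ => ?_
  rw [Finset.mul_sum]
  refine Finset.sum_congr rfl fun j _ => ?_
  rw [Fin.prod_univ_succ, altInt_apply, altInt_apply]
  have h2 : ∀ (x : μ) (y : Fin k → μ), (fun l => f ((Fin.cons x y : Fin (k + 1) → μ) l)) =
      Matrix.vecCons (f x) fun l => f (y l) := by
    intro x y
    funext l
    refine Fin.cases ?_ (fun l => ?_) l <;> simp
  change _ * (α (fun l => f ((Fin.cons a i : Fin (k + 1) → μ) l)) * _) = _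
  rw [h2, h2]
  simp [Fin.consEquiv]
  ring

theorem altInt_sum_smul {k : ℕ} (c : ν → ℝ) (v : ν → E) (α : Alt E (k + 1)) :
    altInt (∑ m, c m • v m) k α = ∑ m, (c m : ℂ) • altInt (v m) k α := by
  change α.curryLeft _ = _
  rw [map_sum]
  refine Finset.sum_congr rfl fun m _ => ?_
  rw [map_smul]
  ext w
  exact Complex.real_smul

/-- Tensoriality: contraction is real linear in the vector, so the first index can be transformed by
itself and the recursion does the rest. -/
theorem matInner_change_basis (f : Module.Basis μ ℝ E) (f' : Module.Basis ν ℝ E)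
    (M : Matrix μ μ ℝ) (Q : Matrix μ ν ℝ) (hQ : ∀ a, f a = ∑ m, Q a m • f' m) (k : ℕ) :
    matInner f M k = matInner f' (Q.transpose * M * Q) k := by
  induction k with
  | zero => ext α β; rw [matInner_zero, matInner_zero]
  | succ k ih =>
    ext α β
    rw [matInner_succ, matInner_succ, ih]
    congr 1
    simp only [hQ, altInt_sum_smul, map_sum, LinearMap.sum_apply, map_smulₛₗ, map_smul,
      LinearMap.smul_apply, Complex.conj_ofReal, smul_eq_mul, Matrix.mul_apply,
      Matrix.transpose_apply, RingHom.id_apply]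
    push_cast
    simp only [Finset.mul_sum, Finset.sum_mul]
    have : ∀ (F : μ → μ → ν → ν → ℂ), ∑ a, ∑ c, ∑ m, ∑ l, F a c m l =
        ∑ l, ∑ m, ∑ c, ∑ a, F a c m l := by
      intro F
      calc _ = ∑ a, ∑ c, ∑ l, ∑ m, F a c m l :=
            Finset.sum_congr rfl fun _ _ => Finset.sum_congr rfl fun _ _ => Finset.sum_comm
        _ = ∑ a, ∑ l, ∑ m, ∑ c, F a c m l := Finset.sum_congr rfl fun _ _ => by
            rw [Finset.sum_comm]
            exact Finset.sum_congr rfl fun _ _ => Finset.sum_comm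
        _ = _ := by
            rw [Finset.sum_comm]
            refine Finset.sum_congr rfl fun _ _ => ?_
            rw [Finset.sum_comm]
            exact Finset.sum_congr rfl fun _ _ => Finset.sum_comm
    rw [this]
    refine Finset.sum_congr rfl fun l _ => Finset.sum_congr rfl fun m _ =>
      Finset.sum_congr rfl fun c _ => Finset.sum_congr rfl fun a _ => ?_
    ring

variable [DecidableEq μ]

/-- The sesquilinear form for which the real basis `f` is orthonormal. -/
def orthoInner (f : Module.Basis μ ℝ E) (k : ℕ) : Alt E k →ₗ[ℂ] Alt E k →ₛₗ[starRingEnd ℂ] ℂ :=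
  matInner f 1 k

theorem orthoInner_zero (f : Module.Basis μ ℝ E) (α β : Alt E 0) :
    orthoInner f 0 α β = α ![] * starRingEnd ℂ (β ![]) := matInner_zero f 1 α β

theorem orthoInner_succ (f : Module.Basis μ ℝ E) (k : ℕ) (α β : Alt E (k + 1)) :
    orthoInner f (k + 1) α β = ((k + 1 : ℕ) : ℂ)⁻¹ * ∑ a,
      orthoInner f k (altInt (f a) k α) (altInt (f a) k β) := by
  rw [orthoInner, matInner_succ]
  congr 1
  refine Finset.sum_congr rfl fun a _ => ?_
  rw [Finset.sum_eq_single a (fun c _ h => by simp [Matrix.one_apply_ne h.symm]) (by simp)]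
  simp [orthoInner]

theorem orthoInner_conj (f : Module.Basis μ ℝ E) (k : ℕ) (α β : Alt E k) :
    starRingEnd ℂ (orthoInner f k α β) = orthoInner f k β α := by
  induction k with
  | zero => simp [orthoInner_zero, mul_comm]
  | succ k ih => simp [orthoInner_succ, ih]

theorem orthoInner_nonneg (f : Module.Basis μ ℝ E) (k : ℕ) (α : Alt E k) :
    0 ≤ (orthoInner f k α α).re := by
  induction k with
  | zero =>
    rw [orthoInner_zero, Complex.mul_conj, Complex.ofReal_re]
    exact Complex.normSq_nonneg _
  | succ k ih =>
    rw [orthoInner_succ, ← Complex.ofReal_natCast, ← Complex.ofReal_inv, Complex.re_ofReal_mul,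
      Complex.re_sum]
    exact mul_nonneg (by positivity) (Finset.sum_nonneg fun a _ => ih _)

theorem alt_eq_zero_of_altInt (f : Module.Basis μ ℝ E) {k : ℕ} {α : Alt E (k + 1)}
    (h : ∀ a, altInt (f a) k α = 0) : α = 0 := by
  refine alt_ext_int fun v => ?_
  rw [← f.sum_repr v, altInt_sum_smul, map_zero]
  exact Finset.sum_eq_zero fun a _ => by rw [h a, alt_smul_zero]

theorem eq_zero_of_orthoInner_self (f : Module.Basis μ ℝ E) (k : ℕ) (α : Alt E k)
    (h : (orthoInner f k α α).re = 0) : α = 0 := by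
  induction k with
  | zero =>
    rw [orthoInner_zero, Complex.mul_conj, Complex.ofReal_re, Complex.normSq_eq_zero] at h
    ext v
    rw [Subsingleton.elim v ![]]
    exact h
  | succ k ih =>
    rw [orthoInner_succ, ← Complex.ofReal_natCast, ← Complex.ofReal_inv, Complex.re_ofReal_mul,
      Complex.re_sum, mul_eq_zero] at h
    have h1 := h.resolve_left (by positivity)
    rw [Finset.sum_eq_zero_iff_of_nonneg fun a _ => orthoInner_nonneg f k _] at h1
    exact alt_eq_zero_of_altInt f fun a => ih _ (h1 a (Finset.mem_univ a))

variable [FiniteDimensional ℂ E]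

theorem sum_altExt_dual (f : Module.Basis μ ℝ E) {k : ℕ} (α : Alt E (k + 1)) :
    ∑ a, altExt (dualCovector f a) k (altInt (f a) k α) = ((k + 1 : ℕ) : ℂ) • α :=
  sum_altExt_altInt f _ (dualCovector_apply f) α

/-- Exterior multiplication by a covector of an orthonormal basis is adjoint to contraction. -/
theorem orthoInner_altExt (f : Module.Basis μ ℝ E) (a : μ) (k : ℕ) (α : Alt E k)
    (β : Alt E (k + 1)) :
    orthoInner f (k + 1) (altExt (dualCovector f a) k α) β = orthoInner f k α (altInt (f a) k β) := by
  have hδ : ∀ c, dualCovector f a (f c) = if c = a then 1 else 0 := fun c => by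
    rw [dualCovector_apply, f.repr_self, Finsupp.single_apply]; split_ifs <;> simp
  induction k with
  | zero =>
    rw [orthoInner_succ]
    simp only [altInt_altExt_zero, hδ, ite_smul, one_smul, alt_zero_smul]
    rw [Finset.sum_eq_single a (fun c _ h => by simp [h]) (by simp)]
    simp
  | succ k ih =>
    rw [orthoInner_succ]
    simp only [altInt_altExt_succ, hδ, map_sub, LinearMap.sub_apply, ih, Finset.sum_sub_distrib,
      ite_smul, one_smul, alt_zero_smul]
    rw [Finset.sum_congr rfl fun c _ => show orthoInner f (k + 1) (if c = a then α else 0)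
      (altInt (f c) (k + 1) β) = if c = a then orthoInner f (k + 1) α (altInt (f c) (k + 1) β) else 0
      by split_ifs <;> simp]
    rw [Finset.sum_ite_eq' Finset.univ a, if_pos (Finset.mem_univ a)]
    -- After the induction hypothesis the remaining sum is ∑ ⟨ι_c α, ι_c ι_a β⟩ with a plus sign,
    -- since the two contractions anticommute. By the recursion it is (k + 1)⟨α, ι_a β⟩, and the
    -- term from the Kronecker delta raises the factor to k + 2.
    simp only [altInt_altInt (f a), map_neg, Finset.sum_neg_distrib, sub_neg_eq_add]
    have h2 := orthoInner_succ f k α (altInt (f a) (k + 1) β)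
    have h3 : ((k + 1 : ℕ) : ℂ) ≠ 0 := by exact_mod_cast Nat.succ_ne_zero k
    have h4 : ((k + 1 + 1 : ℕ) : ℂ) ≠ 0 := by exact_mod_cast Nat.succ_ne_zero (k + 1)
    rw [inv_mul_eq_iff_eq_mul₀ h4]
    rw [eq_inv_mul_iff_mul_eq₀ h3] at h2
    rw [← h2]; push_cast; ring

end MatInner

/-! ### The metric at one point: unitary frames, Gram matrices and adjoints on the fibre. -/

section Hermitian
/-- A finite dimensional complex vector space with a Hermitian inner product has an orthonormal
basis. -/
theorem exists_orthonormal_basis_of_core {V : Type*} [AddCommGroup V] [Module ℂ V]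
    [FiniteDimensional ℂ V] (c : InnerProductSpace.Core ℂ V) :
    ∃ b : Module.Basis (Fin (Module.finrank ℂ V)) ℂ V,
      ∀ i j, c.inner (b i) (b j) = if i = j then 1 else 0 := by
  let := c.toNormedAddCommGroup
  let : InnerProductSpace ℂ V := InnerProductSpace.ofCore c.toCore
  refine ⟨(stdOrthonormalBasis ℂ V).toBasis, fun i j => ?_⟩
  have := (orthonormal_iff_ite.1 (stdOrthonormalBasis ℂ V).orthonormal) i j
  simpa using this
end Hermitian

section TwoForms
variable {E : Type*} [NormedAddCommGroup E] [NormedSpace ℂ E]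

/-- A `2`-form as a bilinear map. -/
def altBilin (γ : Alt E 2) : E →ₗ[ℝ] E →ₗ[ℝ] ℂ :=
  LinearMap.mk₂ ℝ (fun v w => γ ![v, w])
    (fun v v' w => by
      change γ.curryLeft (v + v') ![w] = γ.curryLeft v ![w] + γ.curryLeft v' ![w]
      rw [map_add]; rfl)
    (fun c v w => by
      change γ.curryLeft (c • v) ![w] = c • γ.curryLeft v ![w]
      rw [map_smul]; rfl)
    (fun v w w' => by
      change (γ.curryLeft v).curryLeft (w + w') ![] =
        (γ.curryLeft v).curryLeft w ![] + (γ.curryLeft v).curryLeft w' ![]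
      rw [map_add]; rfl)
    (fun c v w => by
      change (γ.curryLeft v).curryLeft (c • w) ![] = c • (γ.curryLeft v).curryLeft w ![]
      rw [map_smul]; rfl)

theorem altBilin_apply (γ : Alt E 2) (v w : E) : altBilin γ v w = γ ![v, w] := rfl

theorem altBilin_swap (γ : Alt E 2) (v w : E) : altBilin γ v w = -altBilin γ w v :=
  congrArg (fun β : Alt E 0 => β ![]) (altInt_altInt w v γ)

end TwoForms

section Metric
variable {E X : Type*} [NormedAddCommGroup E] [NormedSpace ℂ E]
  [TopologicalSpace X] [ChartedSpace E X]

/-- The Riemannian metric of a Hermitian metric in a chart. -/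
def HermitianMetric.metric (g : HermitianMetric E X) (e : atlas E X) (z : E) (v w : E) : ℝ :=
  (altBilin (g.form.1 e z) v (Complex.I • w)).re

variable (g : HermitianMetric E X) (e : atlas E X) (z : E)

namespace HermitianMetric

theorem metric_add_left (v v' w : E) :
    g.metric e z (v + v') w = g.metric e z v w + g.metric e z v' w := by simp [metric]

theorem metric_smul_left (c : ℝ) (v w : E) :
    g.metric e z (c • v) w = c * g.metric e z v w := by simp [metric]

theorem metric_smul_right (c : ℝ) (v w : E) :
    g.metric e z v (c • w) = c * g.metric e z v w := by
  rw [metric, smul_comm]; simp [metric]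

theorem form_I_smul (v w : E) : altBilin (g.form.1 e z) (Complex.I • v) (Complex.I • w) =
    altBilin (g.form.1 e z) v w := g.type_one_one e z v w

theorem form_conj (v w : E) : starRingEnd ℂ (altBilin (g.form.1 e z) v w) =
    altBilin (g.form.1 e z) v w := Complex.conj_eq_iff_im.2 (g.real e z _)

theorem form_eq_re (v w : E) : altBilin (g.form.1 e z) v w =
    ((altBilin (g.form.1 e z) v w).re : ℂ) := (Complex.conj_eq_iff_re.1 (form_conj g e z v w)).symm

theorem metric_comm (v w : E) : g.metric e z v w = g.metric e z w v := by
  unfold metric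
  rw [← form_I_smul, smul_smul, Complex.I_mul_I, neg_one_smul, map_neg, altBilin_swap, neg_neg]

theorem metric_I_smul (v w : E) :
    g.metric e z (Complex.I • v) (Complex.I • w) = g.metric e z v w := by
  unfold metric
  rw [form_I_smul]

theorem metric_I_smul_left (v w : E) :
    g.metric e z (Complex.I • v) w = -g.metric e z v (Complex.I • w) := by
  rw [← metric_I_smul g e z v, smul_smul, Complex.I_mul_I, neg_one_smul, ← neg_one_smul ℝ w,
    metric_smul_right]
  ring

theorem metric_pos (hz : z ∈ e.1.target) {v : E} (hv : v ≠ 0) : 0 < g.metric e z v v :=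
  g.pos e z hz v hv

theorem metric_neg_right (v w : E) : g.metric e z v (-w) = -g.metric e z v w := by
  rw [← neg_one_smul ℝ w, metric_smul_right]; ring

/-- The Hermitian inner product on `E` of the metric at a point of a chart. -/
abbrev core (hz : z ∈ e.1.target) : InnerProductSpace.Core ℂ E where
  inner v w := ⟨g.metric e z v w, -g.metric e z v (Complex.I • w)⟩
  conj_inner_symm v w := by
    apply Complex.ext
    · exact g.metric_comm e z w v
    · change - -g.metric e z w (Complex.I • v) = -g.metric e z v (Complex.I • w)
      rw [neg_neg, g.metric_comm, metric_I_smul_left]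
  re_inner_nonneg v := by
    by_cases hv : v = 0
    · subst hv
      change 0 ≤ g.metric e z 0 0
      simp [metric]
    · exact (g.metric_pos e z hz hv).le
  add_left v v' w := by
    apply Complex.ext
    · exact metric_add_left ..
    · change -_ = -_ + -_
      rw [metric_add_left]; ring
  smul_left v w c := by
    have h : ∀ x y : E, g.metric e z (c • x) y = c.re * g.metric e z x y -
        c.im * g.metric e z x (Complex.I • y) := by
      intro x y
      conv_lhs => rw [← Complex.re_add_im c, add_smul, mul_smul]
      rw [metric_add_left, Complex.coe_smul, Complex.coe_smul, metric_smul_left, metric_smul_left,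
        metric_I_smul_left]
      ring
    apply Complex.ext
    · change g.metric e z (c • v) w = _
      rw [h, Complex.mul_re, Complex.conj_re, Complex.conj_im]
      ring
    · change -g.metric e z (c • v) (Complex.I • w) = _
      rw [h, Complex.mul_im, Complex.conj_re, Complex.conj_im, smul_smul, Complex.I_mul_I,
        neg_one_smul, metric_neg_right]
      ring
  definite v h := by
    by_contra hv
    exact (g.metric_pos e z hz hv).ne' (congrArg Complex.re h)

/-- A real basis of `E` is orthonormal at a point of a chart. -/
def IsOrthonormal {μ : Type*} [DecidableEq μ] (f : Module.Basis μ ℝ E) : Prop :=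
  ∀ a c, g.metric e z (f a) (f c) = if a = c then 1 else 0

/-- For an orthonormal basis of the Hermitian inner product with real part the metric, the real
parts give the orthonormality of the b_a, and the vanishing imaginary parts give that b_a is
orthogonal to i b_c. The frame is unitary at the point z only; as a basis of `E` it is constant in
the chart. -/
theorem exists_unitary_frame [FiniteDimensional ℂ E] (hz : z ∈ e.1.target) :
    ∃ b : Module.Basis (Fin (Module.finrank ℂ E)) ℂ E, g.IsOrthonormal e z (realFrame b) := by
  obtain ⟨b, hb⟩ := exists_orthonormal_basis_of_core (g.core e z hz)
  have h1 : ∀ a c, g.metric e z (b a) (b c) = if a = c then 1 else 0 := by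
    intro a c
    have := congrArg Complex.re (hb a c)
    refine this.trans ?_
    split_ifs <;> simp
  have h2 : ∀ a c, g.metric e z (b a) (Complex.I • b c) = 0 := by
    intro a c
    have := congrArg Complex.im (hb a c)
    have h3 : -g.metric e z (b a) (Complex.I • b c) = 0 := this.trans (by split_ifs <;> simp)
    linarith
  refine ⟨b, ?_⟩
  rintro ⟨i, a⟩ ⟨j, c⟩
  fin_cases i <;> fin_cases j
  · simp [realFrame_zero, h1]
  · simp [realFrame_zero, realFrame_one, h2]
  · simp [realFrame_zero, realFrame_one, h2, metric_I_smul_left]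
  · simp [realFrame_one, h1, metric_I_smul]

theorem metric_sum_sum {μ ν : Type*} (s : Finset μ) (t : Finset ν) (x : μ → ℝ) (v : μ → E)
    (y : ν → ℝ) (w : ν → E) : g.metric e z (∑ a ∈ s, x a • v a) (∑ c ∈ t, y c • w c) =
      ∑ a ∈ s, ∑ c ∈ t, x a * y c * g.metric e z (v a) (w c) := by
  simp only [metric, Finset.smul_sum, map_sum, LinearMap.sum_apply, Complex.re_sum]
  rw [Finset.sum_comm]
  refine Finset.sum_congr rfl fun a _ => Finset.sum_congr rfl fun c _ => ?_
  rw [smul_comm Complex.I]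
  simp
  ring
end HermitianMetric

open HermitianMetric
variable [FiniteDimensional ℂ E]

/-- The Gram matrix of the metric at a point of a chart with respect to a real basis. -/
def gramOf {ν : Type*} (f₀ : Module.Basis ν ℝ E) : Matrix ν ν ℝ :=
  Matrix.of fun a c => g.metric e z (f₀ a) (f₀ c)

section Ortho
variable {μ ν : Type*} [Fintype μ] [DecidableEq μ] [Fintype ν] [DecidableEq ν]
  {f : Module.Basis μ ℝ E} {g e z} (hf : g.IsOrthonormal e z f) (f₀ : Module.Basis ν ℝ E)
include hf

theorem gramOf_eq : gramOf g e z f₀ = Matrix.of (fun a m => f.repr (f₀ a) m) *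
    (Matrix.of fun a m => f.repr (f₀ a) m).transpose := by
  ext a c
  change g.metric e z (f₀ a) (f₀ c) = _
  rw [← f.sum_repr (f₀ a), ← f.sum_repr (f₀ c), metric_sum_sum]
  simp only [hf _ _, Matrix.mul_apply, Matrix.transpose_apply, Matrix.of_apply, f.sum_repr]
  refine Finset.sum_congr rfl fun m _ => ?_
  simp

theorem frame_mul_frame : (Matrix.of fun a m => f.repr (f₀ a) m) *
    (Matrix.of fun m a => (f₀).repr (f m) a) = 1 := by
  ext a c
  simp only [Matrix.mul_apply, Matrix.of_apply]
  have := congrArg (fun v => (f₀).repr v c) (f.sum_repr (f₀ a))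
  simp only [map_sum, map_smul, Finsupp.coe_finsetSum, Finset.sum_apply, Finsupp.smul_apply,
    smul_eq_mul, Module.Basis.repr_self, Finsupp.single_apply] at this
  rw [this, Matrix.one_apply]

theorem frame_mul_frame' : (Matrix.of fun m a => (f₀).repr (f m) a) *
    (Matrix.of fun a m => f.repr (f₀ a) m) = 1 := by
  ext a c
  simp only [Matrix.mul_apply, Matrix.of_apply]
  have := congrArg (fun v => f.repr v c) ((f₀).sum_repr (f a))
  simp only [map_sum, map_smul, Finsupp.coe_finsetSum, Finset.sum_apply, Finsupp.smul_apply,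
    smul_eq_mul, Module.Basis.repr_self, Finsupp.single_apply] at this
  rw [this, Matrix.one_apply]

theorem gramOf_inv : (gramOf g e z f₀)⁻¹ =
    (Matrix.of fun m a => (f₀).repr (f m) a).transpose *
      Matrix.of fun m a => (f₀).repr (f m) a := by
  refine Matrix.inv_eq_right_inv ?_
  rw [gramOf_eq hf f₀, Matrix.mul_assoc, ← Matrix.mul_assoc (Matrix.transpose _), ← Matrix.transpose_mul,
    frame_mul_frame' hf f₀, Matrix.transpose_one, Matrix.one_mul, frame_mul_frame hf f₀]

/-- The inverse Gram matrix is exactly what turns into the identity matrix under the change to an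
orthonormal basis. Hence the inner product of the statement can be computed in any frame that is
orthonormal at the point. -/
theorem matInner_gramOf (k : ℕ) : matInner f₀ (gramOf g e z f₀)⁻¹ k = orthoInner f k := by
  rw [matInner_change_basis _ f _ (Matrix.of fun a m => f.repr (f₀ a) m)
    (fun a => (f.sum_repr _).symm), gramOf_inv hf f₀, Matrix.mul_assoc, Matrix.mul_assoc,
    frame_mul_frame' hf f₀, Matrix.mul_one, ← Matrix.transpose_mul, frame_mul_frame' hf f₀,
    Matrix.transpose_one]
  rfl

theorem altInner_eq (k : ℕ) (α β : Alt E k) : altInner g e z k α β = orthoInner f k α β := by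
  rw [← matInner_gramOf hf (Module.finBasis ℝ E) k]
  rfl

theorem gramOf_det_pos_of_orthonormal : 0 < (gramOf g e z f₀).det := by
  have hcard : Fintype.card μ = Fintype.card ν := by
    rw [← Module.finrank_eq_card_basis f, Module.finrank_eq_card_basis f₀]
  -- The two bases may be indexed by different types; reindexing makes the transition matrix square,
  -- so that it has a determinant.
  let σ : ν ≃ μ := (Fintype.equivOfCardEq hcard).symm
  have h1 : gramOf g e z f₀ = ((Matrix.of fun a m => f.repr (f₀ a) m).submatrix id σ) *
      ((Matrix.of fun a m => f.repr (f₀ a) m).submatrix id σ).transpose := by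
    rw [gramOf_eq hf f₀, Matrix.transpose_submatrix, Matrix.submatrix_mul_equiv, Matrix.submatrix_id_id]
  have h2 : ((Matrix.of fun a m => f.repr (f₀ a) m).submatrix id σ) *
      ((Matrix.of fun m a => (f₀).repr (f m) a).submatrix σ id) = 1 := by
    rw [Matrix.submatrix_mul_equiv, frame_mul_frame hf f₀, Matrix.submatrix_id_id]
  have h3 := congrArg Matrix.det h2
  rw [Matrix.det_mul, Matrix.det_one] at h3
  rw [h1, Matrix.det_mul, Matrix.det_transpose]
  exact mul_self_pos.2 (left_ne_zero_of_mul_eq_one h3)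
end Ortho

theorem gramOf_det_pos {ν : Type*} [Fintype ν] [DecidableEq ν] (hz : z ∈ e.1.target)
    (f₀ : Module.Basis ν ℝ E) : 0 < (gramOf g e z f₀).det := by
  obtain ⟨b, hb⟩ := g.exists_unitary_frame e z hz
  exact gramOf_det_pos_of_orthonormal hb f₀

theorem altInner_eq_matInner {ν : Type*} [Fintype ν] [DecidableEq ν] (hz : z ∈ e.1.target)
    (f₀ : Module.Basis ν ℝ E) (k : ℕ) (α β : Alt E k) :
    altInner g e z k α β = matInner f₀ (gramOf g e z f₀)⁻¹ k α β := by
  obtain ⟨b, hb⟩ := g.exists_unitary_frame e z hz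
  rw [altInner_eq hb, matInner_gramOf hb]

theorem gram_det_pos (hz : z ∈ e.1.target) : 0 < (gram g e z).det :=
  gramOf_det_pos g e z hz (Module.finBasis ℝ E)

/-- The inner product on forms of all degrees at a point of a chart. -/
def fibInner : Fib E →ₗ[ℂ] Fib E →ₛₗ[starRingEnd ℂ] ℂ :=
  LinearMap.mk₂'ₛₗ (RingHom.id ℂ) (starRingEnd ℂ)
    (fun u v => ∑ k ∈ Finset.range (2 * Module.finrank ℂ E + 1),
      matInner (Module.finBasis ℝ E) (gram g e z)⁻¹ k (u k) (v k))
    (fun u u' v => by simp [Finset.sum_add_distrib])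
    (fun c u v => by simp [Finset.mul_sum])
    (fun u v v' => by simp [Finset.sum_add_distrib])
    (fun c u v => by simp [Finset.mul_sum])

theorem fibInner_apply (u v : Fib E) : fibInner g e z u v =
    ∑ k ∈ Finset.range (2 * Module.finrank ℂ E + 1), altInner g e z k (u k) (v k) := rfl

section OrthoFib
variable {μ : Type*} [Fintype μ] [DecidableEq μ] {f : Module.Basis μ ℝ E}
  {g e z} (hf : g.IsOrthonormal e z f)
include hf

theorem fibInner_eq (u v : Fib E) : fibInner g e z u v =
    ∑ k ∈ Finset.range (2 * Module.finrank ℂ E + 1), orthoInner f k (u k) (v k) :=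
  (fibInner_apply g e z u v).trans (Finset.sum_congr rfl fun _ _ => altInner_eq hf _ _ _)

theorem fibInner_conj_of_orthonormal (u v : Fib E) :
    starRingEnd ℂ (fibInner g e z u v) = fibInner g e z v u := by
  simp only [fibInner_eq hf, map_sum, orthoInner_conj]

theorem fibInner_fibExt (a : μ) (u v : Fib E) :
    fibInner g e z (fibExt (dualCovector f a) u) v = fibInner g e z u (fibInt (f a) v) := by
  rw [fibInner_eq hf, fibInner_eq hf, Finset.sum_range_succ', Finset.sum_range_succ, fibExt_zero,
    map_zero, LinearMap.zero_apply]
  congr 1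
  · exact Finset.sum_congr rfl fun k _ => orthoInner_altExt f a k _ _
  -- Both sums stop at degree 2n, but the adjointness shifts the degree by one. The unmatched
  -- summand pairs with a contraction of a form of degree 2n + 1, which is zero.
  · have := alt_subsingleton E (k := 2 * Module.finrank ℂ E + 1) (by omega)
    rw [fibInt_apply, Subsingleton.elim (v (2 * Module.finrank ℂ E + 1)) 0, map_zero, map_zero]

theorem fibInner_fibInt (a : μ) (u v : Fib E) :
    fibInner g e z (fibInt (f a) u) v = fibInner g e z u (fibExt (dualCovector f a) v) := by
  rw [← fibInner_conj_of_orthonormal hf, ← fibInner_fibExt hf, fibInner_conj_of_orthonormal hf]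
end OrthoFib

section Pos
variable {g e z} (hz : z ∈ e.1.target)
include hz

theorem fibInner_conj (u v : Fib E) :
    starRingEnd ℂ (fibInner g e z u v) = fibInner g e z v u := by
  obtain ⟨b, hb⟩ := g.exists_unitary_frame e z hz
  exact fibInner_conj_of_orthonormal hb u v

theorem altInner_self_nonneg (k : ℕ) (α : Alt E k) : 0 ≤ (altInner g e z k α α).re := by
  obtain ⟨b, hb⟩ := g.exists_unitary_frame e z hz
  rw [altInner_eq hb]
  exact orthoInner_nonneg _ _ _

theorem eq_zero_of_altInner_self {k : ℕ} {α : Alt E k} (h : (altInner g e z k α α).re = 0) :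
    α = 0 := by
  obtain ⟨b, hb⟩ := g.exists_unitary_frame e z hz
  rw [altInner_eq hb] at h
  exact eq_zero_of_orthoInner_self _ _ _ h

theorem fibInner_self_nonneg (u : Fib E) : 0 ≤ (fibInner g e z u u).re := by
  rw [fibInner_apply, Complex.re_sum]
  exact Finset.sum_nonneg fun k _ => altInner_self_nonneg hz k _

theorem eq_zero_of_fibInner_self {u : Fib E} (h : (fibInner g e z u u).re = 0) : u = 0 := by
  rw [fibInner_apply, Complex.re_sum] at h
  replace h := (Finset.sum_eq_zero_iff_of_nonneg fun k _ => altInner_self_nonneg hz k (u k)).1 h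
  refine Fib.ext fun k => ?_
  by_cases hk : k < 2 * Module.finrank ℂ E + 1
  · exact eq_zero_of_altInner_self hz (h k (Finset.mem_range.2 hk))
  · have := alt_subsingleton E (k := k) (by omega)
    exact Subsingleton.elim _ _

/-- The device by which an operator given as an adjoint is identified: it is enough to compare inner
products with all forms of the fibre. -/
theorem fibInner_left_injective {u u' : Fib E} (h : ∀ v, fibInner g e z v u = fibInner g e z v u') :
    u = u' := by
  have h1 := h (u - u')
  rw [← sub_eq_zero, ← map_sub] at h1
  exact sub_eq_zero.1 (eq_zero_of_fibInner_self hz (by rw [h1]; rfl))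
end Pos

section Unitary
variable {ι : Type*} [Fintype ι] [DecidableEq ι] {b : Module.Basis ι ℂ E}
  {g e z} (hb : g.IsOrthonormal e z (realFrame b))
include hb

/-- The factor 2 is the squared norm of dz = dx + i dy, while ∂/∂z is normalized by dz(∂/∂z) = 1. -/
theorem fibInner_creation (s : ι ⊕ ι) (u v : Fib E) :
    fibInner g e z (creation b s u) v = fibInner g e z u ((2 : ℂ) • annihilation b s v) := by
  have h0 : ∀ a, dz b a = dualCovector (realFrame b) (0, a) +
      Complex.I • dualCovector (realFrame b) (1, a) := by
    intro a
    rw [dualCovector_realFrame_zero, dualCovector_realFrame_one, smul_smul]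
    ring_nf; rw [Complex.I_sq]; module
  have h1 : ∀ a, dzBar b a = dualCovector (realFrame b) (0, a) -
      Complex.I • dualCovector (realFrame b) (1, a) := by
    intro a
    rw [dualCovector_realFrame_zero, dualCovector_realFrame_one, smul_smul]
    ring_nf; rw [Complex.I_sq]; module
  cases s with
  | inl a =>
    simp only [creation, annihilation, Sum.elim_inl, h0, map_add, map_smul, LinearMap.add_apply,
      LinearMap.smul_apply, fibInner_fibExt hb, realFrame_zero, realFrame_one, smul_smul,
      LinearMap.sub_apply, map_sub, map_smulₛₗ, smul_eq_mul, RingHom.id_apply, Complex.conj_I]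
    norm_num
  | inr a =>
    simp only [creation, annihilation, Sum.elim_inr, h1, map_add, map_smul, LinearMap.add_apply,
      LinearMap.smul_apply, fibInner_fibExt hb, realFrame_zero, realFrame_one, smul_smul,
      LinearMap.sub_apply, map_sub, map_smulₛₗ, smul_eq_mul, RingHom.id_apply, Complex.conj_I]
    norm_num
    ring

theorem fibInner_annihilation (s : ι ⊕ ι) (u v : Fib E) :
    fibInner g e z (annihilation b s u) v = fibInner g e z u ((1 / 2 : ℂ) • creation b s v) := by
  have h := fibInner_creation hb s v u
  rw [← fibInner_conj_of_orthonormal hb, map_smulₛₗ, ← fibInner_conj_of_orthonormal hb (creation b s v) u,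
    h, map_smulₛₗ, smul_eq_mul, smul_eq_mul, map_mul, Complex.conj_conj]
  have h1 : starRingEnd ℂ (1 / 2 : ℂ) = 1 / 2 := by simpa using Complex.conj_ofReal (1 / 2)
  have h2 : starRingEnd ℂ (2 : ℂ) = 2 := by simpa using Complex.conj_ofReal 2
  simp only [h1, map_smulₛₗ, h2, smul_eq_mul, map_mul]
  ring
end Unitary

end Metric

/-! ### Derivatives of matrix inverses and determinants at the identity matrix. -/

section MatrixCalculus
variable {E : Type*} [NormedAddCommGroup E] [NormedSpace ℝ E] {𝕜 : Type*} [NormedField 𝕜]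
  [NormedAlgebra ℝ 𝕜] {ν : Type*} [Fintype ν] [DecidableEq ν] {s : Set E}

theorem contDiffOn_matrix_det {M : E → Matrix ν ν 𝕜}
    (hM : ∀ i j, ContDiffOn ℝ ∞ (fun z => M z i j) s) : ContDiffOn ℝ ∞ (fun z => (M z).det) s := by
  simp only [Matrix.det_apply, Units.smul_def]
  exact ContDiffOn.sum fun σ _ => (contDiffOn_prod fun i _ => hM _ _).const_smul _

theorem contDiffOn_matrix_inv {M : E → Matrix ν ν 𝕜}
    (hM : ∀ i j, ContDiffOn ℝ ∞ (fun z => M z i j) s) (hdet : ∀ z ∈ s, (M z).det ≠ 0) (i j : ν) :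
    ContDiffOn ℝ ∞ (fun z => (M z)⁻¹ i j) s := by
  simp only [Matrix.inv_def, Matrix.smul_apply, Ring.inverse_eq_inv', smul_eq_mul]
  refine ((contDiffOn_matrix_det hM).inv hdet).mul ?_
  simp only [Matrix.adjugate_apply]
  refine contDiffOn_matrix_det fun k l => ?_
  simp only [Matrix.updateRow_apply]
  split_ifs
  · exact contDiffOn_const
  · exact hM k l

/-- Differentiation of M⁻¹M = 1 at a point where M is the identity. -/
theorem fderiv_matrix_inv {M : E → Matrix ν ν ℝ} {z : E}
    (hM : ∀ i j, DifferentiableAt ℝ (fun z => M z i j) z)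
    (hM' : ∀ i j, DifferentiableAt ℝ (fun z => (M z)⁻¹ i j) z)
    (hdet : ∀ᶠ w in nhds z, (M w).det ≠ 0) (h1 : M z = 1) (i j : ν) (w : E) :
    fderiv ℝ (fun z => (M z)⁻¹ i j) z w = -fderiv ℝ (fun z => M z i j) z w := by
  have h2 : (fun z => ∑ k, (M z)⁻¹ i k * M z k j) =ᶠ[nhds z] fun _ => (1 : Matrix ν ν ℝ) i j := by
    filter_upwards [hdet] with w hw
    rw [← Matrix.mul_apply, Matrix.nonsing_inv_mul _ (isUnit_iff_ne_zero.2 hw)]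
  have h3 := DFunLike.congr_fun (Filter.EventuallyEq.fderiv_eq (𝕜 := ℝ) h2) w
  have hd : ∀ k ∈ Finset.univ, DifferentiableAt ℝ (fun z => (M z)⁻¹ i k * M z k j) z :=
    fun k _ => (hM' i k).fun_mul (hM k j)
  rw [fderiv_fun_sum hd] at h3
  simp only [fderiv_fun_const, Pi.zero_apply, _root_.zero_apply, _root_.sum_apply] at h3
  rw [Finset.sum_congr rfl fun k _ => by rw [fderiv_fun_mul (hM' i k) (hM k j)]] at h3
  simp only [_root_.add_apply, _root_.smul_apply, h1, inv_one, smul_eq_mul,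
    Finset.sum_add_distrib, Matrix.one_apply, ite_mul, one_mul, zero_mul] at h3
  simp at h3
  linarith

theorem fderiv_matrix_det {M : E → Matrix ν ν ℝ} {z : E}
    (hM : ∀ i j, DifferentiableAt ℝ (fun z => M z i j) z) (h1 : M z = 1) (w : E) :
    fderiv ℝ (fun z => (M z).det) z w = ∑ i, fderiv ℝ (fun z => M z i i) z w := by
  let F : (ν → ν → ℝ) → ℝ := fun A => (Matrix.of A).det
  have hF : ContDiff ℝ ∞ F := by
    rw [← contDiffOn_univ]
    exact contDiffOn_matrix_det fun i j => (contDiff_apply_apply ℝ ℝ i j).contDiffOn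
  have hFd : ∀ A, HasFDerivAt F (fderiv ℝ F A) A := fun A =>
    (hF.differentiable (by simp) A).hasFDerivAt
  have hpi : HasFDerivAt (fun z => (fun i j => M z i j : ν → ν → ℝ))
      (ContinuousLinearMap.pi fun i => ContinuousLinearMap.pi fun j =>
        fderiv ℝ (fun z => M z i j) z) z :=
    hasFDerivAt_pi.2 fun i => hasFDerivAt_pi.2 fun j => (hM i j).hasFDerivAt
  have h2 := ((hFd _).comp z hpi).fderiv
  have h3 : (F ∘ fun z => (fun i j => M z i j : ν → ν → ℝ)) = fun z => (M z).det := rfl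
  rw [h3] at h2
  rw [h2, ContinuousLinearMap.comp_apply]
  have h4 : (fun i j => M z i j) = (1 : Matrix ν ν ℝ) := by rw [h1]
  rw [h4]
  have h5 : ∀ B : Matrix ν ν ℝ, fderiv ℝ F (1 : Matrix ν ν ℝ) B = B.trace := by
    intro B
    have h6 : HasDerivAt (fun t : ℝ => (fun i j => (1 : Matrix ν ν ℝ) i j + t * B i j : ν → ν → ℝ))
        (fun i j => B i j) 0 := by
      refine hasDerivAt_pi.2 fun i => hasDerivAt_pi.2 fun j => ?_
      simpa using ((hasDerivAt_id (0 : ℝ)).mul_const (B i j)).const_add ((1 : Matrix ν ν ℝ) i j)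
    have h7 : (fun i j => (1 : Matrix ν ν ℝ) i j + (0 : ℝ) * B i j : ν → ν → ℝ) =
      (1 : Matrix ν ν ℝ) := by ext i j; simp
    have h8 := HasFDerivAt.comp_hasDerivAt (0 : ℝ) (by rw [h7]; exact hFd _) h6
    have h9 : (F ∘ fun t : ℝ => (fun i j => (1 : Matrix ν ν ℝ) i j + t * B i j : ν → ν → ℝ)) =
        fun t => (1 + t • B).det := rfl
    rw [h9] at h8
    have h10 : HasDerivAt (fun t : ℝ => (1 + t • B).det) B.trace 0 := by
      have : (fun t : ℝ => (1 + t • B).det) = fun t => 1 + B.trace * t +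
          (Polynomial.eval t (Matrix.det (1 + (Polynomial.X : Polynomial ℝ) •
            B.map Polynomial.C)).divX.divX) * t ^ 2 := by
        funext t
        exact Matrix.det_one_add_smul t B
      rw [this]
      have h11 := (((hasDerivAt_id (0 : ℝ)).const_mul B.trace).const_add 1).add
        ((Polynomial.hasDerivAt (Matrix.det (1 + (Polynomial.X : Polynomial ℝ) •
            B.map Polynomial.C)).divX.divX 0).mul ((hasDerivAt_id (0 : ℝ)).pow 2))
      exact (h11.congr_deriv (by simp)).congr_of_eventuallyEq (Filter.Eventually.of_forall fun t => rfl)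
    exact h8.unique h10
  exact h5 _
end MatrixCalculus

/-! ### The first derivative of the inner product of constant forms. -/

section MetricCalculus
variable {E X : Type*} [NormedAddCommGroup E] [NormedSpace ℂ E] [FiniteDimensional ℂ E]
  [TopologicalSpace X] [ChartedSpace E X] (g : HermitianMetric E X) (e : atlas E X)

/-- Evaluation of alternating forms as a continuous linear map. -/
def altEval {k : ℕ} (v : Fin k → E) : Alt E k →L[ℝ] ℂ :=
  LinearMap.toContinuousLinearMap
    { toFun := fun α => α v, map_add' := fun _ _ => rfl, map_smul' := fun _ _ => rfl }

theorem altEval_apply {k : ℕ} (v : Fin k → E) (α : Alt E k) : altEval v α = α v := rfl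

theorem contDiffOn_metric (v w : E) : ContDiffOn ℝ ∞ (fun z => g.metric e z v w) e.1.target :=
  Complex.reCLM.contDiff.comp_contDiffOn
    ((altEval ![v, Complex.I • w]).contDiff.comp_contDiffOn (g.form.2.2.1 e))

theorem contDiffOn_gramOf_inv {ν : Type*} [Fintype ν] [DecidableEq ν] (f₀ : Module.Basis ν ℝ E)
    (i j : ν) : ContDiffOn ℝ ∞ (fun z => (gramOf g e z f₀)⁻¹ i j) e.1.target :=
  contDiffOn_matrix_inv (fun i j => contDiffOn_metric g e (f₀ i) (f₀ j))
    (fun z hz => (gramOf_det_pos g e z hz f₀).ne') i j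

/-- The real bilinear form on `k`-forms induced by a matrix with respect to a real basis, as a
continuous bilinear map. -/
def matInnerCLM {ν : Type*} [Fintype ν] (f : Module.Basis ν ℝ E) (M : Matrix ν ν ℝ) (k : ℕ) :
    Alt E k →L[ℝ] Alt E k →L[ℝ] ℂ :=
  (k.factorial : ℝ)⁻¹ • ∑ i : Fin k → ν, ∑ j : Fin k → ν, (∏ l, M (i l) (j l)) •
    (ContinuousLinearMap.mul ℝ ℂ).bilinearComp (altEval fun l => f (i l))
      ((Complex.conjCLE : ℂ →L[ℝ] ℂ).comp (altEval fun l => f (j l)))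

theorem matInnerCLM_apply {ν : Type*} [Fintype ν] (f : Module.Basis ν ℝ E) (M : Matrix ν ν ℝ)
    (k : ℕ) (α β : Alt E k) : matInnerCLM f M k α β = matInner f M k α β := by
  simp only [matInnerCLM, matInner_apply, _root_.smul_apply, _root_.sum_apply,
    ContinuousLinearMap.bilinearComp_apply, ContinuousLinearMap.mul_apply', altEval_apply,
    Complex.real_smul]
  push_cast
  rfl

theorem contDiffOn_matInnerCLM {ν : Type*} [Fintype ν] [DecidableEq ν] (f₀ : Module.Basis ν ℝ E)
    (k : ℕ) : ContDiffOn ℝ ∞ (fun z => matInnerCLM f₀ (gramOf g e z f₀)⁻¹ k) e.1.target := by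
  unfold matInnerCLM
  refine ContDiffOn.const_smul _ (ContDiffOn.sum fun i _ => ContDiffOn.sum fun j _ => ?_)
  exact (contDiffOn_prod fun l _ => contDiffOn_gramOf_inv g e f₀ _ _).smul contDiffOn_const

theorem contDiffOn_altInner {k : ℕ} {α β : E → Alt E k} {s : Set E} (hs : s ⊆ e.1.target)
    (hα : ContDiffOn ℝ ∞ α s) (hβ : ContDiffOn ℝ ∞ β s) :
    ContDiffOn ℝ ∞ (fun z => altInner g e z k (α z) (β z)) s := by
  have := (((contDiffOn_matInnerCLM g e (Module.finBasis ℝ E) k).mono hs).clm_apply hα).clm_apply hβ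
  refine this.congr fun z _ => ?_
  rw [matInnerCLM_apply]
  rfl

variable {e} {z : E} (hz : z ∈ e.1.target)
include hz

theorem differentiableAt_of_contDiffOn {F : Type*} [NormedAddCommGroup F] [NormedSpace ℝ F]
    {f : E → F} (hf : ContDiffOn ℝ ∞ f e.1.target) : DifferentiableAt ℝ f z :=
  (hf.contDiffAt (e.1.open_target.mem_nhds hz)).differentiableAt (by simp)

/-- The derivative of the metric in the direction `w`, in a real basis, as an endomorphism of the
forms. -/
def metricDeriv (g : HermitianMetric E X) (e : atlas E X) (z w : E) {μ : Type*} [Fintype μ]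
    (f : Module.Basis μ ℝ E) (k : ℕ) (α : Alt E (k + 1)) : Alt E (k + 1) :=
  -∑ a, ∑ c, (fderiv ℝ (fun z => g.metric e z (f a) (f c)) z w : ℂ) •
    altExt (dualCovector f c) k (altInt (f a) k α)

variable {μ : Type*} [Fintype μ] [DecidableEq μ] {f : Module.Basis μ ℝ E}
  (hf : g.IsOrthonormal e z f)
include hf

theorem gramOf_eq_one : gramOf g e z f = 1 := by
  ext a c
  rw [Matrix.one_apply]
  exact hf a c

theorem fderiv_gramOf_inv (a c : μ) (w : E) :
    fderiv ℝ (fun z => (gramOf g e z f)⁻¹ a c) z w =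
      -fderiv ℝ (fun z => g.metric e z (f a) (f c)) z w :=
  fderiv_matrix_inv (fun _ _ => differentiableAt_of_contDiffOn hz (contDiffOn_metric g e _ _))
    (fun _ _ => differentiableAt_of_contDiffOn hz (contDiffOn_gramOf_inv g e f _ _))
    (Filter.eventually_of_mem (e.1.open_target.mem_nhds hz)
      fun z hz => (gramOf_det_pos g e z hz f).ne') (gramOf_eq_one g hz hf) a c w

/-- The inductive step for `fderiv_matInner_const`: S represents the derivative in degree k, and the
index split off by the recursion contributes the derivative of the inverse Gram matrix, which is
minus that of the metric. -/
theorem fderiv_matInner_const_succ (k : ℕ) (α β : Alt E (k + 1)) (w : E) (S : Alt E k → Alt E k)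
    (ih : ∀ α β : Alt E k, fderiv ℝ (fun z => matInner f (gramOf g e z f)⁻¹ k α β) z w =
      orthoInner f k (S α) β) :
    fderiv ℝ (fun z => matInner f (gramOf g e z f)⁻¹ (k + 1) α β) z w =
      ((k + 1 : ℕ) : ℂ)⁻¹ * ((∑ a, orthoInner f k (S (altInt (f a) k α)) (altInt (f a) k β)) -
        ∑ a, ∑ c, (fderiv ℝ (fun z => g.metric e z (f a) (f c)) z w : ℂ) *
          orthoInner f k (altInt (f a) k α) (altInt (f c) k β)) := by
  have hM : ∀ a c, DifferentiableAt ℝ (fun z => (((gramOf g e z f)⁻¹ a c : ℝ) : ℂ)) z := fun a c =>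
    Complex.ofRealCLM.differentiableAt.comp z
      (differentiableAt_of_contDiffOn hz (contDiffOn_gramOf_inv g e f a c))
  have hI : ∀ α β : Alt E k, DifferentiableAt ℝ
      (fun z => matInner f (gramOf g e z f)⁻¹ k α β) z := by
    intro α β
    have := ((contDiffOn_matInnerCLM g e f k).clm_apply
      (contDiffOn_const (c := α))).clm_apply (contDiffOn_const (c := β))
    simp only [matInnerCLM_apply] at this
    exact differentiableAt_of_contDiffOn hz this
  have hMd : ∀ a c, fderiv ℝ (fun z => (((gramOf g e z f)⁻¹ a c : ℝ) : ℂ)) z w =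
      -(fderiv ℝ (fun z => g.metric e z (f a) (f c)) z w : ℂ) := by
    intro a c
    have h1 := fderiv_comp (𝕜 := ℝ) z (Complex.ofRealCLM.differentiableAt)
      (differentiableAt_of_contDiffOn hz (contDiffOn_gramOf_inv g e f a c))
    have h2 := DFunLike.congr_fun h1 w
    refine h2.trans ?_
    rw [ContinuousLinearMap.fderiv, ContinuousLinearMap.comp_apply,
      fderiv_gramOf_inv g hz hf a c w]
    simp
  simp only [matInner_succ]
  have hd : ∀ a c, DifferentiableAt ℝ (fun z => (((gramOf g e z f)⁻¹ a c : ℝ) : ℂ) *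
      matInner f (gramOf g e z f)⁻¹ k (altInt (f a) k α) (altInt (f c) k β)) z :=
    fun a c => (hM a c).fun_mul (hI _ _)
  rw [fderiv_const_mul]
  · rw [fderiv_fun_sum fun a _ => DifferentiableAt.fun_sum fun c _ => hd a c]
    simp only [_root_.smul_apply, _root_.sum_apply, smul_eq_mul]
    congr 1
    rw [← Finset.sum_sub_distrib]
    refine Finset.sum_congr rfl fun a _ => ?_
    rw [fderiv_fun_sum fun c _ => hd a c]
    simp only [_root_.sum_apply]
    rw [Finset.sum_congr rfl fun c _ => by rw [fderiv_fun_mul (hM a c) (hI _ _)]]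
    simp only [_root_.add_apply, _root_.smul_apply, smul_eq_mul, ih, hMd, Finset.sum_add_distrib,
      gramOf_eq_one g hz hf, inv_one]
    rw [Finset.sum_eq_single a (fun c _ h => by simp [Matrix.one_apply_ne h.symm]) (by simp)]
    simp only [Matrix.one_apply_eq, Complex.ofReal_one, one_mul, sub_eq_add_neg, mul_neg,
      ← Finset.sum_neg_distrib]
    congr 1
    refine Finset.sum_congr rfl fun c _ => ?_
    rw [mul_comm]
    rfl
  · exact DifferentiableAt.fun_sum fun a _ => DifferentiableAt.fun_sum fun c _ => hd a c

/-- The derivative of the metric is a combination of operators eᵈ ∧ ι_c. Moving eᵃ past eᵈ and ι_a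
past ι_c costs two signs that cancel, and Euler's formula is applied to ι_c α, of degree k + 1. With
the term of the split index this makes k + 2, the denominator in the recursion. -/
theorem sum_altExt_metricDeriv (w : E) (k : ℕ) (α : Alt E (k + 2)) :
    ∑ a, altExt (dualCovector f a) (k + 1) (metricDeriv g e z w f k (altInt (f a) (k + 1) α)) =
      ((k + 1 : ℕ) : ℂ) • metricDeriv g e z w f (k + 1) α := by
  simp only [metricDeriv, map_neg, map_sum, map_smul, Finset.smul_sum, smul_neg,
    Finset.sum_neg_distrib]
  congr 1
  rw [Finset.sum_comm]
  refine Finset.sum_congr rfl fun c _ => ?_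
  rw [Finset.sum_comm]
  refine Finset.sum_congr rfl fun d _ => ?_
  rw [← Finset.smul_sum, smul_comm]
  congr 1
  have h1 : ∀ a, altExt (dualCovector f a) (k + 1) (altExt (dualCovector f d) k
      (altInt (f c) k (altInt (f a) (k + 1) α))) = altExt (dualCovector f d) (k + 1)
        (altExt (dualCovector f a) k (altInt (f a) k (altInt (f c) (k + 1) α))) := by
    intro a
    rw [altInt_altInt, map_neg, map_neg, eq_comm, ← add_eq_zero_iff_eq_neg]
    exact altExt_altExt _ _ _
  rw [Finset.sum_congr rfl fun a _ => h1 a, ← map_sum, sum_altExt_dual, map_smul]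

/-- The derivative of the inner product of constant forms. -/
theorem fderiv_matInner_const (k : ℕ) (α β : Alt E (k + 1)) (w : E) :
    fderiv ℝ (fun z => matInner f (gramOf g e z f)⁻¹ (k + 1) α β) z w =
      orthoInner f (k + 1) (metricDeriv g e z w f k α) β := by
  induction k with
  | zero =>
    rw [fderiv_matInner_const_succ g hz hf 0 α β w (fun _ => 0)
      (fun α β => by simp [matInner_zero])]
    simp only [metricDeriv, map_neg, map_sum, map_smul, LinearMap.neg_apply, LinearMap.sum_apply,
      LinearMap.smul_apply, orthoInner_altExt, map_zero, LinearMap.zero_apply]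
    simp
  | succ k ih =>
    rw [fderiv_matInner_const_succ g hz hf (k + 1) α β w _ ih]
    have h1 : ∀ a, orthoInner f (k + 1) (metricDeriv g e z w f k (altInt (f a) (k + 1) α))
        (altInt (f a) (k + 1) β) = orthoInner f (k + 2) (altExt (dualCovector f a) (k + 1)
          (metricDeriv g e z w f k (altInt (f a) (k + 1) α))) β := fun a =>
      (orthoInner_altExt f a _ _ _).symm
    rw [Finset.sum_congr rfl fun a _ => h1 a, ← LinearMap.sum_apply, ← map_sum,
      sum_altExt_metricDeriv g hz hf, map_smul, LinearMap.smul_apply]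
    have h2 : orthoInner f (k + 2) (metricDeriv g e z w f (k + 1) α) β =
        -∑ a, ∑ c, (fderiv ℝ (fun z => g.metric e z (f a) (f c)) z w : ℂ) *
          orthoInner f (k + 1) (altInt (f a) (k + 1) α) (altInt (f c) (k + 1) β) := by
      simp only [metricDeriv, map_neg, map_sum, map_smul, LinearMap.neg_apply, LinearMap.sum_apply,
        LinearMap.smul_apply, orthoInner_altExt, smul_eq_mul]
    have h3 : ((k + 1 + 1 : ℕ) : ℂ) ≠ 0 := by exact_mod_cast Nat.succ_ne_zero (k + 1)
    rw [sub_eq_add_neg, ← h2, inv_mul_eq_iff_eq_mul₀ h3, smul_eq_mul]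
    push_cast; ring

end MetricCalculus

/-! ### Componentwise derivatives of functions with values in the fibre. -/

section FibCalculus
variable {E : Type*} [NormedAddCommGroup E] [NormedSpace ℂ E]

/-- Differentiability of a function with values in the forms of all degrees. -/
def FibDiffAt (U : E → Fib E) (z : E) : Prop := ∀ k, DifferentiableAt ℝ (fun z => U z k) z

/-- The derivative of a function with values in the forms of all degrees. -/
def fibDeriv (U : E → Fib E) (z w : E) : Fib E := fun k => fderiv ℝ (fun z => U z k) z w

theorem fibDeriv_apply (U : E → Fib E) (z w : E) (k : ℕ) :
    fibDeriv U z w k = fderiv ℝ (fun z => U z k) z w := rfl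

theorem alt_linear_differentiableAt [FiniteDimensional ℂ E] {k l : ℕ} (T : Alt E k →ₗ[ℂ] Alt E l)
    {U : E → Alt E k} {z : E} (hU : DifferentiableAt ℝ U z) :
    DifferentiableAt ℝ (fun z => T (U z)) z :=
  (LinearMap.toContinuousLinearMap (T.restrictScalars ℝ)).differentiableAt.comp z hU

theorem alt_linear_fderiv [FiniteDimensional ℂ E] {k l : ℕ} (T : Alt E k →ₗ[ℂ] Alt E l)
    {U : E → Alt E k} {z : E} (hU : DifferentiableAt ℝ U z) (w : E) :
    fderiv ℝ (fun z => T (U z)) z w = T (fderiv ℝ U z w) := by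
  have := fderiv_comp (𝕜 := ℝ) z
    (LinearMap.toContinuousLinearMap (T.restrictScalars ℝ)).differentiableAt hU
  rw [ContinuousLinearMap.fderiv] at this
  exact DFunLike.congr_fun this w

theorem fibDeriv_congr {U V : E → Fib E} {z : E} (h : V =ᶠ[nhds z] U) (w : E) :
    fibDeriv V z w = fibDeriv U z w := Fib.ext fun k => by
  have : (fun z => V z k) =ᶠ[nhds z] fun z => U z k := h.mono fun z hz => by
    change V z k = U z k
    rw [hz]
  rw [fibDeriv_apply, fibDeriv_apply, this.fderiv_eq]

theorem fibDeriv_const (u : Fib E) (z w : E) : fibDeriv (fun _ => u) z w = 0 := Fib.ext fun k => by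
  change fderiv ℝ (fun _ => u k) z w = 0
  simp

variable [FiniteDimensional ℂ E]

theorem FibDiffAt.fibExt {U : E → Fib E} {z : E} (hU : FibDiffAt U z) (θ : E →L[ℝ] ℂ) :
    FibDiffAt (fun z => fibExt θ (U z)) z
  | 0 => differentiableAt_const _
  | k + 1 => alt_linear_differentiableAt (altExt θ k) (hU k)

theorem fibDeriv_fibExt {U : E → Fib E} {z : E} (hU : FibDiffAt U z) (θ : E →L[ℝ] ℂ) (w : E) :
    fibDeriv (fun z => fibExt θ (U z)) z w = fibExt θ (fibDeriv U z w) := Fib.ext fun k =>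
  match k with
  | 0 => by
    change fderiv ℝ (fun _ => (0 : Alt E 0)) z w = 0
    simp
  | k + 1 => alt_linear_fderiv (altExt θ k) (hU k) w

/-- A real-linear function of a vector, combined to its complex-linear part. -/
def holPart {M : Type*} [AddCommGroup M] [Module ℂ M] (F : E → M) (v : E) : M :=
  (1 / 2 : ℂ) • (F v - Complex.I • F (Complex.I • v))

/-- A real-linear function of a vector, combined to its antilinear part. -/
def antiPart {M : Type*} [AddCommGroup M] [Module ℂ M] (F : E → M) (v : E) : M :=
  (1 / 2 : ℂ) • (F v + Complex.I • F (Complex.I • v))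

/-- The splitting d = ∂ + ∂̄ at the level of a frame: dx, dy are replaced by dz, dz̄, and the
directional derivatives by their complex linear and antilinear parts. -/
theorem sum_realFrame_covector {ι : Type*} [Fintype ι] [DecidableEq ι] (b : Module.Basis ι ℂ E)
    (F : E → Fib E) :
    ∑ m, fibExt (dualCovector (realFrame b) m) (F (realFrame b m)) =
      ∑ a, creation b (Sum.inl a) (holPart F (b a)) +
        ∑ a, creation b (Sum.inr a) (antiPart F (b a)) := by
  rw [Fintype.sum_prod_type, Fin.sum_univ_two, ← Finset.sum_add_distrib, ← Finset.sum_add_distrib]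
  refine Finset.sum_congr rfl fun a _ => ?_
  rw [dualCovector_realFrame_zero, dualCovector_realFrame_one, realFrame_zero, realFrame_one]
  simp only [creation, holPart, antiPart, Sum.elim_inl, Sum.elim_inr, map_smul, map_add, map_sub,
    LinearMap.smul_apply, LinearMap.add_apply, LinearMap.sub_apply]
  module
end FibCalculus

/-! ### Product rule for the inner product of forms and derivative of the volume density. -/

section MetricFib
variable {E X : Type*} [NormedAddCommGroup E] [NormedSpace ℂ E] [FiniteDimensional ℂ E]
  [TopologicalSpace X] [ChartedSpace E X] (g : HermitianMetric E X) {e : atlas E X}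
  {z : E} (hz : z ∈ e.1.target)

/-- The derivative of the metric in the direction `w`, as an endomorphism of the forms of all
degrees. -/
def fibMetricDeriv (e : atlas E X) (z : E) {μ : Type*} [Fintype μ] (f : Module.Basis μ ℝ E)
    (w : E) : Module.End ℂ (Fib E) :=
  -∑ a, ∑ c, (fderiv ℝ (fun z => g.metric e z (f a) (f c)) z w : ℂ) •
    (fibExt (dualCovector f c) * fibInt (f a))

theorem fibMetricDeriv_zero {μ : Type*} [Fintype μ] (f : Module.Basis μ ℝ E) (w : E) (u : Fib E) :
    fibMetricDeriv g e z f w u 0 = 0 := by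
  simp only [fibMetricDeriv, LinearMap.neg_apply, LinearMap.sum_apply, LinearMap.smul_apply,
    Fib.neg_apply, Fib.sum_apply, Fib.smul_apply, Module.End.mul_apply, fibExt_zero]
  simp

theorem fibMetricDeriv_succ {μ : Type*} [Fintype μ] (f : Module.Basis μ ℝ E) (w : E) (u : Fib E)
    (k : ℕ) : fibMetricDeriv g e z f w u (k + 1) = metricDeriv g e z w f k (u (k + 1)) := by
  simp only [fibMetricDeriv, LinearMap.neg_apply, LinearMap.sum_apply, LinearMap.smul_apply,
    Fib.neg_apply, Fib.sum_apply, Fib.smul_apply, Module.End.mul_apply, fibExt_succ]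
  rfl

include hz
variable {μ : Type*} [Fintype μ] [DecidableEq μ] {f : Module.Basis μ ℝ E}
  (hf : g.IsOrthonormal e z f)

theorem differentiableAt_altInner {k : ℕ} {α β : E → Alt E k} (hα : DifferentiableAt ℝ α z)
    (hβ : DifferentiableAt ℝ β z) : DifferentiableAt ℝ (fun z => altInner g e z k (α z) (β z)) z := by
  have h := ((differentiableAt_of_contDiffOn hz (contDiffOn_matInnerCLM g e
    (Module.finBasis ℝ E) k)).clm_apply hα).clm_apply hβ
  simp only [matInnerCLM_apply] at h
  exact h

include hf

theorem fderiv_altInner {k : ℕ} {α β : E → Alt E k} (hα : DifferentiableAt ℝ α z)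
    (hβ : DifferentiableAt ℝ β z) (w : E) :
    fderiv ℝ (fun z => altInner g e z k (α z) (β z)) z w =
      altInner g e z k (fderiv ℝ α z w) (β z) + altInner g e z k (α z) (fderiv ℝ β z w) +
      altInner g e z k (fibMetricDeriv g e z f w (Fib.single k (α z)) k) (β z) := by
  have hG := differentiableAt_of_contDiffOn hz (contDiffOn_matInnerCLM g e f k)
  -- The fixed basis in the definition of the inner product is replaced by f. Its Gram matrix is the
  -- identity at z, though not nearby, so the derivative of the matrix takes its simple form.
  have h1 : (fun z => altInner g e z k (α z) (β z)) =ᶠ[nhds z]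
      fun z => matInnerCLM f (gramOf g e z f)⁻¹ k (α z) (β z) :=
    Filter.eventually_of_mem (e.1.open_target.mem_nhds hz) fun z hz => by
      beta_reduce
      rw [matInnerCLM_apply, altInner_eq_matInner g e z hz f]
  have h2 : matInnerCLM f (gramOf g e z f)⁻¹ k = matInnerCLM f 1 k := by
    rw [gramOf_eq_one g hz hf, inv_one]
  rw [h1.fderiv_eq, ((hG.hasFDerivAt.clm_apply hα.hasFDerivAt).clm_apply hβ.hasFDerivAt).fderiv]
  simp only [_root_.add_apply, ContinuousLinearMap.comp_apply, ContinuousLinearMap.flip_apply, h2,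
    matInnerCLM_apply, altInner_eq hf]
  change orthoInner f k _ _ + (orthoInner f k _ _ + _) = _
  rw [add_left_comm, ← add_assoc]
  congr 1
  -- The remaining term, where the metric is differentiated and both forms are frozen, is the
  -- derivative of the inner product of constant forms.
  have h4 : ∀ α₀ β₀ : Alt E k, fderiv ℝ (fun z => matInnerCLM f (gramOf g e z f)⁻¹ k) z w α₀ β₀ =
      fderiv ℝ (fun z => matInner f (gramOf g e z f)⁻¹ k α₀ β₀) z w := by
    intro α₀ β₀
    have h5 := ((hG.hasFDerivAt.clm_apply (hasFDerivAt_const α₀ z)).clm_apply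
      (hasFDerivAt_const β₀ z)).fderiv
    simp only [matInnerCLM_apply] at h5
    rw [h5]
    simp
  rw [h4]
  cases k with
  | zero =>
    rw [fibMetricDeriv_zero, map_zero, LinearMap.zero_apply]
    simp [matInner_zero]
  | succ k =>
    rw [fderiv_matInner_const g hz hf, fibMetricDeriv_succ, Fib.single_same]

/-- The product rule for the inner product of forms. -/
theorem fderiv_fibInner {U V : E → Fib E} (hU : FibDiffAt U z) (hV : FibDiffAt V z) (w : E) :
    fderiv ℝ (fun z => fibInner g e z (U z) (V z)) z w =
      fibInner g e z (fibDeriv U z w) (V z) + fibInner g e z (U z) (fibDeriv V z w) +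
      fibInner g e z (fibMetricDeriv g e z f w (U z)) (V z) := by
  simp only [fibInner_apply]
  rw [fderiv_fun_sum fun k _ => differentiableAt_altInner g hz (hU k) (hV k), _root_.sum_apply,
    ← Finset.sum_add_distrib, ← Finset.sum_add_distrib]
  refine Finset.sum_congr rfl fun k _ => ?_
  rw [fderiv_altInner g hz hf (hU k) (hV k)]
  congr 2
  cases k with
  | zero => rw [fibMetricDeriv_zero, fibMetricDeriv_zero]
  | succ k => rw [fibMetricDeriv_succ, fibMetricDeriv_succ, Fib.single_same]

omit hf in
theorem differentiableAt_fibInner {U V : E → Fib E} (hU : FibDiffAt U z) (hV : FibDiffAt V z) :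
    DifferentiableAt ℝ (fun z => fibInner g e z (U z) (V z)) z := by
  simp only [fibInner_apply]
  exact DifferentiableAt.fun_sum fun k _ => differentiableAt_altInner g hz (hU k) (hV k)

/-- The logarithmic derivative of the volume density. -/
theorem fderiv_sqrt_det_gram (w : E) :
    fderiv ℝ (fun z => Real.sqrt (gram g e z).det) z w =
      (1 / 2 * ∑ a, fderiv ℝ (fun z => g.metric e z (f a) (f a)) z w) *
        Real.sqrt (gram g e z).det := by
  have hcard : Fintype.card μ = Fintype.card (Fin (Module.finrank ℝ E)) := by
    rw [← Module.finrank_eq_card_basis f, Fintype.card_fin]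
  let σ : Fin (Module.finrank ℝ E) ≃ μ := (Fintype.equivOfCardEq hcard).symm
  -- Q is the constant matrix from f to the coordinate basis. The two Gram determinants differ by
  -- the constant factor (det Q)², which drops out of the logarithmic derivative; for f the
  -- derivative of the determinant is a trace.
  let Q : Matrix (Fin (Module.finrank ℝ E)) (Fin (Module.finrank ℝ E)) ℝ :=
    (Matrix.of fun a m => f.repr (Module.finBasis ℝ E a) m).submatrix id σ
  have h1 : ∀ z, gram g e z = Q * (gramOf g e z f).submatrix σ σ * Q.transpose := by
    intro z
    ext a c
    change g.metric e z (Module.finBasis ℝ E a) (Module.finBasis ℝ E c) = _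
    conv_lhs => rw [← f.sum_repr (Module.finBasis ℝ E a), ← f.sum_repr (Module.finBasis ℝ E c)]
    rw [HermitianMetric.metric_sum_sum, ← σ.sum_comp, Finset.sum_congr rfl fun i _ => (σ.sum_comp _).symm,
      Finset.sum_comm]
    simp only [Matrix.mul_apply, Matrix.transpose_apply, Q, Matrix.submatrix_apply, Matrix.of_apply,
      id_eq, gramOf, Finset.sum_mul]
    refine Finset.sum_congr rfl fun i _ => Finset.sum_congr rfl fun j _ => ?_
    ring
  have h3 : ∀ z, (gram g e z).det = Q.det * Q.det * (gramOf g e z f).det := by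
    intro z
    rw [h1, Matrix.det_mul, Matrix.det_mul, Matrix.det_transpose, Matrix.det_submatrix_equiv_self]
    ring
  have h4 := gram_det_pos g e z hz
  have hd : DifferentiableAt ℝ (fun z => (gramOf g e z f).det) z :=
    differentiableAt_of_contDiffOn hz
      (contDiffOn_matrix_det fun i j => contDiffOn_metric g e (f i) (f j))
  have h5 : HasFDerivAt (fun z => (gram g e z).det)
      ((Q.det * Q.det) • fderiv ℝ (fun z => (gramOf g e z f).det) z) z := by
    simp only [h3]
    exact hd.hasFDerivAt.const_mul _
  rw [(h5.sqrt h4.ne').fderiv]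
  have h6 := fderiv_matrix_det (M := fun z => gramOf g e z f) (z := z)
    (fun i j => differentiableAt_of_contDiffOn hz (contDiffOn_metric g e (f i) (f j)))
    (gramOf_eq_one g hz hf) w
  have h7 : Q.det * Q.det = (gram g e z).det := by
    rw [h3, gramOf_eq_one g hz hf, Matrix.det_one, mul_one]
  simp only [_root_.smul_apply, smul_eq_mul, h6, h7]
  have h8 : Real.sqrt (gram g e z).det * Real.sqrt (gram g e z).det = (gram g e z).det :=
    Real.mul_self_sqrt h4.le
  have h9 : Real.sqrt (gram g e z).det ≠ 0 := (Real.sqrt_pos.2 h4).ne'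
  set r := Real.sqrt (gram g e z).det
  set t := ∑ a, fderiv ℝ (fun z => gramOf g e z f a a) z w
  change _ = (1 / 2 * t) * r
  rw [← h8]
  field_simp

end MetricFib

/-! ### Operators on forms evaluated at a point of a chart; ∂ and ∂̄ in a frame. -/

section Eval
variable {E X : Type*} [NormedAddCommGroup E] [NormedSpace ℂ E] [TopologicalSpace X]
  [ChartedSpace E X]

/-- The value of a form at a point of a chart. -/
def ev (e : atlas E X) (z : E) : Forms E X →ₗ[ℂ] Fib E where
  toFun u := fun k => (u k).1 e z
  map_add' _ _ := rfl
  map_smul' _ _ := rfl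

theorem ev_apply (e : atlas E X) (z : E) (u : Forms E X) (k : ℕ) : ev e z u k = (u k).1 e z := rfl

theorem ev_of_notMem {e : atlas E X} {z : E} (hz : z ∉ e.1.target) (u : Forms E X) :
    ev e z u = 0 := Fib.ext fun k => (u k).2.1 e z hz

theorem forms_ext {u v : Forms E X} (h : ∀ e : atlas E X, ∀ z ∈ e.1.target, ev e z u = ev e z v) :
    u = v := by
  refine funext fun k => Subtype.ext (funext fun e => funext fun z => ?_)
  by_cases hz : z ∈ e.1.target
  · exact congrFun (h e z hz) k
  · rw [(u k).2.1 e z hz, (v k).2.1 e z hz]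

/-- All operator identities on the manifold are reduced by this to identities on a single fibre,
where a unitary frame of that point is available. -/
theorem end_ext {A B : Module.End ℂ (Forms E X)}
    (h : ∀ e : atlas E X, ∀ z ∈ e.1.target, ∀ u, ev e z (A u) = ev e z (B u)) : A = B :=
  LinearMap.ext fun u => forms_ext fun e z hz => h e z hz u

theorem contDiffOn_ev (e : atlas E X) (u : Forms E X) (k : ℕ) :
    ContDiffOn ℝ ∞ (fun z => ev e z u k) e.1.target := (u k).2.2.1 e

theorem fibDiffAt_ev {e : atlas E X} {z : E} (hz : z ∈ e.1.target) (u : Forms E X) :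
    FibDiffAt (fun z => ev e z u) z := fun k =>
  ((contDiffOn_ev e u k).contDiffAt (e.1.open_target.mem_nhds hz)).differentiableAt (by simp)

theorem ev_single_same (e : atlas E X) (z : E) (k : ℕ) (γ : DiffForm E X k) :
    ev e z (Forms.single k γ) = Fib.single k (γ.1 e z) := Fib.ext fun l => by
  by_cases h : l = k
  · subst h
    rw [Fib.single_same, ev_apply, Forms.single, Pi.single_eq_same]
  · rw [Fib.single_ne h, ev_apply, Forms.single, Pi.single_eq_of_ne h]
    rfl

theorem single_of_ev {u : Forms E X} {k : ℕ} (h : ∀ e : atlas E X, ∀ z ∈ e.1.target, ∀ l ≠ k,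
    ev e z u l = 0) : u = Forms.single k (u k) := forms_ext fun e z hz => by
  rw [ev_single_same]
  refine Fib.ext fun l => ?_
  by_cases hl : l = k
  · subst hl
    rw [Fib.single_same, ev_apply]
  · rw [Fib.single_ne hl, h e z hz l hl]

theorem contDiffAt_transition [IsManifold 𝓘(ℂ, E) ∞ X] (e e' : atlas E X) {z : E}
    (hz : z ∈ (e.1.symm ≫ₕ e'.1).source) : DifferentiableAt ℝ (e'.1 ∘ e.1.symm) z :=
  (((contDiffOn_transition e e').contDiffAt
          ((e.1.symm ≫ₕ e'.1).open_source.mem_nhds hz)).restrict_scalars ℝ).differentiableAt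
      (by simp)

theorem ev_transition (e e' : atlas E X) {z : E} (hz : z ∈ (e.1.symm ≫ₕ e'.1).source)
    (u : Forms E X) (k : ℕ) : ev e z u k =
      altPullback k (fderiv ℝ (e'.1 ∘ e.1.symm) z) (ev e' (e'.1 (e.1.symm z)) u k) :=
  (u k).2.2.2 e e' z hz

theorem alternatize_sum {ι : Type*} (s : Finset ι) {k : ℕ} (F : ι → E →L[ℝ] Alt E k) :
    ContinuousAlternatingMap.alternatizeUncurryFin (∑ i ∈ s, F i) =
      ∑ i ∈ s, ContinuousAlternatingMap.alternatizeUncurryFin (F i) :=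
  map_sum (ContinuousAlternatingMap.alternatizeUncurryFinCLM ℝ E ℂ) F s

variable [FiniteDimensional ℂ E] [IsManifold 𝓘(ℂ, E) ∞ X]

theorem ev_extD {e : atlas E X} {z : E} (hz : z ∈ e.1.target) {μ : Type*} [Fintype μ]
    (f : Module.Basis μ ℝ E) (u : Forms E X) :
    ev e z (extD u) =
      ∑ m, fibExt (dualCovector f m) (fibDeriv (fun z => ev e z u) z (f m)) := Fib.ext fun k => by
  rw [Fib.sum_apply]
  match k with
  | 0 =>
    simp only [fibExt_zero, Finset.sum_const_zero]
    rfl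
  | k + 1 =>
    simp only [fibExt_succ, fibDeriv_apply]
    change e.1.target.indicator (extDeriv ((u k).1 e)) z = _
    rw [Set.indicator_of_mem hz]
    change ContinuousAlternatingMap.alternatizeUncurryFin (fderiv ℝ ((u k).1 e) z) = _
    have h : fderiv ℝ ((u k).1 e) z =
        ∑ m, (dualCovector f m).smulRight (fderiv ℝ ((u k).1 e) z (f m)) := by
      ext1 v
      conv_lhs => rw [← f.sum_repr v, map_sum]
      rw [_root_.sum_apply]
      refine Finset.sum_congr rfl fun m _ => ?_
      rw [map_smul, ContinuousLinearMap.smulRight_apply, dualCovector_apply]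
      ext w
      simp
    rw [h, alternatize_sum]
    rfl

theorem ev_bidegree (e : atlas E X) (z : E) (p q : ℕ) (u : Forms E X) :
    ev e z (bidegree E X p q u) = fibBidegree E p q (ev e z u) := rfl

theorem fibDeriv_fibBidegree {U : E → Fib E} {z : E} (hU : FibDiffAt U z) (p q : ℕ) (w : E) :
    fibDeriv (fun z => fibBidegree E p q (U z)) z w = fibBidegree E p q (fibDeriv U z w) :=
  Fib.ext fun k => alt_linear_fderiv (altBidegree p q k) (hU k) w

theorem holPart_map {M N : Type*} [AddCommGroup M] [Module ℂ M] [AddCommGroup N] [Module ℂ N]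
    (T : M →ₗ[ℂ] N) (F : E → M) (v : E) : holPart (fun w => T (F w)) v = T (holPart F v) := by
  simp [holPart]

theorem antiPart_map {M N : Type*} [AddCommGroup M] [Module ℂ M] [AddCommGroup N] [Module ℂ N]
    (T : M →ₗ[ℂ] N) (F : E → M) (v : E) : antiPart (fun w => T (F w)) v = T (antiPart F v) := by
  simp [antiPart]

variable {ι : Type*} [Fintype ι] [DecidableEq ι] (b : Module.Basis ι ℂ E)

/-- The holomorphic and antiholomorphic parts of the derivative in a frame. -/
def frameDeriv (U : E → Fib E) (z : E) : ι ⊕ ι → Fib E :=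
  Sum.elim (fun a => holPart (fibDeriv U z) (b a)) fun a => antiPart (fibDeriv U z) (b a)

theorem frameDeriv_fibBidegree {U : E → Fib E} {z : E} (hU : FibDiffAt U z) (p q : ℕ)
    (s : ι ⊕ ι) : frameDeriv b (fun z => fibBidegree E p q (U z)) z s =
      fibBidegree E p q (frameDeriv b U z s) := by
  have h : fibDeriv (fun z => fibBidegree E p q (U z)) z =
      fun w => fibBidegree E p q (fibDeriv U z w) :=
    funext fun w => fibDeriv_fibBidegree hU p q w
  cases s with
  | inl a => simp only [frameDeriv, Sum.elim_inl, h, holPart_map]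
  | inr a => simp only [frameDeriv, Sum.elim_inr, h, antiPart_map]

theorem ev_extD_frame {e : atlas E X} {z : E} (hz : z ∈ e.1.target) (u : Forms E X) :
    ev e z (extD u) = ∑ s, creation b s (frameDeriv b (fun z => ev e z u) z s) := by
  rw [ev_extD hz (realFrame b), sum_realFrame_covector b, Fintype.sum_sum_type]
  rfl

/-- The type projections have constant coefficients in a chart, so they commute with the derivatives
and act only on the exterior multiplications in d; `hc` says which of these survive. -/
theorem ev_component {e : atlas E X} {z : E} (hz : z ∈ e.1.target) (u : Forms E X) (r t : ℕ)
    (c : ι ⊕ ι → ℂ) (hc : ∀ s, ∑ p ∈ Finset.range (Module.finrank ℂ E + 1),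
      ∑ q ∈ Finset.range (Module.finrank ℂ E + 1),
        fibBidegree E (p + r) (q + t) * creation b s * fibBidegree E p q = c s • creation b s) :
    ev e z ((∑ p ∈ Finset.range (Module.finrank ℂ E + 1),
      ∑ q ∈ Finset.range (Module.finrank ℂ E + 1),
        bidegree E X (p + r) (q + t) * extD * bidegree E X p q : Module.End ℂ (Forms E X)) u) =
      ∑ s, c s • creation b s (frameDeriv b (fun z => ev e z u) z s) := by
  have h1 : ∀ p q, ev e z ((bidegree E X (p + r) (q + t) * extD * bidegree E X p q :
      Module.End ℂ (Forms E X)) u) =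
      ∑ s, (fibBidegree E (p + r) (q + t) * creation b s * fibBidegree E p q)
        (frameDeriv b (fun z => ev e z u) z s) := by
    intro p q
    rw [Module.End.mul_apply, Module.End.mul_apply, ev_bidegree, ev_extD_frame b hz, map_sum]
    refine Finset.sum_congr rfl fun s _ => ?_
    simp only [ev_bidegree]
    rw [frameDeriv_fibBidegree b (fibDiffAt_ev hz u)]
    rfl
  simp only [LinearMap.sum_apply, map_sum, h1]
  calc _ = ∑ s, (∑ p ∈ Finset.range (Module.finrank ℂ E + 1),
      ∑ q ∈ Finset.range (Module.finrank ℂ E + 1),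
        fibBidegree E (p + r) (q + t) * creation b s * fibBidegree E p q)
          (frameDeriv b (fun z => ev e z u) z s) := by
        simp only [LinearMap.sum_apply]
        rw [Finset.sum_comm, Finset.sum_congr rfl fun q _ => Finset.sum_comm, Finset.sum_comm]
        exact Finset.sum_congr rfl fun s _ => Finset.sum_comm
    _ = _ := Finset.sum_congr rfl fun s _ => by rw [hc, LinearMap.smul_apply]

theorem ev_del {e : atlas E X} {z : E} (hz : z ∈ e.1.target) (u : Forms E X) :
    ev e z (del E X u) =
      ∑ a, creation b (Sum.inl a) (holPart (fibDeriv (fun z => ev e z u) z) (b a)) := by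
  refine (ev_component b hz u 1 0 _ fun s => sum_bidegree_creation_left b s).trans ?_
  rw [Fintype.sum_sum_type]
  simp [frameDeriv]

theorem ev_delbar {e : atlas E X} {z : E} (hz : z ∈ e.1.target) (u : Forms E X) :
    ev e z (delbar E X u) =
      ∑ a, creation b (Sum.inr a) (antiPart (fibDeriv (fun z => ev e z u) z) (b a)) := by
  refine (ev_component b hz u 0 1 _ fun s => sum_bidegree_creation_right b s).trans ?_
  rw [Fintype.sum_sum_type]
  simp [frameDeriv]

theorem ev_wedge_single (e : atlas E X) (z : E) {m : ℕ} (γ : DiffForm E X m) (u : Forms E X) :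
    ev e z (wedge (Forms.single m γ) u) = fibWedge m (γ.1 e z) (ev e z u) := Fib.ext fun k => by
  have h1 : ev e z (wedge (Forms.single m γ) u) k =
      ∑ p ∈ (Finset.HasAntidiagonal.antidiagonal k).attach,
        altWedge (Finset.HasAntidiagonal.mem_antidiagonal.1 p.2)
          (ev e z (Forms.single m γ) p.1.1) (ev e z u p.1.2) := by
    change (((∑ p ∈ (Finset.HasAntidiagonal.antidiagonal k).attach,
      wedgeForm (Finset.HasAntidiagonal.mem_antidiagonal.1 p.2) (Forms.single m γ p.1.1) (u p.1.2) :
        DiffForm E X k)) : atlas E X → E → Alt E k) e z = _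
    rw [AddSubmonoidClass.coe_finsetSum, Finset.sum_apply, Finset.sum_apply]
    rfl
  rw [h1, ev_single_same]
  by_cases hm : m ≤ k
  · obtain ⟨j, hj⟩ := Nat.exists_eq_add_of_le hm
    rw [fibWedge_of_add hj.symm]
    rw [Finset.sum_eq_single ⟨(m, j), Finset.HasAntidiagonal.mem_antidiagonal.2 hj.symm⟩]
    · rw [Fib.single_same]
    · intro p _ hp
      have : p.1.1 ≠ m := by
        intro h2
        have h3 := Finset.HasAntidiagonal.mem_antidiagonal.1 p.2
        refine hp (Subtype.ext (Prod.ext h2 ?_))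
        change p.1.2 = j
        omega
      rw [Fib.single_ne this, map_zero, LinearMap.zero_apply]
    · intro h
      exact absurd (Finset.mem_attach _ _) h
  · rw [fibWedge_of_lt (by omega)]
    refine Finset.sum_eq_zero fun p _ => ?_
    have h3 := Finset.HasAntidiagonal.mem_antidiagonal.1 p.2
    rw [Fib.single_ne (by omega), map_zero, LinearMap.zero_apply]

theorem ev_mulFn (e : atlas E X) (z : E) (f : C^∞⟮𝓘(ℝ, E), X; 𝓘(ℝ, ℝ), ℝ⟯) (u : Forms E X) :
    ev e z (mulFn f u) = (f (e.1.symm z) : ℂ) • ev e z u := Fib.ext fun k => by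
  ext v
  change f (e.1.symm z) • ev e z u k v = (f (e.1.symm z) : ℂ) * ev e z u k v
  simp

theorem wedge_add (α β : Forms E X) : wedge (α + β) = wedge α + wedge β := by
  refine LinearMap.ext fun u => funext fun k => ?_
  refine Eq.trans ?_ (Finset.sum_add_distrib (M := DiffForm E X k))
  refine Finset.sum_congr (s₁ := (Finset.HasAntidiagonal.antidiagonal k).attach) rfl fun p _ => ?_
  exact LinearMap.map_add₂ (wedgeForm _) (α p.1.1) (β p.1.1) (u p.1.2)

theorem wedge_smul (c : ℂ) (α : Forms E X) : wedge (c • α) = c • wedge α := by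
  refine LinearMap.ext fun u => funext fun k => ?_
  refine Eq.trans ?_ (Finset.smul_sum (N := DiffForm E X k) (r := c)).symm
  refine Finset.sum_congr (s₁ := (Finset.HasAntidiagonal.antidiagonal k).attach) rfl fun p _ => ?_
  exact LinearMap.map_smul₂ (wedgeForm _) c (α p.1.1) (u p.1.2)

/-- Forms of all degrees are the objects here, so it has to be recorded that ∂̄ raises the degree by
exactly one. It gives ∂̄ω and ∂̄η as forms of a single degree. -/
theorem delbar_single {k : ℕ} (γ : DiffForm E X k) : delbar E X (Forms.single k γ) =
    Forms.single (k + 1) (delbar E X (Forms.single k γ) (k + 1)) := by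
  refine single_of_ev fun e z hz l hl => ?_
  rw [ev_delbar (Module.finBasis ℂ E) hz, Fib.sum_apply]
  refine Finset.sum_eq_zero fun a _ => ?_
  rw [creation_eq]
  cases l with
  | zero => rfl
  | succ l =>
    have h : ∀ w, fibDeriv (fun z => ev e z (Forms.single k γ)) z w l = 0 := by
      intro w
      rw [fibDeriv_apply]
      simp only [ev_single_same, Fib.single_ne (show l ≠ k by omega)]
      simp
    rw [fibExt_succ]
    simp only [antiPart, Fib.smul_apply, Fib.add_apply, h, alt_smul_zero, add_zero, map_zero]

end Eval

/-! ### Complex conjugation of forms and operators. -/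

section Conj
variable {E X : Type*} [NormedAddCommGroup E] [NormedSpace ℂ E] [FiniteDimensional ℂ E]

variable (E) in
/-- Complex conjugation of forms of all degrees. -/
def fibConj : Fib E →ₛₗ[starRingEnd ℂ] Fib E where
  toFun u := fun k => altConj k (u k)
  map_add' u v := Fib.ext fun k => (altConj k).map_add (u k) (v k)
  map_smul' c u := Fib.ext fun k => (altConj k).map_smulₛₗ c (u k)

theorem fibConj_apply (u : Fib E) (k : ℕ) : fibConj E u k = altConj k (u k) := rfl

theorem altConj_apply {k : ℕ} (α : Alt E k) (v : Fin k → E) :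
    altConj k α v = starRingEnd ℂ (α v) := rfl

theorem fibConj_fibConj (u : Fib E) : fibConj E (fibConj E u) = u := Fib.ext fun k => by
  ext v
  simp [fibConj_apply, altConj_apply]

/-- The conjugate of a covector. -/
def covConj (θ : E →L[ℝ] ℂ) : E →L[ℝ] ℂ := (Complex.conjCLE : ℂ →L[ℝ] ℂ).comp θ

theorem fibConj_fibExt (θ : E →L[ℝ] ℂ) (u : Fib E) :
    fibConj E (fibExt θ u) = fibExt (covConj θ) (fibConj E u) := Fib.ext fun k => by
  cases k with
  | zero => rw [fibConj_apply, fibExt_zero, fibExt_zero, map_zero]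
  | succ k =>
    rw [fibConj_apply, fibExt_succ, fibExt_succ, fibConj_apply]
    ext v
    rw [altConj_apply, altExt_apply, altExt_apply, map_sum]
    refine Finset.sum_congr rfl fun i _ => ?_
    rw [altConj_apply, map_mul, map_mul]
    congr 1
    simp

theorem covConj_dzBar {ι : Type*} [Fintype ι] [DecidableEq ι] (b : Module.Basis ι ℂ E) (a : ι) :
    covConj (dzBar b a) = dz b a := by
  ext v
  simp [covConj, dzBar]

theorem fibConj_creation {ι : Type*} [Fintype ι] [DecidableEq ι] (b : Module.Basis ι ℂ E)
    (s : ι ⊕ ι) (u : Fib E) :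
    fibConj E (creation b s u) = creation b s.swap (fibConj E u) := by
  rw [creation_eq, creation_eq, fibConj_fibExt]
  cases s with
  | inl a => rfl
  | inr a => exact congrArg (fun θ => fibExt θ (fibConj E u)) (covConj_dzBar b a)

theorem alt_conj_fderiv {k : ℕ} {U : E → Alt E k} {z : E} (hU : DifferentiableAt ℝ U z) (w : E) :
    fderiv ℝ (fun z => altConj k (U z)) z w = altConj k (fderiv ℝ U z w) := by
  let T : Alt E k →ₗ[ℝ] Alt E k :=
    { toFun := altConj k
      map_add' := (altConj k).map_add
      map_smul' := fun c α => by ext v; simp [altConj_apply] }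
  have := fderiv_comp (𝕜 := ℝ) z (LinearMap.toContinuousLinearMap T).differentiableAt hU
  rw [ContinuousLinearMap.fderiv] at this
  exact DFunLike.congr_fun this w

theorem fibDeriv_fibConj {U : E → Fib E} {z : E} (hU : FibDiffAt U z) (w : E) :
    fibDeriv (fun z => fibConj E (U z)) z w = fibConj E (fibDeriv U z w) :=
  Fib.ext fun k => alt_conj_fderiv (hU k) w

theorem fibConj_antiPart (F : E → Fib E) (v : E) :
    fibConj E (antiPart F v) = holPart (fun w => fibConj E (F w)) v := by
  simp only [antiPart, holPart, map_smulₛₗ, map_add]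
  simp [sub_eq_add_neg, map_ofNat]

variable [TopologicalSpace X] [ChartedSpace E X] [IsManifold 𝓘(ℂ, E) ∞ X]

theorem ev_conj (e : atlas E X) (z : E) (u : Forms E X) :
    ev e z (conjForm E X u) = fibConj E (ev e z u) := rfl

theorem conjForm_conjForm (u : Forms E X) : conjForm E X (conjForm E X u) = u :=
  forms_ext fun e z _ => by rw [ev_conj, ev_conj, fibConj_fibConj]

/-- Conjugation exchanges dz with dz̄ and the antilinear with the complex linear part of a
derivative. -/
theorem conjForm_delbar (u : Forms E X) :
    conjForm E X (delbar E X u) = del E X (conjForm E X u) := forms_ext fun e z hz => by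
  rw [ev_conj, ev_delbar (Module.finBasis ℂ E) hz, ev_del (Module.finBasis ℂ E) hz, map_sum]
  refine Finset.sum_congr rfl fun a _ => ?_
  rw [fibConj_creation, fibConj_antiPart]
  simp only [ev_conj]
  congr 1
  exact congrArg (fun F => holPart F _)
    (funext fun w => (fibDeriv_fibConj (fibDiffAt_ev hz u) w).symm)

theorem conjOp_apply (A : Module.End ℂ (Forms E X)) (u : Forms E X) :
    conjOp A u = conjForm E X (A (conjForm E X u)) := rfl

theorem conjOp_mul (A B : Module.End ℂ (Forms E X)) : conjOp (A * B) = conjOp A * conjOp B :=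
  LinearMap.ext fun u => by
    simp only [conjOp_apply, Module.End.mul_apply, conjForm_conjForm]

theorem conjOp_add (A B : Module.End ℂ (Forms E X)) : conjOp (A + B) = conjOp A + conjOp B :=
  LinearMap.ext fun u => by
    simp only [conjOp_apply, LinearMap.add_apply, map_add]

theorem conjOp_smul (c : ℂ) (A : Module.End ℂ (Forms E X)) :
    conjOp (c • A) = starRingEnd ℂ c • conjOp A :=
  LinearMap.ext fun u => by
    simp only [conjOp_apply, LinearMap.smul_apply, LinearMap.map_smulₛₗ]

theorem conjOp_sub (A B : Module.End ℂ (Forms E X)) : conjOp (A - B) = conjOp A - conjOp B :=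
  LinearMap.ext fun u => by
    simp only [conjOp_apply, LinearMap.sub_apply, map_sub]

theorem conjOp_conjOp (A : Module.End ℂ (Forms E X)) : conjOp (conjOp A) = A :=
  LinearMap.ext fun u => by
    simp only [conjOp_apply, conjForm_conjForm]

theorem conjOp_delbar : conjOp (delbar E X) = del E X := LinearMap.ext fun u => by
  rw [conjOp_apply, conjForm_delbar, conjForm_conjForm]

theorem conjOp_mulFn (f : C^∞⟮𝓘(ℝ, E), X; 𝓘(ℝ, ℝ), ℝ⟯) : conjOp (mulFn f : Module.End ℂ (Forms E X)) = mulFn f :=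
  end_ext fun e z hz u => by
    rw [conjOp_apply, ev_conj, ev_mulFn, ev_mulFn, ev_conj, map_smulₛₗ, fibConj_fibConj]
    simp

theorem altConj_altWedge {a b k : ℕ} (h : a + b = k) (α : Alt E a) (β : Alt E b) :
    altConj k (altWedge h α β) = altWedge h (altConj a α) (altConj b β) := by
  ext v
  rw [altConj_apply, altWedge_apply, altWedge_apply, map_sum]
  refine Finset.sum_congr rfl fun σ _ => ?_
  induction σ using Quotient.inductionOn' with
  | h σ => simp only [wedgeSummand_mk, altConj_apply, zsmul_eq_mul, map_mul, map_intCast]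

theorem conjOp_wedge (α : Forms E X) : conjOp (wedge α) = wedge (conjForm E X α) := by
  refine LinearMap.ext fun u => funext fun k => ?_
  refine (map_sum (mapFibre (altConj k) (fun r => Complex.conj_ofReal r) (fun _ _ => rfl)) _ _).trans
    (Finset.sum_congr rfl fun p _ => ?_)
  refine Subtype.ext (funext fun e => funext fun z => ?_)
  change altConj k (altWedge _ (ev e z α p.1.1) (ev e z (conjForm E X u) p.1.2)) =
    altWedge _ (ev e z (conjForm E X α) p.1.1) (ev e z u p.1.2)
  rw [altConj_altWedge]
  congr 1
  rw [← fibConj_apply, ← ev_conj, conjForm_conjForm]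

theorem conjForm_fnForm (f : C^∞⟮𝓘(ℝ, E), X; 𝓘(ℝ, ℝ), ℝ⟯) :
    conjForm E X (fnForm f) = fnForm f := forms_ext fun e z hz => by
  rw [ev_conj]
  refine Fib.ext fun k => ?_
  rw [fibConj_apply, fnForm, ev_single_same]
  cases k with
  | zero =>
    rw [Fib.single_same]
    ext v
    rw [altConj_apply]
    dsimp only
    rw [Set.indicator_of_mem hz]
    exact Complex.conj_ofReal _
  | succ k => rw [Fib.single_ne (by omega), map_zero]

end Conj

/-! ### Pull-back on forms of all degrees. -/

section Pullback
variable {E : Type*} [NormedAddCommGroup E] [NormedSpace ℂ E]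

/-- Pull-back of forms of all degrees along a real linear map. -/
def fibPullback (A : E →L[ℝ] E) : Module.End ℂ (Fib E) := fibDiag fun k => altPullback k A

theorem fibPullback_apply (A : E →L[ℝ] E) (u : Fib E) (k : ℕ) :
    fibPullback A u k = altPullback k A (u k) := rfl

theorem fibPullback_fibWedge (A : E →L[ℝ] E) {m : ℕ} (γ : Alt E m) (u : Fib E) :
    fibPullback A (fibWedge m γ u) = fibWedge m (altPullback m A γ) (fibPullback A u) :=
  Fib.ext fun k => by
    rw [fibPullback_apply]
    by_cases hm : m ≤ k
    · obtain ⟨j, hj⟩ := Nat.exists_eq_add_of_le hm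
      rw [fibWedge_of_add hj.symm, fibWedge_of_add hj.symm, altPullback_wedge]
      rfl
    · rw [fibWedge_of_lt (by omega), fibWedge_of_lt (by omega), map_zero]

end Pullback

/-! ### Behaviour of metric, inner product and density under coordinate changes. -/

section Transition
variable {E X : Type*} [NormedAddCommGroup E] [NormedSpace ℂ E] [FiniteDimensional ℂ E]
  [TopologicalSpace X] [ChartedSpace E X] [IsManifold 𝓘(ℂ, E) ∞ X] (g : HermitianMetric E X)
  {e e' : atlas E X} {z : E} (hz : z ∈ (e.1.symm ≫ₕ e'.1).source)
include hz

theorem mem_target_of_transition : z ∈ e.1.target := by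
  rw [OpenPartialHomeomorph.trans_source] at hz
  simpa using hz.1

theorem mem_target_of_transition' : e'.1 (e.1.symm z) ∈ e'.1.target := by
  rw [OpenPartialHomeomorph.trans_source] at hz
  exact e'.1.map_source hz.2

theorem transition_I_smul (v : E) : fderiv ℝ (e'.1 ∘ e.1.symm) z (Complex.I • v) =
    Complex.I • fderiv ℝ (e'.1 ∘ e.1.symm) z v := by
  rw [fderiv_transition e e' hz]
  exact map_smul (fderiv ℂ (e'.1 ∘ e.1.symm) z) _ _

theorem metric_transition (v w : E) : g.metric e z v w =
    g.metric e' (e'.1 (e.1.symm z)) (fderiv ℝ (e'.1 ∘ e.1.symm) z v)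
      (fderiv ℝ (e'.1 ∘ e.1.symm) z w) := by
  change (g.form.1 e z ![v, Complex.I • w]).re = (g.form.1 e' _ ![_, Complex.I • _]).re
  rw [g.form.2.2.2 e e' z hz, ← transition_I_smul hz]
  change (g.form.1 e' _ fun i => _).re = _
  congr 2
  funext i
  fin_cases i <;> rfl

/-- The derivative of a coordinate change, as a linear equivalence. -/
theorem exists_transition_equiv : ∃ A : E ≃ₗ[ℝ] E, ∀ v, A v = fderiv ℝ (e'.1 ∘ e.1.symm) z v := by
  let A₀ : E →ₗ[ℝ] E := (fderiv ℝ (e'.1 ∘ e.1.symm) z : E →ₗ[ℝ] E)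
  let F : E → E := e.1 ∘ e'.1.symm
  have hz' : e'.1 (e.1.symm z) ∈ (e'.1.symm ≫ₕ e.1).source := by
    rw [OpenPartialHomeomorph.trans_source] at hz ⊢
    refine ⟨by simpa using e'.1.map_source hz.2, ?_⟩
    rw [Set.mem_preimage, e'.1.left_inv hz.2]
    exact e.1.map_target (by simpa using hz.1)
  have h1 := (contDiffAt_transition e e' hz).hasFDerivAt
  have h2 := (contDiffAt_transition e' e hz').hasFDerivAt
  have h3 := h2.comp z h1
  have h4 : ((e.1 ∘ e'.1.symm) ∘ (e'.1 ∘ e.1.symm)) =ᶠ[nhds z] id := by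
    refine Filter.eventually_of_mem ((e.1.symm ≫ₕ e'.1).open_source.mem_nhds hz) fun w hw => ?_
    rw [OpenPartialHomeomorph.trans_source] at hw
    simp only [Function.comp_apply, id_eq]
    rw [e'.1.left_inv hw.2, e.1.right_inv (by simpa using hw.1)]
  have h5 := (h3.congr_of_eventuallyEq h4.symm).unique (hasFDerivAt_id z)
  have hinj : Function.Injective A₀ := by
    refine Function.LeftInverse.injective
      (g := fun v => fderiv ℝ (e.1 ∘ e'.1.symm) (e'.1 (e.1.symm z)) v) fun v => ?_
    exact DFunLike.congr_fun h5 v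
  exact ⟨LinearEquiv.ofInjectiveEndo A₀ hinj, fun v => rfl⟩

/-- The derivative of the coordinate change is an isometry for the metrics in the two charts. It
carries an orthonormal frame to an orthonormal frame, and in such frames the two sides are the same
sum. -/
theorem altInner_transition (k : ℕ) (α β : Alt E k) :
    altInner g e z k (altPullback k (fderiv ℝ (e'.1 ∘ e.1.symm) z) α)
      (altPullback k (fderiv ℝ (e'.1 ∘ e.1.symm) z) β) =
    altInner g e' (e'.1 (e.1.symm z)) k α β := by
  obtain ⟨A, hA⟩ := exists_transition_equiv hz
  obtain ⟨b, hb⟩ := g.exists_unitary_frame e z (mem_target_of_transition hz)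
  have hf : g.IsOrthonormal e' (e'.1 (e.1.symm z)) ((realFrame b).map A) := fun i j => by
    rw [Module.Basis.map_apply, Module.Basis.map_apply, hA, hA, ← metric_transition g hz]
    exact hb i j
  rw [altInner_eq hb, altInner_eq hf, orthoInner, orthoInner, matInner_apply, matInner_apply]
  simp only [Module.Basis.map_apply, hA]
  rfl

theorem fibInner_transition (u v : Fib E) :
    fibInner g e z (fibPullback (fderiv ℝ (e'.1 ∘ e.1.symm) z) u)
      (fibPullback (fderiv ℝ (e'.1 ∘ e.1.symm) z) v) =
    fibInner g e' (e'.1 (e.1.symm z)) u v := by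
  rw [fibInner_apply, fibInner_apply]
  exact Finset.sum_congr rfl fun k _ => altInner_transition g hz k (u k) (v k)

theorem ev_transition_fib (u : Forms E X) : ev e z u =
    fibPullback (fderiv ℝ (e'.1 ∘ e.1.symm) z) (ev e' (e'.1 (e.1.symm z)) u) :=
  Fib.ext fun k => ev_transition e e' hz u k

theorem fibInner_ev_transition (u v : Forms E X) :
    fibInner g e z (ev e z u) (ev e z v) =
      fibInner g e' (e'.1 (e.1.symm z)) (ev e' (e'.1 (e.1.symm z)) u)
        (ev e' (e'.1 (e.1.symm z)) v) := by
  rw [ev_transition_fib hz, ev_transition_fib hz, fibInner_transition g hz]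

/-- The Gram matrix changes to MᵀGM. The factor |det M| is the Jacobian of the change of variables,
so the chart volumes agree on overlaps. -/
theorem sqrt_det_gram_transition :
    Real.sqrt (gram g e z).det = |(fderiv ℝ (e'.1 ∘ e.1.symm) z).det| *
      Real.sqrt (gram g e' (e'.1 (e.1.symm z))).det := by
  let b := Module.finBasis ℝ E
  let M := LinearMap.toMatrix b b (fderiv ℝ (e'.1 ∘ e.1.symm) z : E →ₗ[ℝ] E)
  have h1 : gram g e z = M.transpose * gram g e' (e'.1 (e.1.symm z)) * M := by
    ext i j
    change g.metric e z (b i) (b j) = _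
    have h : ∀ i, fderiv ℝ (e'.1 ∘ e.1.symm) z (b i) = ∑ l, M l i • b l := fun i => by
      conv_lhs => rw [← b.sum_repr (fderiv ℝ (e'.1 ∘ e.1.symm) z (b i))]
      refine Finset.sum_congr rfl fun l _ => ?_
      exact congrArg (· • b l) (LinearMap.toMatrix_apply b b _ l i).symm
    rw [metric_transition g hz, h, h, HermitianMetric.metric_sum_sum, Finset.sum_comm]
    simp only [Matrix.mul_apply, Matrix.transpose_apply, Finset.sum_mul]
    refine Finset.sum_congr rfl fun l _ => Finset.sum_congr rfl fun l' _ => ?_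
    change _ = M l' i * g.metric e' _ (b l') (b l) * M l j
    ring
  have h2 : (fderiv ℝ (e'.1 ∘ e.1.symm) z).det = M.det := (LinearMap.det_toMatrix b _).symm
  rw [h1, Matrix.det_mul, Matrix.det_mul, Matrix.det_transpose, h2, mul_right_comm,
    ← pow_two, Real.sqrt_mul (sq_nonneg _), Real.sqrt_sq_eq_abs]

end Transition

/-! ### Pointwise adjoints of exterior multiplication by smooth forms. -/

section Adjoint
variable {E X : Type*} [NormedAddCommGroup E] [NormedSpace ℂ E] [FiniteDimensional ℂ E]
  [TopologicalSpace X] [ChartedSpace E X] (g : HermitianMetric E X)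

instance (k : ℕ) : FiniteDimensional ℂ (Alt E k) :=
  Module.Finite.of_restrictScalars_finite ℝ ℂ (Alt E k)

/-- A family of forms is smooth if its inner products with constant forms are. -/
theorem contDiffOn_of_altInner (e : atlas E X) {k : ℕ} {β : E → Alt E k}
    (h : ∀ α : Alt E k, ContDiffOn ℝ ∞ (fun z => altInner g e z k α (β z)) e.1.target) :
    ContDiffOn ℝ ∞ β e.1.target := by
  let B := Module.finBasis ℂ (Alt E k)
  let G : E → Matrix _ _ ℂ := fun z => Matrix.of fun i j => altInner g e z k (B i) (B j)
  let M : E → Alt E k →ₗ[ℂ] Alt E k →ₛₗ[starRingEnd ℂ] ℂ := fun z =>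
    matInner (Module.finBasis ℝ E) (gramOf g e z (Module.finBasis ℝ E))⁻¹ k
  have hM : ∀ z ∈ e.1.target, ∀ α β, altInner g e z k α β = M z α β := fun z hz α β =>
    altInner_eq_matInner g e z hz _ k α β
  have hsum : ∀ z ∈ e.1.target, ∀ (α : Alt E k) (c : Fin (Module.finrank ℂ (Alt E k)) → ℂ),
      altInner g e z k α (∑ j, c j • B j) =
        ∑ j, starRingEnd ℂ (c j) * altInner g e z k α (B j) := by
    intro z hz α c
    rw [hM z hz, map_sum]
    exact Finset.sum_congr rfl fun j _ => by
      rw [LinearMap.map_smulₛₗ, hM z hz, smul_eq_mul]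
  -- A kernel vector of the Gram matrix of the fibre would give a form y with ⟨y, y⟩ = 0. The
  -- coefficients are conjugated because the inner product is antilinear in its second slot.
  have hdet : ∀ z ∈ e.1.target, (G z).det ≠ 0 := by
    intro z hz h0
    obtain ⟨x, hx, hGx⟩ := Matrix.exists_mulVec_eq_zero_iff.2 h0
    have h1 : ∀ i, altInner g e z k (B i) (∑ j, starRingEnd ℂ (x j) • B j) = 0 := by
      intro i
      rw [hsum z hz]
      have := congrFun hGx i
      simp only [Matrix.mulVec, dotProduct, G, Matrix.of_apply, Pi.zero_apply] at this
      rw [← this]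
      exact Finset.sum_congr rfl fun j _ => by rw [Complex.conj_conj, mul_comm]
    set y := ∑ j, starRingEnd ℂ (x j) • B j with hy
    have h2 : altInner g e z k y y = 0 := by
      have h4 : M z y = ∑ j, starRingEnd ℂ (x j) • M z (B j) := by
        rw [hy, map_sum]
        exact Finset.sum_congr rfl fun j _ => map_smul _ _ _
      rw [hM z hz, h4, LinearMap.sum_apply]
      refine Finset.sum_eq_zero fun j _ => ?_
      rw [LinearMap.smul_apply, ← hM z hz, h1, smul_zero]
    have h3 : y = 0 := eq_zero_of_altInner_self hz (by rw [h2, Complex.zero_re])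
    refine hx (funext fun j => ?_)
    have := Fintype.linearIndependent_iff.1 B.linearIndependent _ (hy.symm.trans h3) j
    simpa using this
  have hG : ∀ i j, ContDiffOn ℝ ∞ (fun z => G z i j) e.1.target := fun i j =>
    contDiffOn_altInner g e subset_rfl contDiffOn_const contDiffOn_const
  have hinv := contDiffOn_matrix_inv hG hdet
  -- The coordinates of β solve a linear system whose matrix is the Gram matrix and whose right hand
  -- side is smooth by assumption; so they are smooth as well.
  have hβ : ∀ z ∈ e.1.target, β z = ∑ i, starRingEnd ℂ
      (∑ j, (G z)⁻¹ i j * altInner g e z k (B j) (β z)) • B i := by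
    intro z hz
    have h1 : (fun j => altInner g e z k (B j) (β z)) =
        (G z).mulVec fun j => starRingEnd ℂ (B.repr (β z) j) := by
      funext i
      conv_lhs => rw [← B.sum_repr (β z), hsum z hz]
      exact Finset.sum_congr rfl fun j _ => mul_comm _ _
    have h2 : ∀ i, ∑ j, (G z)⁻¹ i j * altInner g e z k (B j) (β z) =
        starRingEnd ℂ (B.repr (β z) i) := by
      intro i
      have h3 : ((G z)⁻¹.mulVec fun j => altInner g e z k (B j) (β z)) =
          fun j => starRingEnd ℂ (B.repr (β z) j) := by
        rw [h1, Matrix.mulVec_mulVec, Matrix.nonsing_inv_mul _ (hdet z hz).isUnit,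
          Matrix.one_mulVec]
      exact congrFun h3 i
    conv_lhs => rw [← B.sum_repr (β z)]
    exact Finset.sum_congr rfl fun i _ => by rw [h2, Complex.conj_conj]
  refine ContDiffOn.congr ?_ hβ
  refine ContDiffOn.sum fun i _ => ?_
  refine ContDiffOn.fun_smul (𝕜' := ℂ) ?_ contDiffOn_const
  exact Complex.conjCLE.contDiff.comp_contDiffOn
    (ContDiffOn.sum fun j _ => (hinv i j).mul (h (B j)))

variable {g}

/-- Exterior multiplication by a form has an adjoint on the fibres. -/
theorem exists_fibWedge_adjoint {e : atlas E X} {z : E} (hz : z ∈ e.1.target) (m : ℕ) (γ : Alt E m) :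
    ∃ T : Module.End ℂ (Fib E), ∀ u v,
      fibInner g e z (fibWedge m γ u) v = fibInner g e z u (T v) := by
  obtain ⟨b, hb⟩ := g.exists_unitary_frame e z hz
  induction m with
  | zero =>
    refine ⟨starRingEnd ℂ (γ ![]) • 1, fun u v => ?_⟩
    rw [fibWedge_zero, LinearMap.smul_apply, LinearMap.smul_apply, map_smul, LinearMap.smul_apply,
      LinearMap.map_smulₛₗ, Complex.conj_conj]
    rfl
  | succ m ih =>
    choose T hT using ih
    refine ⟨((m + 1 : ℕ) : ℂ)⁻¹ • ∑ i, T (altInt (realFrame b i) m γ) * fibInt (realFrame b i),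
      fun u v => ?_⟩
    -- Euler's formula writes γ through covectors and contracted forms of lower degree. The adjoint
    -- of a covector is a contraction, and the lower degree is covered by induction.
    have h1 : γ = ((m + 1 : ℕ) : ℂ)⁻¹ • ∑ i, altExt (dualCovector (realFrame b) i) m
        (altInt (realFrame b i) m γ) := by
      rw [sum_altExt_dual, smul_smul, inv_mul_cancel₀ (by exact_mod_cast Nat.succ_ne_zero m),
        one_smul]
    conv_lhs => rw [h1, map_smul, map_sum]
    simp only [LinearMap.smul_apply, LinearMap.sum_apply, map_smul, map_sum, LinearMap.map_smulₛₗ,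
      fibWedge_altExt, Module.End.mul_apply, fibInner_fibExt hb, hT]
    simp

theorem altInner_eq_fibInner_single (e : atlas E X) (z : E) {k : ℕ}
    (hk : k ≤ 2 * Module.finrank ℂ E) (α : Alt E k) (v : Fib E) (hz : z ∈ e.1.target) :
    altInner g e z k α (v k) = fibInner g e z (Fib.single k α) v := by
  rw [fibInner_apply, Finset.sum_eq_single k, Fib.single_same]
  · intro l _ hl
    rw [Fib.single_ne hl, altInner_eq_matInner g e z hz (Module.finBasis ℝ E), map_zero,
      LinearMap.zero_apply]
  · intro h
    exact absurd (Finset.mem_range.2 (by omega)) h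

theorem contDiffOn_fibInner (e : atlas E X) {U V : E → Fib E}
    (hU : ∀ k, ContDiffOn ℝ ∞ (fun z => U z k) e.1.target)
    (hV : ∀ k, ContDiffOn ℝ ∞ (fun z => V z k) e.1.target) :
    ContDiffOn ℝ ∞ (fun z => fibInner g e z (U z) (V z)) e.1.target := by
  simp only [fibInner_apply]
  exact ContDiffOn.sum fun k _ => contDiffOn_altInner g e subset_rfl (hU k) (hV k)

theorem contDiffOn_fibWedge {m : ℕ} {s : Set E} {γ : E → Alt E m} {U : E → Fib E}
    (hγ : ContDiffOn ℝ ∞ γ s) (hU : ∀ k, ContDiffOn ℝ ∞ (fun z => U z k) s) (k : ℕ) :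
    ContDiffOn ℝ ∞ (fun z => fibWedge m (γ z) (U z) k) s := by
  by_cases hm : m ≤ k
  · obtain ⟨j, hj⟩ := Nat.exists_eq_add_of_le hm
    simp only [fibWedge_of_add hj.symm]
    exact contDiffOn_altWedge _ hγ (hU j)
  · simp only [fibWedge_of_lt (show k < m by omega)]
    exact contDiffOn_const

variable (g) [IsManifold 𝓘(ℂ, E) ∞ X]

/-- Exterior multiplication by a smooth form has a pointwise adjoint on smooth forms. -/
theorem exists_wedge_adjoint {m : ℕ} (γ : DiffForm E X m) : ∃ B : Module.End ℂ (Forms E X),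
    ∀ e : atlas E X, ∀ z ∈ e.1.target, ∀ (α : Fib E) (u : Forms E X),
      fibInner g e z (fibWedge m (γ.1 e z) α) (ev e z u) = fibInner g e z α (ev e z (B u)) := by
  classical
  choose T hT using fun (e : atlas E X) (z : E) (hz : z ∈ e.1.target) =>
    exists_fibWedge_adjoint (g := g) hz m (γ.1 e z)
  -- The pointwise adjoint is chosen on the target of each chart and set to 0 outside, as required
  -- of a family in `DiffForm`.
  let S : atlas E X → E → Module.End ℂ (Fib E) := fun e z =>
    if hz : z ∈ e.1.target then T e z hz else 0
  have hS : ∀ e : atlas E X, ∀ z ∈ e.1.target, ∀ u v,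
      fibInner g e z (fibWedge m (γ.1 e z) u) v = fibInner g e z u (S e z v) := by
    intro e z hz u v
    simp only [S, dif_pos hz]
    exact hT e z hz u v
  have hS0 : ∀ (e : atlas E X), ∀ z ∉ e.1.target, S e z = 0 := fun e z hz => dif_neg hz
  have key : ∀ (u : Forms E X) (k : ℕ), (fun e z => S e z (ev e z u) k) ∈ DiffForm E X k := by
    intro u k
    refine ⟨fun e z hz => ?_, fun e => ?_, fun e e' z hz => ?_⟩
    · change S e z (ev e z u) k = 0
      rw [hS0 e z hz]; rfl
    · by_cases hk : k ≤ 2 * Module.finrank ℂ E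
      · refine contDiffOn_of_altInner g e fun α => ?_
        have h1 : ContDiffOn ℝ ∞ (fun z => fibInner g e z
            (fibWedge m (γ.1 e z) (Fib.single k α)) (ev e z u)) e.1.target :=
          contDiffOn_fibInner e (contDiffOn_fibWedge (γ.2.2.1 e) fun l => contDiffOn_const)
            (contDiffOn_ev e u)
        refine h1.congr fun z hz => ?_
        rw [altInner_eq_fibInner_single e z hk α _ hz, hS e z hz]
      -- The inner product does not see degrees above 2n, but there every form is zero.
      · have := alt_subsingleton E (k := k) (by omega)
        exact contDiffOn_const.congr (f := fun _ => (0 : Alt E k)) fun z _ => Subsingleton.elim _ _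
    · have hz₁ := mem_target_of_transition hz
      have hz₂ := mem_target_of_transition' hz
      -- Smooth families have to transform correctly. Both sides represent the same functional,
      -- because inner product and wedge are compatible with pull-back.
      have h2 : S e z (ev e z u) = fibPullback (fderiv ℝ (e'.1 ∘ e.1.symm) z)
          (S e' (e'.1 (e.1.symm z)) (ev e' (e'.1 (e.1.symm z)) u)) := by
        refine fibInner_left_injective (g := g) hz₁ fun v => ?_
        obtain ⟨A, hA⟩ := exists_transition_equiv hz
        -- The derivative of the coordinate change is invertible, so every test form is a pull-back.
        have h3 : v = fibPullback (fderiv ℝ (e'.1 ∘ e.1.symm) z)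
            (fibPullback (LinearMap.toContinuousLinearMap (A.symm : E →ₗ[ℝ] E)) v) := by
          refine Fib.ext fun l => ?_
          ext w
          change v l w = v l fun i => A.symm (fderiv ℝ (e'.1 ∘ e.1.symm) z (w i))
          simp [← hA]
        rw [← hS e z hz₁]
        rw [h3, fibInner_transition g hz, ← hS e' _ hz₂, ← fibInner_transition g hz,
          fibPullback_fibWedge, ← γ.2.2.2 e e' z hz, ← ev_transition_fib hz]
      exact congrArg (fun w : Fib E => w k) h2
  refine ⟨{ toFun := fun u k => ⟨_, key u k⟩
            map_add' := fun u v => ?_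
            map_smul' := fun c u => ?_ }, fun e z hz α u => hS e z hz α _⟩
  · refine forms_ext fun e z _ => ?_
    change S e z (ev e z (u + v)) = S e z (ev e z u) + S e z (ev e z v)
    rw [map_add, map_add]
  · refine forms_ext fun e z _ => ?_
    change S e z (ev e z (c • u)) = c • S e z (ev e z u)
    rw [map_smul, map_smul]

end Adjoint

/-! ### The inner product as a function on the manifold. -/

section PointInner
variable {E X : Type*} [NormedAddCommGroup E] [NormedSpace ℂ E] [FiniteDimensional ℂ E]
  [TopologicalSpace X] [ChartedSpace E X] [IsManifold 𝓘(ℂ, E) ∞ X] (g : HermitianMetric E X)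

theorem mem_transition {x : X} (e e' : atlas E X) (hx : x ∈ e.1.source) (hx' : x ∈ e'.1.source) :
    e.1 x ∈ (e.1.symm ≫ₕ e'.1).source := by
  rw [OpenPartialHomeomorph.trans_source]
  refine ⟨e.1.map_source hx, ?_⟩
  rw [Set.mem_preimage, e.1.left_inv hx]
  exact hx'

/-- Invariance under coordinate changes frees the pointwise inner product from the preferred chart
at x, which varies with x without any continuity. Continuity and integration need one chart for a
whole neighbourhood. -/
theorem pointInner_eq {x : X} (e : atlas E X) (hx : x ∈ e.1.source) (u v : Forms E X) :
    pointInner g u v x = fibInner g e (e.1 x) (ev e (e.1 x) u) (ev e (e.1 x) v) := by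
  have h := fibInner_ev_transition g
    (mem_transition (prefChart x) e (mem_chart_source E x) hx) u v
  rw [(prefChart x).1.left_inv (mem_chart_source E x)] at h
  exact h

theorem pointInner_symm {e : atlas E X} {z : E} (hz : z ∈ e.1.target) (u v : Forms E X) :
    pointInner g u v (e.1.symm z) = fibInner g e z (ev e z u) (ev e z v) := by
  rw [pointInner_eq g e (e.1.map_target hz), e.1.right_inv hz]

theorem ev_eq_zero_transition {e e' : atlas E X} {x : X} (hx : x ∈ e.1.source)
    (hx' : x ∈ e'.1.source) {u : Forms E X} (h : ev e' (e'.1 x) u = 0) : ev e (e.1 x) u = 0 := by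
  rw [ev_transition_fib (mem_transition e e' hx hx'), e.1.left_inv hx, h, map_zero]

theorem ev_eq_zero_of_notMem_formSupport {u : Forms E X} {e : atlas E X} {z : E}
    (hz : e.1.symm z ∉ formSupport u) : ev e z u = 0 := by
  by_cases hzt : z ∈ e.1.target
  · rw [← e.1.right_inv hzt]
    refine ev_eq_zero_transition (e' := prefChart (e.1.symm z)) (e.1.map_target hzt)
      (mem_chart_source E _) (Fib.ext fun k => ?_)
    by_contra h
    exact hz (subset_closure ⟨k, h⟩)
  · exact ev_of_notMem hzt u

theorem formSupport_subset {u : Forms E X} {C : Set X} (hC : IsClosed C)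
    (h : ∀ e : atlas E X, ∀ z ∈ e.1.target, e.1.symm z ∉ C → ev e z u = 0) :
    formSupport u ⊆ C := by
  refine closure_minimal (fun x hx => ?_) hC
  obtain ⟨k, hk⟩ := hx
  by_contra hxC
  refine hk ?_
  have := h (prefChart x) (chartAt E x x) (mem_chart_target E x) (by
    change (chartAt E x).symm (chartAt E x x) ∉ C
    rwa [(chartAt E x).left_inv (mem_chart_source E x)])
  exact congrArg (fun w : Fib E => w k) this

theorem pointInner_eq_zero {u : Forms E X} (v : Forms E X) {x : X} (hx : x ∉ formSupport u) :
    pointInner g u v x = 0 := by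
  rw [pointInner_eq g (prefChart x) (mem_chart_source E x), ev_eq_zero_of_notMem_formSupport,
    map_zero, LinearMap.zero_apply]
  change (chartAt E x).symm (chartAt E x x) ∉ _
  rwa [(chartAt E x).left_inv (mem_chart_source E x)]

theorem continuous_pointInner (u v : Forms E X) : Continuous (pointInner g u v) := by
  refine continuous_iff_continuousAt.2 fun x => ?_
  let e : atlas E X := prefChart x
  have hx : x ∈ e.1.source := mem_chart_source E x
  have h1 : ContinuousOn (fun z => fibInner g e z (ev e z u) (ev e z v)) e.1.target :=
    (contDiffOn_fibInner e (contDiffOn_ev e u) (contDiffOn_ev e v)).continuousOn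
  have h2 : ContinuousOn (fun y => fibInner g e (e.1 y) (ev e (e.1 y) u) (ev e (e.1 y) v))
      e.1.source := h1.comp e.1.continuousOn fun y hy => e.1.map_source hy
  exact (h2.congr fun y hy => pointInner_eq g e hy u v).continuousAt
    (e.1.open_source.mem_nhds hx)

theorem hasCompactSupport_pointInner {u : Forms E X} (hu : IsCompact (formSupport u))
    (v : Forms E X) : HasCompactSupport (pointInner g u v) := by
  refine IsCompact.of_isClosed_subset hu (isClosed_tsupport _) ?_
  exact closure_minimal (fun x hx => by
    by_contra h
    exact hx (pointInner_eq_zero g v h)) isClosed_closure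

theorem pointInner_conj (u v : Forms E X) (x : X) :
    starRingEnd ℂ (pointInner g u v x) = pointInner g v u x := by
  rw [pointInner_eq g (prefChart x) (mem_chart_source E x),
    pointInner_eq g (prefChart x) (mem_chart_source E x), fibInner_conj (mem_chart_target E x)]

end PointInner

/-! ### The Riemannian volume measure. -/

section Density
variable {E X : Type*} [NormedAddCommGroup E] [NormedSpace ℂ E] [FiniteDimensional ℂ E]
  [TopologicalSpace X] [ChartedSpace E X] (g : HermitianMetric E X)

/-- The density of the Riemannian volume in a chart. -/
def volDensity (e : atlas E X) (z : E) : ℝ := Real.sqrt (gram g e z).det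

theorem contDiffOn_volDensity (e : atlas E X) : ContDiffOn ℝ ∞ (volDensity g e) e.1.target :=
  (contDiffOn_matrix_det fun _ _ => contDiffOn_metric g e _ _).sqrt
    fun z hz => (gram_det_pos g e z hz).ne'

theorem volDensity_pos {e : atlas E X} {z : E} (hz : z ∈ e.1.target) : 0 < volDensity g e z :=
  Real.sqrt_pos.2 (gram_det_pos g e z hz)

end Density

section Volume
variable {E X : Type*} [NormedAddCommGroup E] [NormedSpace ℂ E] [FiniteDimensional ℂ E]
  [MeasurableSpace E] [BorelSpace E] [TopologicalSpace X] [ChartedSpace E X]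
  [MeasurableSpace X] [BorelSpace X] (g : HermitianMetric E X)
open MeasureTheory

theorem aemeasurable_volDensity (e : atlas E X) : AEMeasurable
    (fun z => ENNReal.ofReal (volDensity g e z)) ((Module.finBasis ℝ E).addHaar.restrict e.1.target) :=
  ((contDiffOn_volDensity g e).continuousOn.aemeasurable e.1.open_target.measurableSet).ennreal_ofReal

theorem aemeasurable_chart_symm (e : atlas E X) :
    AEMeasurable e.1.symm ((Module.finBasis ℝ E).addHaar.restrict e.1.target) :=
  e.1.continuousOn_symm.aemeasurable e.1.open_target.measurableSet

theorem aemeasurable_chart_symm' (e : atlas E X) :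
    AEMeasurable e.1.symm (((Module.finBasis ℝ E).addHaar.restrict e.1.target).withDensity
      fun z => ENNReal.ofReal (volDensity g e z)) :=
  (aemeasurable_chart_symm e).mono_ac (withDensity_absolutelyContinuous _ _)

theorem chartVolume_apply (e : atlas E X) {A : Set X} (hA : MeasurableSet A) :
    chartVolume g e A = ∫⁻ z in e.1.target ∩ e.1.symm ⁻¹' A, ENNReal.ofReal (volDensity g e z)
      ∂(Module.finBasis ℝ E).addHaar := by
  have h := Measure.map_apply_of_aemeasurable (aemeasurable_chart_symm' g e) hA
  refine h.trans ?_
  rw [withDensity_apply', Measure.restrict_restrict' e.1.open_target.measurableSet, Set.inter_comm]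

theorem measurableSet_chart_symm (e : atlas E X) {A : Set X} (hA : MeasurableSet A) :
    MeasurableSet (e.1.target ∩ e.1.symm ⁻¹' A) := by
  have h : Continuous (e.1.target.domRestrict e.1.symm) := e.1.continuousOn_symm.domRestrict
  have h1 := (e.1.open_target.measurableSet).subtype_image (h.measurable hA)
  convert h1 using 1
  ext z
  simp [Set.domRestrict, and_comm]

variable [IsManifold 𝓘(ℂ, E) ∞ X]

/-- Change of variables along the coordinate change, with `sqrt_det_gram_transition` for the
density. -/
theorem chartVolume_eq (e e' : atlas E X) {A : Set X} (hA : MeasurableSet A)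
    (h : A ⊆ e.1.source) (h' : A ⊆ e'.1.source) : chartVolume g e A = chartVolume g e' A := by
  rw [chartVolume_apply g e hA, chartVolume_apply g e' hA]
  have hmem : ∀ z ∈ e.1.target ∩ e.1.symm ⁻¹' A, z ∈ (e.1.symm ≫ₕ e'.1).source := fun z hz => by
    rw [OpenPartialHomeomorph.trans_source]
    exact ⟨by simpa using hz.1, h' hz.2⟩
  have himg : e'.1.target ∩ e'.1.symm ⁻¹' A =
      (e'.1 ∘ e.1.symm) '' (e.1.target ∩ e.1.symm ⁻¹' A) := by
    ext w
    constructor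
    · rintro ⟨hw, hwA⟩
      refine ⟨e.1 (e'.1.symm w), ⟨e.1.map_source (h hwA), ?_⟩, ?_⟩
      · rw [Set.mem_preimage, e.1.left_inv (h hwA)]; exact hwA
      · rw [Function.comp_apply, e.1.left_inv (h hwA), e'.1.right_inv hw]
    · rintro ⟨z, ⟨hz, hzA⟩, rfl⟩
      refine ⟨e'.1.map_source (h' hzA), ?_⟩
      rw [Set.mem_preimage, Function.comp_apply, e'.1.left_inv (h' hzA)]
      exact hzA
  rw [himg, lintegral_image_eq_lintegral_abs_det_fderiv_mul _ (measurableSet_chart_symm e hA)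
    (fun z hz => (contDiffAt_transition e e' (hmem z hz)).hasFDerivAt.hasFDerivWithinAt)]
  · refine setLIntegral_congr_fun (measurableSet_chart_symm e hA) fun z hz => ?_
    rw [volDensity, sqrt_det_gram_transition g (hmem z hz), ENNReal.ofReal_mul (abs_nonneg _)]
    rfl
  · intro z hz w hw hzw
    have h1 := congrArg e'.1.symm hzw
    simp only [Function.comp_apply] at h1
    rw [e'.1.left_inv (h' hz.2), e'.1.left_inv (h' hw.2)] at h1
    rw [← e.1.right_inv hz.1, h1, e.1.right_inv hw.1]

theorem chartVolume_compl (e : atlas E X) : chartVolume g e e.1.sourceᶜ = 0 := by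
  rw [chartVolume_apply g e e.1.open_source.measurableSet.compl]
  have : e.1.target ∩ e.1.symm ⁻¹' e.1.sourceᶜ = ∅ := by
    ext z
    simp only [Set.mem_inter_iff, Set.mem_preimage, Set.mem_compl_iff, Set.mem_empty_iff_false,
      iff_false, not_and, not_not]
    exact fun hz => e.1.map_target hz
  rw [this]
  simp

theorem volumeMeasure_restrict (e : atlas E X) :
    (volumeMeasure g).restrict e.1.source = chartVolume g e := by
  have hs := e.1.open_source.measurableSet
  have h0 : (chartVolume g e).restrict e.1.source = chartVolume g e :=
    Measure.restrict_eq_self_of_ae_mem (by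
      rw [ae_iff]
      exact chartVolume_compl g e)
  refine le_antisymm ?_ ?_
  -- A supremum of measures is bounded by bounding each of them. The part of the volume of e' inside
  -- the source of e is at most the volume of e, since the two agree on the overlap; the other part
  -- is put into a measure that vanishes on restriction to that source.
  · have h1 : volumeMeasure g ≤ chartVolume g e + (volumeMeasure g).restrict e.1.sourceᶜ := by
      refine iSup_le fun e' => ?_
      rw [← Measure.restrict_add_restrict_compl (μ := chartVolume g e') hs]
      refine add_le_add ?_ (Measure.restrict_mono le_rfl (le_iSup (chartVolume g) e'))
      refine Measure.le_iff.2 fun A hA => ?_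
      rw [Measure.restrict_apply hA]
      have hA' := hA.inter hs
      have h2 : chartVolume g e' (A ∩ e.1.source) =
          chartVolume g e' (A ∩ e.1.source ∩ e'.1.source) := by
        have h3 : chartVolume g e' ((A ∩ e.1.source) \ e'.1.source) = 0 :=
          measure_mono_null (fun x hx => hx.2) (chartVolume_compl g e')
        rw [← measure_inter_add_sdiff (A ∩ e.1.source) e'.1.open_source.measurableSet, h3, add_zero]
      rw [h2, chartVolume_eq g e' e (hA'.inter e'.1.open_source.measurableSet)
        Set.inter_subset_right fun x hx => hx.1.2]
      exact measure_mono fun x hx => hx.1.1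
    refine (Measure.restrict_mono (le_refl e.1.source) h1).trans ?_
    rw [Measure.restrict_add, Measure.restrict_restrict hs]
    simp [h0]
  · conv_lhs => rw [← h0]
    exact Measure.restrict_mono le_rfl (le_iSup (chartVolume g) e)

theorem volumeMeasure_apply (e : atlas E X) {A : Set X} (hA : A ⊆ e.1.source) :
    volumeMeasure g A = chartVolume g e A := by
  rw [← volumeMeasure_restrict, Measure.restrict_eq_self _ hA]

/-- Integrals of functions supported in a chart. -/
theorem integral_volume (e : atlas E X) {F : X → ℂ} (hF : Continuous F)
    (h0 : ∀ x ∉ e.1.source, F x = 0) : ∫ x, F x ∂(volumeMeasure g) =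
      ∫ z in e.1.target, (volDensity g e z : ℂ) * F (e.1.symm z) ∂(Module.finBasis ℝ E).addHaar := by
  rw [← setIntegral_eq_integral_of_forall_compl_eq_zero h0, volumeMeasure_restrict]
  refine (integral_map (aemeasurable_chart_symm' g e) hF.aestronglyMeasurable).trans ?_
  rw [integral_withDensity_eq_integral_toReal_smul₀ (aemeasurable_volDensity g e)
    (Filter.Eventually.of_forall fun _ => ENNReal.ofReal_lt_top)]
  refine integral_congr_ae (Filter.Eventually.of_forall fun z => ?_)
  change (ENNReal.ofReal (volDensity g e z)).toReal • _ = _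
  rw [ENNReal.toReal_ofReal (show 0 ≤ volDensity g e z from Real.sqrt_nonneg _), Complex.real_smul]

/-- On a compact neighbourhood in a chart the density is bounded. Local finiteness is what makes
continuous functions with compact support integrable. -/
instance : IsLocallyFiniteMeasure (volumeMeasure g) := by
  refine ⟨fun x => ?_⟩
  let e : atlas E X := prefChart x
  have hx : x ∈ e.1.source := mem_chart_source E x
  have : ProperSpace E := FiniteDimensional.proper_real E
  obtain ⟨K, hK, hKt, hKc⟩ := local_compact_nhds (e.1.open_target.mem_nhds (e.1.map_source hx))
  have hU : e.1.source ∩ e.1 ⁻¹' interior K ∈ nhds x :=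
    (e.1.continuousOn.isOpen_inter_preimage e.1.open_source isOpen_interior).mem_nhds
      ⟨hx, mem_interior_iff_mem_nhds.2 hK⟩
  refine ⟨_, hU, ?_⟩
  rw [volumeMeasure_apply g e Set.inter_subset_left, chartVolume_apply g e
    (e.1.continuousOn.isOpen_inter_preimage e.1.open_source isOpen_interior).measurableSet]
  have hsub : e.1.target ∩ e.1.symm ⁻¹' (e.1.source ∩ e.1 ⁻¹' interior K) ⊆ K := by
    rintro z ⟨hz, hz'⟩
    have := hz'.2
    rw [Set.mem_preimage, e.1.right_inv hz] at this
    exact interior_subset this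
  refine (lintegral_mono_set hsub).trans_lt ?_
  obtain ⟨C, hC⟩ := hKc.exists_bound_of_continuousOn
    ((contDiffOn_volDensity g e).continuousOn.mono hKt)
  refine (setLIntegral_mono' hKc.measurableSet (g := fun _ => ENNReal.ofReal C) fun z hz =>
    ENNReal.ofReal_le_ofReal ((le_abs_self _).trans (hC z hz))).trans_lt ?_
  rw [setLIntegral_const]
  exact ENNReal.mul_lt_top ENNReal.ofReal_lt_top hKc.measure_lt_top

/-- The density is positive. This enters the uniqueness of adjoints, where a nonnegative continuous
function with vanishing integral has to vanish. -/
instance : (volumeMeasure g).IsOpenPosMeasure := by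
  refine ⟨fun U hU hne h0 => ?_⟩
  obtain ⟨x, hxU⟩ := hne
  let e : atlas E X := prefChart x
  have hx : x ∈ e.1.source := mem_chart_source E x
  have h1 : chartVolume g e U = 0 :=
    le_antisymm ((le_iSup (chartVolume g) e U).trans h0.le) zero_le
  have h2 := Measure.map_apply_of_aemeasurable (aemeasurable_chart_symm' g e) hU.measurableSet
  rw [show (((Module.finBasis ℝ E).addHaar.restrict e.1.target).withDensity
      fun z => ENNReal.ofReal (volDensity g e z)).map e.1.symm U = 0 from h1,
    eq_comm, withDensity_apply_eq_zero' (aemeasurable_volDensity g e)] at h2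
  have hV : IsOpen (e.1.target ∩ e.1.symm ⁻¹' U) :=
    e.1.continuousOn_symm.isOpen_inter_preimage e.1.open_target hU
  have h3 : (Module.finBasis ℝ E).addHaar (e.1.target ∩ e.1.symm ⁻¹' U) = 0 := by
    rw [Measure.restrict_apply' e.1.open_target.measurableSet] at h2
    refine measure_mono_null (fun z hz => ?_) h2
    refine ⟨⟨?_, hz.2⟩, hz.1⟩
    exact (ENNReal.ofReal_pos.2 (volDensity_pos g hz.1)).ne'
  have h4 : e.1 x ∈ e.1.target ∩ e.1.symm ⁻¹' U := by
    refine ⟨e.1.map_source hx, ?_⟩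
    rw [Set.mem_preimage, e.1.left_inv hx]
    exact hxU
  exact hV.measure_ne_zero _ ⟨e.1 x, h4⟩ h3

theorem integrable_pointInner {u : Forms E X} (hu : IsCompact (formSupport u)) (v : Forms E X) :
    Integrable (pointInner g u v) (volumeMeasure g) :=
  (continuous_pointInner g u v).integrable_of_hasCompactSupport
    (hasCompactSupport_pointInner g hu v)

end Volume

/-! ### Local operators, supports and partitions of unity. -/

section Local
variable {E X : Type*} [NormedAddCommGroup E] [NormedSpace ℂ E] [FiniteDimensional ℂ E]
  [TopologicalSpace X] [ChartedSpace E X] [IsManifold 𝓘(ℂ, E) ∞ X]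

/-- An operator on forms is local if it does not enlarge supports. -/
def IsLocalOp (A : Module.End ℂ (Forms E X)) : Prop :=
  ∀ (u : Forms E X) (e : atlas E X), ∀ z ∈ e.1.target,
    (∀ᶠ w in nhds z, ev e w u = 0) → ev e z (A u) = 0

theorem IsLocalOp.formSupport_subset {A : Module.End ℂ (Forms E X)} (hA : IsLocalOp A)
    (u : Forms E X) : formSupport (A u) ⊆ formSupport u := by
  refine TwistedBKN.formSupport_subset isClosed_closure fun e z hz hzu => hA u e z hz ?_
  have h := e.1.continuousOn_symm.isOpen_inter_preimage e.1.open_target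
    (isClosed_closure (s := {x | ∃ k, (u k).1 (prefChart x) (chartAt E x x) ≠ 0})).isOpen_compl
  filter_upwards [h.mem_nhds ⟨hz, hzu⟩] with w hw
  exact ev_eq_zero_of_notMem_formSupport hw.2

theorem IsLocalOp.isCompact {A : Module.End ℂ (Forms E X)} (hA : IsLocalOp A) {u : Forms E X}
    (hu : IsCompact (formSupport u)) : IsCompact (formSupport (A u)) :=
  hu.of_isClosed_subset isClosed_closure (hA.formSupport_subset u)

theorem fibDeriv_eq_zero {U : E → Fib E} {z : E} (h : ∀ᶠ w in nhds z, U w = 0) (w : E) :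
    fibDeriv U z w = 0 := by
  rw [fibDeriv_congr (U := fun _ => (0 : Fib E)) h, fibDeriv_const]

theorem isLocalOp_delbar : IsLocalOp (delbar E X) := fun u e z hz h => by
  rw [ev_delbar (Module.finBasis ℂ E) hz]
  refine Finset.sum_eq_zero fun a _ => ?_
  simp only [antiPart, fibDeriv_eq_zero h, smul_zero, add_zero, map_zero]

theorem formSupport_mulFn_subset (f : C^∞⟮𝓘(ℝ, E), X; 𝓘(ℝ, ℝ), ℝ⟯) (u : Forms E X) :
    formSupport (mulFn f u) ⊆ tsupport f ∩ formSupport u := by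
  refine formSupport_subset ((isClosed_tsupport _).inter isClosed_closure) fun e z hz h => ?_
  rw [ev_mulFn]
  by_cases h1 : e.1.symm z ∈ tsupport f
  · rw [ev_eq_zero_of_notMem_formSupport fun h2 => h ⟨h1, h2⟩, smul_zero]
  · rw [image_eq_zero_of_notMem_tsupport h1, Complex.ofReal_zero, zero_smul]

theorem formSupport_conjForm (u : Forms E X) : formSupport (conjForm E X u) = formSupport u := by
  have h : ∀ u : Forms E X, formSupport (conjForm E X u) ⊆ formSupport u := fun u =>
    formSupport_subset isClosed_closure fun e z _ hzu => by
      rw [ev_conj, ev_eq_zero_of_notMem_formSupport hzu, map_zero]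
  refine (h u).antisymm ?_
  conv_lhs => rw [← conjForm_conjForm u]
  exact h _

/-- Decomposition of a compactly supported form into forms supported in charts. -/
theorem exists_sum_chart_supported [T2Space X] [SecondCountableTopology X] {u : Forms E X}
    (hu : IsCompact (formSupport u)) : ∃ (s : Finset X) (w : X → Forms E X), u = ∑ i ∈ s, w i ∧
      ∀ i, IsCompact (formSupport (w i)) ∧ formSupport (w i) ⊆ (prefChart (E := E) i).1.source := by
  have := realManifold E X
  have : ProperSpace E := FiniteDimensional.proper_real E
  have : LocallyCompactSpace X := ChartedSpace.locallyCompactSpace E X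
  obtain ⟨f, hf⟩ := SmoothPartitionOfUnity.exists_isSubordinate_chartAt_source 𝓘(ℝ, E) X
  -- By local finiteness only finitely many functions of the partition meet the compact support;
  -- their sum is 1 on it, and elsewhere the form is zero anyway.
  have hfin := f.locallyFinite.finite_nonempty_inter_compact hu
  refine ⟨hfin.toFinset, fun i => mulFn (f i) u, ?_, fun i => ⟨?_, ?_⟩⟩
  · refine forms_ext fun e z hz => ?_
    rw [map_sum]
    simp only [ev_mulFn]
    rw [← Finset.sum_smul]
    by_cases h : e.1.symm z ∈ formSupport u
    · have h1 : ∑ i ∈ hfin.toFinset, f i (e.1.symm z) = 1 := by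
        refine f.sum_finsupport' _ (Set.mem_univ _) fun i hi => ?_
        rw [Set.Finite.mem_toFinset]
        exact ⟨e.1.symm z, (f.mem_finsupport _).1 hi, h⟩
      rw [← Complex.ofReal_sum, h1, Complex.ofReal_one, one_smul]
    · rw [ev_eq_zero_of_notMem_formSupport h, smul_zero]
  · exact hu.of_isClosed_subset isClosed_closure
      ((formSupport_mulFn_subset _ u).trans Set.inter_subset_right)
  · exact (formSupport_mulFn_subset _ u).trans (Set.inter_subset_left.trans (hf i))

end Local

/-! ### Formal adjoints: sums, conjugates, localization and uniqueness. -/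

section FormalAdjoint
variable {E X : Type*} [NormedAddCommGroup E] [NormedSpace ℂ E] [FiniteDimensional ℂ E]
  [MeasurableSpace E] [BorelSpace E] [TopologicalSpace X] [ChartedSpace E X]
  [IsManifold 𝓘(ℂ, E) ∞ X] [MeasurableSpace X] [BorelSpace X] (g : HermitianMetric E X)
open MeasureTheory

theorem pointInner_sub_left (u u' v : Forms E X) (x : X) :
    pointInner g (u - u') v x = pointInner g u v x - pointInner g u' v x := by
  simp only [pointInner_eq g (prefChart x) (mem_chart_source E x), map_sub, LinearMap.sub_apply]

theorem pointInner_sub_right (u v v' : Forms E X) (x : X) :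
    pointInner g u (v - v') x = pointInner g u v x - pointInner g u v' x := by
  simp only [pointInner_eq g (prefChart x) (mem_chart_source E x), map_sub]

theorem pointInner_sum_left {ι : Type*} (s : Finset ι) (u : ι → Forms E X) (v : Forms E X) (x : X) :
    pointInner g (∑ i ∈ s, u i) v x = ∑ i ∈ s, pointInner g (u i) v x := by
  simp only [pointInner_eq g (prefChart x) (mem_chart_source E x), map_sum, LinearMap.sum_apply]

theorem pointInner_mulFn_left (f : C^∞⟮𝓘(ℝ, E), X; 𝓘(ℝ, ℝ), ℝ⟯) (u v : Forms E X) (x : X) :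
    pointInner g (mulFn f u) v x = (f x : ℂ) * pointInner g u v x := by
  simp only [pointInner_eq g (prefChart x) (mem_chart_source E x), ev_mulFn, map_smul,
    LinearMap.smul_apply, smul_eq_mul]
  rw [(prefChart x).1.left_inv (mem_chart_source E x)]

theorem fibInner_fibConj (e : atlas E X) (z : E) (u v : Fib E) :
    fibInner g e z (fibConj E u) (fibConj E v) = starRingEnd ℂ (fibInner g e z u v) := by
  rw [fibInner_apply, fibInner_apply, map_sum]
  refine Finset.sum_congr rfl fun k _ => ?_
  simp only [altInner, fibConj_apply, altConj_apply, map_mul, map_sum, map_inv₀, map_natCast,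
    map_prod, Complex.conj_ofReal]

theorem pointInner_conjForm (u v : Forms E X) (x : X) :
    pointInner g (conjForm E X u) (conjForm E X v) x = starRingEnd ℂ (pointInner g u v x) := by
  simp only [pointInner_eq g (prefChart x) (mem_chart_source E x), ev_conj, fibInner_fibConj]

theorem l2Inner_conjForm (u v : Forms E X) :
    l2Inner g (conjForm E X u) (conjForm E X v) = starRingEnd ℂ (l2Inner g u v) := by
  simp only [l2Inner, pointInner_conjForm]
  exact integral_conj

variable {g}

theorem isFormalAdjoint_of_pointwise {A B : Module.End ℂ (Forms E X)}
    (h : ∀ (e : atlas E X), ∀ z ∈ e.1.target, ∀ u v, fibInner g e z (ev e z (A u)) (ev e z v) =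
      fibInner g e z (ev e z u) (ev e z (B v))) : IsFormalAdjoint g A B := fun u v _ => by
  refine integral_congr_ae (Filter.Eventually.of_forall fun x => ?_)
  simp only [pointInner_eq g (prefChart x) (mem_chart_source E x)]
  exact h (prefChart x) _ (mem_chart_target E x) u v

/-- Conjugation is an antiunitary involution that preserves supports. -/
theorem IsFormalAdjoint.conjOp {A B : Module.End ℂ (Forms E X)} (h : IsFormalAdjoint g A B) :
    IsFormalAdjoint g (conjOp A) (conjOp B) := fun u v hu => by
  have h1 := h (conjForm E X u) (conjForm E X v) (by rwa [formSupport_conjForm])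
  have h2 := congrArg (starRingEnd ℂ) h1
  rw [← l2Inner_conjForm, ← l2Inner_conjForm, conjForm_conjForm, conjForm_conjForm] at h2
  exact h2

/-- Locality of A and C keeps the supports of Au and Cu compact, which gives the integrability
needed to split the integrals. -/
theorem IsFormalAdjoint.sub {A B C D : Module.End ℂ (Forms E X)} (h : IsFormalAdjoint g A B)
    (h' : IsFormalAdjoint g C D) (hA : IsLocalOp A) (hC : IsLocalOp C) :
    IsFormalAdjoint g (A - C) (B - D) := fun u v hu => by
  have h1 : l2Inner g ((A - C) u) v = l2Inner g (A u) v - l2Inner g (C u) v := by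
    simp only [l2Inner]
    rw [← integral_sub (integrable_pointInner g (hA.isCompact hu) v)
      (integrable_pointInner g (hC.isCompact hu) v)]
    simp only [LinearMap.sub_apply, pointInner_sub_left]
  have h2 : l2Inner g u ((B - D) v) = l2Inner g u (B v) - l2Inner g u (D v) := by
    simp only [l2Inner]
    rw [← integral_sub (integrable_pointInner g hu _) (integrable_pointInner g hu _)]
    simp only [LinearMap.sub_apply, pointInner_sub_right]
  rw [h1, h2, h u v hu, h' u v hu]

/-- Only u has to be cut by a partition of unity, since every integrand is supported where u is;
locality ensures this also on the side of A. -/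
theorem isFormalAdjoint_of_chart_supported [T2Space X] [SecondCountableTopology X]
    {A B : Module.End ℂ (Forms E X)} (hA : IsLocalOp A)
    (h : ∀ (e : atlas E X) (u v : Forms E X), IsCompact (formSupport u) →
      formSupport u ⊆ e.1.source → l2Inner g (A u) v = l2Inner g u (B v)) :
    IsFormalAdjoint g A B := fun u v hu => by
  obtain ⟨s, w, hw, hws⟩ := exists_sum_chart_supported hu
  have h1 : l2Inner g (A u) v = ∑ i ∈ s, l2Inner g (A (w i)) v := by
    simp only [l2Inner]
    rw [← integral_finsetSum s fun i _ => integrable_pointInner g (hA.isCompact (hws i).1) v]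
    conv_lhs => rw [hw, map_sum]
    simp only [pointInner_sum_left]
  have h2 : l2Inner g u (B v) = ∑ i ∈ s, l2Inner g (w i) (B v) := by
    simp only [l2Inner]
    rw [← integral_finsetSum s fun i _ => integrable_pointInner g (hws i).1 _]
    conv_lhs => rw [hw]
    simp only [pointInner_sum_left]
  rw [h1, h2]
  exact Finset.sum_congr rfl fun i _ => h _ _ v (hws i).1 (hws i).2

theorem pointInner_self_eq (u : Forms E X) (x : X) :
    pointInner g u u x = ((pointInner g u u x).re : ℂ) :=
  (Complex.conj_eq_iff_re.1 (pointInner_conj g u u x)).symm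

theorem pointInner_self_nonneg (u : Forms E X) (x : X) : 0 ≤ (pointInner g u u x).re := by
  rw [pointInner_eq g (prefChart x) (mem_chart_source E x)]
  exact fibInner_self_nonneg (mem_chart_target E x) _

theorem eq_zero_of_pointInner_self {u : Forms E X} (h : ∀ x, (pointInner g u u x).re = 0) :
    u = 0 := forms_ext fun e z hz => by
  rw [map_zero]
  refine eq_zero_of_fibInner_self (g := g) hz ?_
  rw [← pointInner_symm g hz, h]

/-- Testing with ρw, for a bump function ρ at x, gives the integral of ρ|w|², which is positive if
w(x) ≠ 0. -/
theorem eq_zero_of_l2Inner [T2Space X] {w : Forms E X}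
    (h : ∀ u, IsCompact (formSupport u) → l2Inner g u w = 0) : w = 0 := by
  have := realManifold E X
  refine eq_zero_of_pointInner_self (g := g) fun x => ?_
  by_contra hx
  obtain ⟨ρ, -⟩ := (SmoothBumpFunction.nhds_basis_tsupport (I := 𝓘(ℝ, E)) x).ex_mem
  let f : C^∞⟮𝓘(ℝ, E), X; 𝓘(ℝ, ℝ), ℝ⟯ := ⟨ρ, ρ.contMDiff⟩
  have hc : IsCompact (formSupport (mulFn f w)) :=
    IsCompact.of_isClosed_subset ρ.hasCompactSupport isClosed_closure
      ((formSupport_mulFn_subset f w).trans Set.inter_subset_left)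
  have h1 := h _ hc
  have h2 : ∀ y, pointInner g (mulFn f w) w y = ((ρ y * (pointInner g w w y).re : ℝ) : ℂ) := by
    intro y
    rw [pointInner_mulFn_left, Complex.ofReal_mul, ← pointInner_self_eq]
    rfl
  rw [l2Inner] at h1
  simp only [h2] at h1
  rw [integral_complex_ofReal, Complex.ofReal_eq_zero] at h1
  refine (Continuous.integral_pos_of_hasCompactSupport_nonneg_nonzero (μ := volumeMeasure g)
    (f := fun y => ρ y * (pointInner g w w y).re) (x := x) ?_ ?_ ?_ ?_).ne' h1
  · exact ρ.continuous.mul (Complex.continuous_re.comp (continuous_pointInner g w w))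
  · exact ρ.hasCompactSupport.mul_right
  · exact fun y => mul_nonneg ρ.nonneg (pointInner_self_nonneg w y)
  · simp only [ρ.eq_one, one_mul]
    exact hx

theorem IsFormalAdjoint.unique [T2Space X] {A B B' : Module.End ℂ (Forms E X)}
    (h : IsFormalAdjoint g A B) (h' : IsFormalAdjoint g A B') : B = B' := by
  refine LinearMap.ext fun v => sub_eq_zero.1 (eq_zero_of_l2Inner (g := g) fun u hu => ?_)
  have h1 : l2Inner g u (B v - B' v) = l2Inner g u (B v) - l2Inner g u (B' v) := by
    simp only [l2Inner]
    rw [← integral_sub (integrable_pointInner g hu _) (integrable_pointInner g hu _)]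
    simp only [pointInner_sub_right]
  rw [h1, ← h u v hu, ← h' u v hu, sub_self]

theorem IsFormalAdjoint.formalAdjoint_eq [T2Space X] {A B : Module.End ℂ (Forms E X)}
    (h : IsFormalAdjoint g A B) : formalAdjoint g A = B := by
  have hex : ∃ B, IsFormalAdjoint g A B := ⟨B, h⟩
  rw [formalAdjoint, dif_pos hex]
  exact hex.choose_spec.unique h

theorem IsFormalAdjoint.existsUnique [T2Space X] {A B : Module.End ℂ (Forms E X)}
    (h : IsFormalAdjoint g A B) : ∃! B, IsFormalAdjoint g A B :=
  ⟨B, h, fun _ h' => h'.unique h⟩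

end FormalAdjoint

/-! ### Integration by parts in a chart. -/

section Divergence
variable {E : Type*} [NormedAddCommGroup E] [NormedSpace ℂ E] [FiniteDimensional ℂ E]
  [MeasurableSpace E] [BorelSpace E]
open MeasureTheory

/-- Integration by parts against the constant function 1. -/
theorem integral_fderiv_eq_zero (μ : Measure E) [μ.IsAddHaarMeasure] {V : E → ℂ}
    (hV : ContDiff ℝ 1 V) (hc : HasCompactSupport V) (w : E) : ∫ z, fderiv ℝ V z w ∂μ = 0 := by
  have h1 : Integrable (fun z => fderiv ℝ V z w) μ :=
    ((hV.continuous_fderiv one_ne_zero).clm_apply continuous_const).integrable_of_hasCompactSupport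
      (hc.fderiv_apply ℝ w)
  have h2 : Integrable V μ := hV.continuous.integrable_of_hasCompactSupport hc
  have h := integral_mul_fderiv_eq_neg_fderiv_mul_of_integrable (𝕜 := ℂ) (μ := μ)
    (f := fun _ : E => (1 : ℂ)) (g := V) (v := w) (by simp) (by simpa using h1) (by simpa using h2)
    (fun _ _ => differentiableAt_const _) fun z _ => hV.differentiable one_ne_zero z
  simpa using h

/-- Vanishing off a compact subset of U makes V continuously differentiable on the whole space,
although smoothness is known only on U. -/
theorem setIntegral_fderiv_eq_zero (μ : Measure E) [μ.IsAddHaarMeasure] {V : E → ℂ} {U K : Set E}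
    (hU : IsOpen U) (hV : ContDiffOn ℝ ∞ V U) (hK : IsCompact K) (hKU : K ⊆ U)
    (h0 : ∀ z ∉ K, V z = 0) (w : E) :
    IntegrableOn (fun z => fderiv ℝ V z w) U μ ∧ ∫ z in U, fderiv ℝ V z w ∂μ = 0 := by
  have hc : HasCompactSupport V := HasCompactSupport.intro hK h0
  have h1 : ContDiff ℝ 1 V := by
    refine contDiff_iff_contDiffAt.2 fun z => ?_
    by_cases hz : z ∈ U
    · exact (hV.contDiffAt (hU.mem_nhds hz)).of_le (by simp)
    · have h2 : V =ᶠ[nhds z] fun _ => 0 :=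
        Filter.eventually_of_mem (hK.isClosed.isOpen_compl.mem_nhds fun h => hz (hKU h)) h0
      exact contDiffAt_const.congr_of_eventuallyEq h2
  have h3 : Integrable (fun z => fderiv ℝ V z w) μ :=
    ((h1.continuous_fderiv one_ne_zero).clm_apply continuous_const).integrable_of_hasCompactSupport
      (hc.fderiv_apply ℝ w)
  refine ⟨h3.integrableOn, ?_⟩
  rw [setIntegral_eq_integral_of_forall_compl_eq_zero, integral_fderiv_eq_zero μ h1 hc]
  intro z hz
  have h2 : V =ᶠ[nhds z] fun _ => 0 :=
    Filter.eventually_of_mem (hK.isClosed.isOpen_compl.mem_nhds fun h => hz (hKU h)) h0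
  rw [h2.fderiv_eq]
  simp

end Divergence

/-! ### The divergence of the flux and its independence of the basis. -/

section Covector
variable {E : Type*} [NormedAddCommGroup E] [NormedSpace ℂ E]

/-- The antilinear part of a covector. -/
def antiCov (θ : E →L[ℝ] ℂ) : E →L[ℝ] ℂ :=
  (1 / 2 : ℂ) • (θ + Complex.I • θ.comp ((Complex.I • ContinuousLinearMap.id ℂ E).restrictScalars ℝ))

theorem antiCov_apply (θ : E →L[ℝ] ℂ) (v : E) :
    antiCov θ v = (1 / 2 : ℂ) * (θ v + Complex.I * θ (Complex.I • v)) := rfl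

theorem antiCov_sum {ι : Type*} (s : Finset ι) (c : ι → ℂ) (θ : ι → E →L[ℝ] ℂ) :
    antiCov (∑ i ∈ s, c i • θ i) = ∑ i ∈ s, c i • antiCov (θ i) := by
  ext v
  simp only [antiCov_apply, _root_.sum_apply, _root_.smul_apply, smul_eq_mul, Finset.mul_sum,
    ← Finset.sum_add_distrib]
  exact Finset.sum_congr rfl fun i _ => by ring

variable [FiniteDimensional ℂ E] {ι : Type*} [Fintype ι] [DecidableEq ι] (b : Module.Basis ι ℂ E)

/-- Since x = (z + z̄)/2 and y = (z - z̄)/2i, the antilinear parts of dx and dy are dz̄/2 and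
(i/2)dz̄. -/
theorem antiCov_dual_zero (a : ι) :
    antiCov (dualCovector (realFrame b) (0, a)) = (1 / 2 : ℂ) • dzBar b a := by
  rw [dualCovector_realFrame_zero]
  ext v
  simp only [antiCov_apply, _root_.smul_apply, _root_.add_apply, smul_eq_mul, dz_apply,
    dzBar_apply, map_smul, Finsupp.smul_apply, map_mul, Complex.conj_I]
  linear_combination (1 / 4 * (b.repr v a - starRingEnd ℂ (b.repr v a))) * Complex.I_mul_I

theorem antiCov_dual_one (a : ι) :
    antiCov (dualCovector (realFrame b) (1, a)) = (Complex.I / 2 : ℂ) • dzBar b a := by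
  rw [dualCovector_realFrame_one]
  ext v
  simp only [antiCov_apply, _root_.smul_apply, _root_.sub_apply, smul_eq_mul, dz_apply,
    dzBar_apply, map_smul, Finsupp.smul_apply, map_mul, Complex.conj_I]
  linear_combination (-Complex.I / 4 * (b.repr v a + starRingEnd ℂ (b.repr v a))) * Complex.I_mul_I

end Covector

section ChartDivergence
variable {E X : Type*} [NormedAddCommGroup E] [NormedSpace ℂ E] [FiniteDimensional ℂ E]
  [TopologicalSpace X] [ChartedSpace E X] (g : HermitianMetric E X) {e : atlas E X}

/-- The component along the covector `θ` of the vector field dual to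
`θ ↦ ⟨θ ∧ u, v⟩` times the volume density. -/
def flux (e : atlas E X) (u v : Forms E X) (θ : E →L[ℝ] ℂ) (z : E) : ℂ :=
  (volDensity g e z : ℂ) * fibInner g e z (fibExt θ (ev e z u)) (ev e z v)

theorem flux_sum (u v : Forms E X) {ι : Type*} (s : Finset ι) (c : ι → ℂ) (θ : ι → E →L[ℝ] ℂ)
    (z : E) : flux g e u v (∑ i ∈ s, c i • θ i) z = ∑ i ∈ s, c i * flux g e u v (θ i) z := by
  simp only [flux, map_sum, map_smul, LinearMap.sum_apply, LinearMap.smul_apply, smul_eq_mul,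
    Finset.mul_sum]
  exact Finset.sum_congr rfl fun i _ => by ring

theorem flux_smul (u v : Forms E X) (c : ℂ) (θ : E →L[ℝ] ℂ) (z : E) :
    flux g e u v (c • θ) z = c * flux g e u v θ z := by
  simp only [flux, map_smul, LinearMap.smul_apply, smul_eq_mul]
  ring

theorem contDiffOn_fibExt {U : E → Fib E} {s : Set E}
    (hU : ∀ k, ContDiffOn ℝ ∞ (fun z => U z k) s) (θ : E →L[ℝ] ℂ) (k : ℕ) :
    ContDiffOn ℝ ∞ (fun z => fibExt θ (U z) k) s := by
  cases k with
  | zero => exact contDiffOn_const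
  | succ k =>
    exact (LinearMap.toContinuousLinearMap ((altExt θ k).restrictScalars ℝ)).contDiff.comp_contDiffOn
      (hU k)

theorem contDiffOn_flux (u v : Forms E X) (θ : E →L[ℝ] ℂ) :
    ContDiffOn ℝ ∞ (flux g e u v θ) e.1.target :=
  (Complex.ofRealCLM.contDiff.comp_contDiffOn (contDiffOn_volDensity g e)).mul
    (contDiffOn_fibInner e (contDiffOn_fibExt (contDiffOn_ev e u) θ) (contDiffOn_ev e v))

variable {z : E} (hz : z ∈ e.1.target)
include hz

theorem differentiableAt_flux (u v : Forms E X) (θ : E →L[ℝ] ℂ) :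
    DifferentiableAt ℝ (flux g e u v θ) z := differentiableAt_of_contDiffOn hz (contDiffOn_flux g u v θ)

theorem fderiv_flux_sum (u v : Forms E X) {ι : Type*} (s : Finset ι) (c : ι → ℂ)
    (θ : ι → E →L[ℝ] ℂ) (w : E) :
    fderiv ℝ (flux g e u v (∑ i ∈ s, c i • θ i)) z w =
      ∑ i ∈ s, c i * fderiv ℝ (flux g e u v (θ i)) z w := by
  have h : flux g e u v (∑ i ∈ s, c i • θ i) = fun z => ∑ i ∈ s, c i * flux g e u v (θ i) z :=
    funext fun z => flux_sum g u v s c θ z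
  rw [h, fderiv_fun_sum fun i _ => (differentiableAt_flux g hz u v (θ i)).const_mul (c i),
    _root_.sum_apply]
  refine Finset.sum_congr rfl fun i _ => ?_
  rw [fderiv_const_mul (differentiableAt_flux g hz u v (θ i))]
  rfl

theorem fderiv_flux_smul (u v : Forms E X) (c : ℂ) (θ : E →L[ℝ] ℂ) (w : E) :
    fderiv ℝ (flux g e u v (c • θ)) z w = c * fderiv ℝ (flux g e u v θ) z w := by
  have h : flux g e u v (c • θ) = fun z => c * flux g e u v θ z :=
    funext fun z => flux_smul g u v c θ z
  rw [h, fderiv_const_mul (differentiableAt_flux g hz u v θ)]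
  rfl

/-- The divergence does not depend on the basis. -/
theorem sum_fderiv_flux_basis (u v : Forms E X) {μ ν : Type*} [Fintype μ] [Fintype ν]
    (b : Module.Basis μ ℝ E) (f : Module.Basis ν ℝ E) :
    ∑ j, fderiv ℝ (flux g e u v (antiCov (dualCovector b j))) z (b j) =
      ∑ m, fderiv ℝ (flux g e u v (antiCov (dualCovector f m))) z (f m) := by
  have h1 : ∀ m, dualCovector f m = ∑ j, (f.repr (b j) m : ℂ) • dualCovector b j := by
    intro m
    ext v
    rw [dualCovector_apply]
    conv_lhs => rw [← b.sum_repr v]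
    simp only [map_sum, map_smul, Finsupp.coe_finsetSum, Finset.sum_apply, Finsupp.smul_apply,
      smul_eq_mul, _root_.sum_apply, _root_.smul_apply, dualCovector_apply, Complex.ofReal_sum,
      Complex.ofReal_mul]
    exact Finset.sum_congr rfl fun j _ => mul_comm _ _
  have h2 : ∀ m, fderiv ℝ (flux g e u v (antiCov (dualCovector f m))) z (f m) =
      ∑ j, (f.repr (b j) m : ℂ) * fderiv ℝ (flux g e u v (antiCov (dualCovector b j))) z (f m) := by
    intro m
    rw [h1, antiCov_sum, fderiv_flux_sum g hz]
  simp only [h2]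
  rw [Finset.sum_comm]
  refine Finset.sum_congr rfl fun j _ => ?_
  conv_lhs => rw [← f.sum_repr (b j), map_sum]
  refine Finset.sum_congr rfl fun m _ => ?_
  rw [map_smul, Complex.real_smul]

/-- The integral is taken over derivatives along the fixed basis of the chart, whereas the algebra
needs a frame unitary at the point considered. The divergence is the same in both, and only the
dz̄_a remain, because the flux is evaluated on antilinear parts. -/
theorem sum_fderiv_flux_frame (u v : Forms E X) {μ ι : Type*} [Fintype μ] [Fintype ι]
    [DecidableEq ι] (b₀ : Module.Basis μ ℝ E) (b : Module.Basis ι ℂ E) :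
    ∑ j, fderiv ℝ (flux g e u v (antiCov (dualCovector b₀ j))) z (b₀ j) =
      ∑ a, antiPart (fderiv ℝ (flux g e u v (dzBar b a)) z) (b a) := by
  rw [sum_fderiv_flux_basis g hz u v b₀ (realFrame b), Fintype.sum_prod_type, Fin.sum_univ_two,
    ← Finset.sum_add_distrib]
  refine Finset.sum_congr rfl fun a _ => ?_
  rw [antiCov_dual_zero, antiCov_dual_one, fderiv_flux_smul g hz, fderiv_flux_smul g hz,
    realFrame_zero, realFrame_one, antiPart, smul_eq_mul, smul_eq_mul]
  ring

end ChartDivergence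

section Adjoint
variable {E X : Type*} [NormedAddCommGroup E] [NormedSpace ℂ E] [FiniteDimensional ℂ E]
  [MeasurableSpace E] [BorelSpace E] [TopologicalSpace X] [ChartedSpace E X]
  [IsManifold 𝓘(ℂ, E) ∞ X] [MeasurableSpace X] [BorelSpace X] {g : HermitianMetric E X}
open MeasureTheory

/-- An identity up to a divergence gives a formal adjoint. -/
theorem isFormalAdjoint_of_divergence [T2Space X] [SecondCountableTopology X]
    {A B : Module.End ℂ (Forms E X)} (hA : IsLocalOp A)
    (h : ∀ (e : atlas E X) (u v : Forms E X), ∀ z ∈ e.1.target,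
      ∑ j, fderiv ℝ (flux g e u v (antiCov (dualCovector (Module.finBasis ℝ E) j))) z
          (Module.finBasis ℝ E j) =
        (volDensity g e z : ℂ) * (fibInner g e z (ev e z (A u)) (ev e z v) -
          fibInner g e z (ev e z u) (ev e z (B v)))) : IsFormalAdjoint g A B := by
  refine isFormalAdjoint_of_chart_supported hA fun e u v hu hue => sub_eq_zero.1 ?_
  have hAu := hA.isCompact hu
  rw [l2Inner, l2Inner, ← integral_sub (integrable_pointInner g hAu v)
    (integrable_pointInner g hu _), integral_volume g e
    (F := fun x => pointInner g (A u) v x - pointInner g u (B v) x)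
    ((continuous_pointInner g _ _).sub (continuous_pointInner g _ _))]
  · have h1 : ∀ z ∈ e.1.target, (volDensity g e z : ℂ) *
        (pointInner g (A u) v (e.1.symm z) - pointInner g u (B v) (e.1.symm z)) =
        ∑ j, fderiv ℝ (flux g e u v (antiCov (dualCovector (Module.finBasis ℝ E) j))) z
          (Module.finBasis ℝ E j) := by
      intro z hz
      rw [h e u v z hz, pointInner_symm g hz, pointInner_symm g hz]
    rw [setIntegral_congr_fun e.1.open_target.measurableSet h1]
    -- The flux vanishes where u does, so it is supported in the compact image of the support of u
    -- inside the chart.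
    have hK : IsCompact (e.1 '' formSupport u) :=
      hu.image_of_continuousOn (e.1.continuousOn.mono hue)
    have hKt : e.1 '' formSupport u ⊆ e.1.target := by
      rintro _ ⟨x, hx, rfl⟩
      exact e.1.map_source (hue hx)
    have h2 := fun j => setIntegral_fderiv_eq_zero (Module.finBasis ℝ E).addHaar
      (V := flux g e u v (antiCov (dualCovector (Module.finBasis ℝ E) j))) e.1.open_target
      (contDiffOn_flux g u v _) hK hKt (fun z hz => by
        have h3 : ev e z u = 0 := by
          by_cases hzt : z ∈ e.1.target
          · refine ev_eq_zero_of_notMem_formSupport fun h4 => hz ⟨_, h4, e.1.right_inv hzt⟩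
          · exact ev_of_notMem hzt u
        rw [flux, h3, map_zero, map_zero, LinearMap.zero_apply, mul_zero])
      (Module.finBasis ℝ E j)
    rw [integral_finsetSum _ fun j _ => (h2 j).1]
    exact Finset.sum_eq_zero fun j _ => (h2 j).2
  · intro x hx
    rw [pointInner_eq_zero g _ fun h3 => hx (hue h3),
      pointInner_eq_zero g _ fun h3 => hx (hue (hA.formSupport_subset u h3)), sub_zero]

end Adjoint

/-! ### The adjoint of ∂̄ in a unitary frame, with the derivatives of metric and density. -/

section Frame
variable {E X : Type*} [NormedAddCommGroup E] [NormedSpace ℂ E] [FiniteDimensional ℂ E]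
  [TopologicalSpace X] [ChartedSpace E X] [IsManifold 𝓘(ℂ, E) ∞ X] (g : HermitianMetric E X)
  {e : atlas E X} {z : E} (hz : z ∈ e.1.target) {ι : Type*} [Fintype ι] [DecidableEq ι]
  {b : Module.Basis ι ℂ E} (hb : g.IsOrthonormal e z (realFrame b))

/-- The logarithmic derivative of the volume density in an orthonormal frame. -/
def traceDeriv (e : atlas E X) (z : E) (b : Module.Basis ι ℂ E) (w : E) : ℂ :=
  ((1 / 2 * ∑ a, fderiv ℝ (fun z => g.metric e z (realFrame b a) (realFrame b a)) z w : ℝ) : ℂ)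

include hz hb

/-- The coefficients are symmetric, being derivatives of a real symmetric form, and exterior
multiplication is adjoint to contraction. So the derivative of the metric can be put on either
argument. -/
theorem fibMetricDeriv_symm (w : E) (x y : Fib E) :
    fibInner g e z (fibMetricDeriv g e z (realFrame b) w x) y =
      fibInner g e z x (fibMetricDeriv g e z (realFrame b) w y) := by
  simp only [fibMetricDeriv, LinearMap.neg_apply, LinearMap.sum_apply, LinearMap.smul_apply,
    Module.End.mul_apply, map_neg, map_sum, map_smul, LinearMap.map_smulₛₗ, fibInner_fibExt hb,
    fibInner_fibInt hb, Complex.conj_ofReal]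
  rw [Finset.sum_comm]
  refine congrArg _ (Finset.sum_congr rfl fun a _ => Finset.sum_congr rfl fun c _ => ?_)
  simp only [HermitianMetric.metric_comm g e _ (realFrame b c) (realFrame b a)]

theorem fderiv_flux (u v : Forms E X) (θ : E →L[ℝ] ℂ) (w : E) :
    fderiv ℝ (flux g e u v θ) z w = (volDensity g e z : ℂ) *
      (traceDeriv g e z b w * fibInner g e z (fibExt θ (ev e z u)) (ev e z v) +
        fibInner g e z (fibExt θ (fibDeriv (fun z => ev e z u) z w)) (ev e z v) +
        fibInner g e z (fibExt θ (ev e z u)) (fibDeriv (fun z => ev e z v) z w) +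
        fibInner g e z (fibExt θ (ev e z u))
          (fibMetricDeriv g e z (realFrame b) w (ev e z v))) := by
  have hU := fibDiffAt_ev hz u
  have hV := fibDiffAt_ev hz v
  have h1 : DifferentiableAt ℝ (fun z => (volDensity g e z : ℂ)) z :=
    differentiableAt_of_contDiffOn hz
      (Complex.ofRealCLM.contDiff.comp_contDiffOn (contDiffOn_volDensity g e))
  have h2 := differentiableAt_fibInner g hz (hU.fibExt θ) hV
  have h3 : fderiv ℝ (fun z => (volDensity g e z : ℂ)) z w =
      traceDeriv g e z b w * (volDensity g e z : ℂ) := by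
    have h4 := (differentiableAt_of_contDiffOn hz (contDiffOn_volDensity g e)).hasFDerivAt
    have h5 := (Complex.ofRealCLM.hasFDerivAt.comp z h4).fderiv
    have h6 : fderiv ℝ (fun z => (volDensity g e z : ℂ)) z w =
        ((fderiv ℝ (volDensity g e) z w : ℝ) : ℂ) := DFunLike.congr_fun h5 w
    rw [h6, show fderiv ℝ (volDensity g e) z w = _ from fderiv_sqrt_det_gram g hz hb w,
      Complex.ofReal_mul]
    rfl
  have h7 : fderiv ℝ (flux g e u v θ) z w = _ := DFunLike.congr_fun
    (fderiv_fun_mul h1 h2) w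
  rw [h7]
  simp only [_root_.add_apply, _root_.smul_apply, smul_eq_mul]
  rw [h3, fderiv_fibInner g hz hb (hU.fibExt θ) hV, fibDeriv_fibExt hU,
    fibMetricDeriv_symm g hz hb]
  ring

/-- The adjoint of `∂̄` in an orthonormal frame. -/
def frameDelbarAdjoint (e : atlas E X) (z : E) (b : Module.Basis ι ℂ E) (v : Forms E X) : Fib E :=
  -((2 : ℂ) • ∑ a, annihilation b (Sum.inr a)
    (holPart (fibDeriv (fun z => ev e z v) z) (b a) +
      holPart (fibMetricDeriv g e z (realFrame b)) (b a) (ev e z v) +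
      holPart (traceDeriv g e z b) (b a) • ev e z v))

/-- The term in which u is differentiated is ⟨∂̄u, v⟩. In the others dz̄_a is moved to the second
argument as twice a contraction; that argument is antilinear, so the antilinear parts of the
derivatives become complex linear parts there. -/
theorem sum_antiPart_fderiv_flux (u v : Forms E X) :
    ∑ a, antiPart (fderiv ℝ (flux g e u v (dzBar b a)) z) (b a) =
      (volDensity g e z : ℂ) * (fibInner g e z (ev e z (delbar E X u)) (ev e z v) -
        fibInner g e z (ev e z u) (frameDelbarAdjoint g e z b v)) := by
  rw [ev_delbar b hz, frameDelbarAdjoint, map_sum, LinearMap.sum_apply, map_neg, map_smulₛₗ,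
    map_sum, sub_neg_eq_add, smul_eq_mul, Finset.mul_sum, ← Finset.sum_add_distrib, Finset.mul_sum]
  refine Finset.sum_congr rfl fun a _ => ?_
  have h1 : ∀ x y : Fib E, fibInner g e z x (annihilation b (Sum.inr a) y) =
      (1 / 2 : ℂ) * fibInner g e z (fibExt (dzBar b a) x) y := by
    intro x y
    have := fibInner_creation hb (Sum.inr a) x y
    rw [LinearMap.map_smulₛₗ, smul_eq_mul, map_ofNat] at this
    rw [show fibExt (dzBar b a) = creation b (Sum.inr a) from rfl, this]
    ring
  rw [h1, antiPart, fderiv_flux g hz hb, fderiv_flux g hz hb, show creation b (Sum.inr a) =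
    fibExt (dzBar b a) from rfl]
  simp only [antiPart, holPart, map_add, map_smul, map_sub, LinearMap.add_apply,
    LinearMap.smul_apply, LinearMap.sub_apply, LinearMap.map_smulₛₗ, smul_eq_mul, map_ofNat,
    map_div₀, map_one, Complex.conj_I, map_mul, traceDeriv, Complex.conj_ofReal]
  ring

end Frame

/-! ### Real (1,1)-forms and their symmetric forms in a complex frame. -/

section HermitianPair
variable {E : Type*} [NormedAddCommGroup E] [NormedSpace ℂ E] [FiniteDimensional ℂ E]

/-- A real 2-form `γ` of type `(1,1)` and the associated symmetric form `m(v,w) = γ(v, i w)`. -/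
structure HermitianPair (m : E → E → ℝ) (γ : Alt E 2) : Prop where
  form : ∀ v w, γ ![v, Complex.I • w] = (m v w : ℂ)
  symm : ∀ v w, m v w = m w v
  I_left : ∀ v w, m (Complex.I • v) w = -m v (Complex.I • w)

variable {ι : Type*} [Fintype ι] [DecidableEq ι] (b : Module.Basis ι ℂ E)

/-- The coefficients of a Hermitian form in a complex frame. -/
def hermCoeff (m : E → E → ℝ) (a c : ι) : ℂ :=
  (m (b a) (b c) : ℂ) + Complex.I * (m (b a) (Complex.I • b c) : ℂ)

theorem fibInt_frame (a : ι) :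
    fibInt (b a) = annihilation b (Sum.inl a) + annihilation b (Sum.inr a) := by
  simp only [annihilation, Sum.elim_inl, Sum.elim_inr]
  module

theorem fibInt_frame_I (a : ι) : fibInt (Complex.I • b a) =
    Complex.I • (annihilation b (Sum.inl a) - annihilation b (Sum.inr a)) := by
  simp only [annihilation, Sum.elim_inl, Sum.elim_inr]
  have : (Complex.I * -Complex.I) • fibInt (Complex.I • b a) = fibInt (Complex.I • b a) := by
    rw [mul_neg, Complex.I_mul_I, neg_neg, one_smul]
  conv_lhs => rw [← this]
  module

theorem fibExt_dual_zero (a : ι) : fibExt (dualCovector (realFrame b) (0, a)) =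
    (1 / 2 : ℂ) • (creation b (Sum.inl a) + creation b (Sum.inr a)) := by
  rw [dualCovector_realFrame_zero, map_smul, map_add]
  rfl

theorem fibExt_dual_one (a : ι) : fibExt (dualCovector (realFrame b) (1, a)) =
    (-Complex.I / 2 : ℂ) • (creation b (Sum.inl a) - creation b (Sum.inr a)) := by
  rw [dualCovector_realFrame_one, map_smul, map_sub]
  rfl

theorem fibWedge_two {μ : Type*} [Fintype μ] [DecidableEq μ] (f : Module.Basis μ ℝ E) (γ : Alt E 2) :
    fibWedge 2 γ = (1 / 2 : ℂ) • ∑ i, ∑ j, γ ![f i, f j] •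
      (fibExt (dualCovector f i) * fibExt (dualCovector f j)) := by
  have h1 : γ = (1 / 2 : ℂ) • ∑ i, altExt (dualCovector f i) 1 (altInt (f i) 1 γ) := by
    rw [sum_altExt_dual, smul_smul]
    norm_num
  have h2 : ∀ i, altInt (f i) 1 γ =
      ∑ j, altExt (dualCovector f j) 0 (altInt (f j) 0 (altInt (f i) 1 γ)) := by
    intro i
    rw [sum_altExt_dual]
    norm_num
  conv_lhs => rw [h1]
  rw [map_smul, map_sum]
  congr 1
  refine Finset.sum_congr rfl fun i _ => ?_
  rw [fibWedge_altExt]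
  conv_lhs => rw [h2 i, map_sum]
  rw [Finset.mul_sum]
  refine Finset.sum_congr rfl fun j _ => ?_
  rw [fibWedge_altExt, fibWedge_zero, mul_smul_comm, mul_smul_comm, mul_one]
  rfl

variable {m : E → E → ℝ} {γ : Alt E 2} (H : HermitianPair m γ)
include H

theorem HermitianPair.form' (v w : E) : γ ![v, w] = -(m v (Complex.I • w) : ℂ) := by
  have h1 := H.form v (Complex.I • w)
  rw [smul_smul, Complex.I_mul_I, neg_one_smul] at h1
  have h2 : altBilin γ v (-w) = -altBilin γ v w := map_neg _ _
  rw [← h1]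
  exact (neg_eq_iff_eq_neg.2 h2).symm

theorem HermitianPair.I_symm (v w : E) : m v (Complex.I • w) = -m w (Complex.I • v) := by
  rw [H.symm v, H.I_left]

theorem HermitianPair.I_sq (v w : E) : m v (Complex.I • Complex.I • w) = -m v w := by
  have h := H.form' v (Complex.I • w)
  rw [H.form] at h
  rw [← Complex.ofReal_inj, Complex.ofReal_neg, h, neg_neg]

theorem HermitianPair.I_I (v w : E) : m (Complex.I • v) (Complex.I • w) = m v w := by
  rw [H.I_left, H.I_sq, neg_neg]

theorem hermCoeff_conj (a c : ι) : starRingEnd ℂ (hermCoeff b m a c) = hermCoeff b m c a := by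
  rw [hermCoeff, hermCoeff, H.symm (b c) (b a), H.I_symm (b c) (b a)]
  simp

theorem fibWedge_hermitian : fibWedge 2 γ = (Complex.I / 2) • ∑ a, ∑ c,
    hermCoeff b m a c • (creation b (Sum.inl a) * creation b (Sum.inr c)) := by
  have hc : ∀ a c, creation b (Sum.inr a) * creation b (Sum.inl c) =
      -(creation b (Sum.inl c) * creation b (Sum.inr a)) := fun a c => (car_frame b).ee _ _
  -- The block of real indices over (a,c) yields the coefficient terms of (a,c) and of (c,a). In the
  -- double sum each term therefore occurs twice, which cancels the factor 1/2 of `fibWedge_two`.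
  have h1 : ∀ a c : ι, ∑ i : Fin 2, ∑ j : Fin 2,
      γ ![realFrame b (i, a), realFrame b (j, c)] •
        (fibExt (dualCovector (realFrame b) (i, a)) * fibExt (dualCovector (realFrame b) (j, c))) =
      (Complex.I / 2) • (hermCoeff b m a c • (creation b (Sum.inl a) * creation b (Sum.inr c)) +
        hermCoeff b m c a • (creation b (Sum.inl c) * creation b (Sum.inr a))) := by
    intro a c
    simp only [Fin.sum_univ_two, realFrame_zero, realFrame_one, fibExt_dual_zero, fibExt_dual_one,
      H.form, H.form', H.I_I, H.I_sq, hermCoeff, H.symm (b c) (b a), H.I_symm (b c) (b a), H.I_left,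
      smul_mul_assoc, mul_smul_comm, mul_add, add_mul, mul_sub, sub_mul, hc, Complex.ofReal_neg]
    match_scalars <;> ring_nf <;> simp only [Complex.I_sq] <;> ring
  rw [fibWedge_two (realFrame b)]
  have h2 : ∑ i, ∑ j, γ ![realFrame b i, realFrame b j] •
      (fibExt (dualCovector (realFrame b) i) * fibExt (dualCovector (realFrame b) j)) =
      ∑ a, ∑ c, ∑ i : Fin 2, ∑ j : Fin 2, γ ![realFrame b (i, a), realFrame b (j, c)] •
        (fibExt (dualCovector (realFrame b) (i, a)) *
          fibExt (dualCovector (realFrame b) (j, c))) := by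
    simp only [Fintype.sum_prod_type, Fin.sum_univ_two, Finset.sum_add_distrib]
  rw [h2]
  simp only [h1, ← Finset.smul_sum, Finset.sum_add_distrib]
  rw [Finset.sum_comm (f := fun a c => hermCoeff b m c a • _)]
  module

/-- Invariance of m under the complex structure removes the terms that would exchange dz and dz̄, so
the endomorphism preserves types. The coefficients on the dz̄ are those on the dz transposed. -/
theorem metric_endomorphism_frame : ∑ a, ∑ c, (m (realFrame b a) (realFrame b c) : ℂ) •
      (fibExt (dualCovector (realFrame b) c) * fibInt (realFrame b a)) =
    ∑ a, ∑ c, (hermCoeff b m c a • (creation b (Sum.inl c) * annihilation b (Sum.inl a)) +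
      hermCoeff b m a c • (creation b (Sum.inr c) * annihilation b (Sum.inr a))) := by
  have h2 : ∑ i, ∑ j, (m (realFrame b i) (realFrame b j) : ℂ) •
      (fibExt (dualCovector (realFrame b) j) * fibInt (realFrame b i)) =
      ∑ a, ∑ c, ∑ i : Fin 2, ∑ j : Fin 2, (m (realFrame b (i, a)) (realFrame b (j, c)) : ℂ) •
        (fibExt (dualCovector (realFrame b) (j, c)) * fibInt (realFrame b (i, a))) := by
    simp only [Fintype.sum_prod_type, Fin.sum_univ_two, Finset.sum_add_distrib]
  rw [h2]
  refine Finset.sum_congr rfl fun a _ => Finset.sum_congr rfl fun c _ => ?_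
  simp only [Fin.sum_univ_two, realFrame_zero, realFrame_one, fibExt_dual_zero, fibExt_dual_one,
    fibInt_frame, fibInt_frame_I, H.I_I, hermCoeff, H.symm (b c) (b a), H.I_symm (b c) (b a),
    H.I_left, smul_mul_assoc, mul_smul_comm, mul_add, add_mul, mul_sub, sub_mul, Complex.ofReal_neg]
  match_scalars <;> ring_nf <;> simp only [Complex.I_sq] <;> ring

/-- The vectors b_a and i b_a contribute equally, which absorbs the factor 1/2, and m(b_a, i b_a)
vanishes by antisymmetry. -/
theorem trace_frame : ((1 / 2 * ∑ a, m (realFrame b a) (realFrame b a) : ℝ) : ℂ) =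
    ∑ a, hermCoeff b m a a := by
  have h : ∀ a, m (b a) (Complex.I • b a) = 0 := fun a => by
    have := H.I_symm (b a) (b a)
    linarith
  simp only [Fintype.sum_prod_type, Fin.sum_univ_two, realFrame_zero, realFrame_one, H.I_I,
    hermCoeff, h]
  push_cast
  simp only [mul_zero, add_zero]
  ring

end HermitianPair

/-! ### The metric and its derivative as Hermitian forms. -/

section MetricPair
variable {E X : Type*} [NormedAddCommGroup E] [NormedSpace ℂ E] [FiniteDimensional ℂ E]
  [TopologicalSpace X] [ChartedSpace E X] (g : HermitianMetric E X) {e : atlas E X} {z : E}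

theorem hermitianPair_metric (e : atlas E X) (z : E) :
    HermitianPair (g.metric e z) (g.form.1 e z) where
  form v w := HermitianMetric.form_eq_re g e z v (Complex.I • w)
  symm := HermitianMetric.metric_comm g e z
  I_left := HermitianMetric.metric_I_smul_left g e z

/-- The derivative of the metric. -/
def metricFderiv (e : atlas E X) (z w : E) (x y : E) : ℝ :=
  fderiv ℝ (fun z => g.metric e z x y) z w

/-- The defining conditions are linear and the complex structure is constant in the chart, so they
survive differentiation. Hence the metric and its derivative are treated by the same algebra. -/
theorem hermitianPair_fderiv (hz : z ∈ e.1.target) (w : E) :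
    HermitianPair (metricFderiv g e z w) (fderiv ℝ (g.form.1 e) z w) where
  form x y := by
    have h1 : DifferentiableAt ℝ (g.form.1 e) z :=
      differentiableAt_of_contDiffOn hz (g.form.2.2.1 e)
    have h2 := ((altEval ![x, Complex.I • y]).hasFDerivAt.comp z h1.hasFDerivAt).fderiv
    have h3 : (fun z => altEval ![x, Complex.I • y] (g.form.1 e z)) =
        fun z => (g.metric e z x y : ℂ) := funext fun z => (hermitianPair_metric g e z).form x y
    have h4 := (differentiableAt_of_contDiffOn hz (contDiffOn_metric g e x y)).hasFDerivAt
    have h5 := (Complex.ofRealCLM.hasFDerivAt.comp z h4).fderiv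
    have h6 : fderiv ℝ (fun z => (g.metric e z x y : ℂ)) z w = (metricFderiv g e z w x y : ℂ) :=
      DFunLike.congr_fun h5 w
    rw [← h6, ← h3]
    exact (DFunLike.congr_fun h2 w).symm
  symm x y := by
    simp only [metricFderiv, HermitianMetric.metric_comm g e _ x y]
  I_left x y := by
    simp only [metricFderiv, HermitianMetric.metric_I_smul_left g e]
    rw [fderiv_fun_neg]
    rfl

variable {ι : Type*} [Fintype ι] [DecidableEq ι] {b : Module.Basis ι ℂ E}

/-- The derivatives of the coefficients of the metric. -/
def coeffDeriv (e : atlas E X) (z : E) (b : Module.Basis ι ℂ E) (w : E) (a c : ι) : ℂ :=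
  hermCoeff b (metricFderiv g e z w) a c

theorem coeffDeriv_conj (hz : z ∈ e.1.target) (w : E) (a c : ι) :
    starRingEnd ℂ (coeffDeriv g e z b w a c) = coeffDeriv g e z b w c a :=
  hermCoeff_conj b (hermitianPair_fderiv g hz w) a c

theorem fibMetricDeriv_frame (hz : z ∈ e.1.target) (w : E) :
    fibMetricDeriv g e z (realFrame b) w = -∑ a, ∑ c,
      (coeffDeriv g e z b w c a • (creation b (Sum.inl c) * annihilation b (Sum.inl a)) +
        coeffDeriv g e z b w a c • (creation b (Sum.inr c) * annihilation b (Sum.inr a))) := by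
  have h := metric_endomorphism_frame b (hermitianPair_fderiv g hz w)
  simp only [metricFderiv] at h
  rw [fibMetricDeriv, h]
  rfl

theorem traceDeriv_frame (hz : z ∈ e.1.target) (w : E) :
    traceDeriv g e z b w = ∑ a, coeffDeriv g e z b w a a :=
  trace_frame b (hermitianPair_fderiv g hz w)

theorem fibWedge_fderiv_form (hz : z ∈ e.1.target) (w : E) :
    fibWedge 2 (fderiv ℝ (g.form.1 e) z w) = (Complex.I / 2) • ∑ a, ∑ c,
      coeffDeriv g e z b w a c • (creation b (Sum.inl a) * creation b (Sum.inr c)) := by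
  rw [fibWedge_hermitian b (hermitianPair_fderiv g hz w)]
  rfl

theorem hermCoeff_metric (hb : g.IsOrthonormal e z (realFrame b)) (a c : ι) :
    hermCoeff b (g.metric e z) a c = if a = c then 1 else 0 := by
  have h1 := hb (0, a) (0, c)
  have h2 := hb (0, a) (1, c)
  rw [realFrame_zero, realFrame_zero] at h1
  rw [realFrame_zero, realFrame_one] at h2
  rw [hermCoeff, h1, h2]
  by_cases h : a = c <;> simp [h]

theorem fibWedge_form (hb : g.IsOrthonormal e z (realFrame b)) : fibWedge 2 (g.form.1 e z) =
    (Complex.I / 2) • ∑ a, creation b (Sum.inl a) * creation b (Sum.inr a) := by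
  rw [fibWedge_hermitian b (hermitianPair_metric g e z)]
  simp only [hermCoeff_metric g hb, ite_smul, one_smul, zero_smul, Finset.sum_ite_eq,
    Finset.mem_univ, if_true]

end MetricPair

/-! ### The Kähler identity with torsion in the algebra of anticommutation relations. -/

namespace CAR
variable {ι R : Type*} [Fintype ι] [DecidableEq ι] [Ring R] [Algebra ℂ R] {e i : ι ⊕ ι → R}

/-- The adjoint Lefschetz operator in a unitary frame. -/
def lam (i : ι ⊕ ι → R) : R := (-2 * Complex.I) • ∑ a, i (Sum.inr a) * i (Sum.inl a)

/-- The Lefschetz operator in a unitary frame. -/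
def lef (e : ι ⊕ ι → R) : R := (Complex.I / 2) • ∑ a, e (Sum.inl a) * e (Sum.inr a)

variable (H : CAR e i)
include H

theorem ie_assoc (a b : ι ⊕ ι) (x : R) :
    i a * (e b * x) = (if a = b then x else 0) - e b * (i a * x) := by
  rw [← mul_assoc, H.ie, sub_mul, ite_mul, one_mul, zero_mul, mul_assoc]

theorem ii_lr (a b : ι) : i (Sum.inl a) * i (Sum.inr b) = -(i (Sum.inr b) * i (Sum.inl a)) := H.ii _ _

theorem ii_lr_assoc (a b : ι) (x : R) :
    i (Sum.inl a) * (i (Sum.inr b) * x) = -(i (Sum.inr b) * (i (Sum.inl a) * x)) := by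
  rw [← mul_assoc, H.ii_lr, neg_mul, mul_assoc]

/-- Every quadratic term of Λ commutes with dz_c except the one that contains the contraction with
∂/∂z_c. This and `lam_mul_inr` are the symbols of the Kähler identities. -/
theorem lam_mul_inl (c : ι) : lam i * e (Sum.inl c) - e (Sum.inl c) * lam i =
    (-2 * Complex.I) • i (Sum.inr c) := by
  rw [lam, smul_mul_assoc, mul_smul_comm, ← smul_sub, Finset.sum_mul, Finset.mul_sum,
    ← Finset.sum_sub_distrib]
  congr 1
  have h : ∀ a, i (Sum.inr a) * i (Sum.inl a) * e (Sum.inl c) -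
      e (Sum.inl c) * (i (Sum.inr a) * i (Sum.inl a)) = if a = c then i (Sum.inr a) else 0 := by
    intro a
    by_cases hac : a = c <;>
    simp [mul_assoc, H.ie, H.ie_assoc, mul_sub, hac]
  simp [h]

theorem lam_mul_inr (c : ι) : lam i * e (Sum.inr c) - e (Sum.inr c) * lam i =
    (2 * Complex.I) • i (Sum.inl c) := by
  rw [lam, smul_mul_assoc, mul_smul_comm, ← smul_sub, Finset.sum_mul, Finset.mul_sum,
    ← Finset.sum_sub_distrib]
  have h : ∀ a, i (Sum.inr a) * i (Sum.inl a) * e (Sum.inr c) -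
      e (Sum.inr c) * (i (Sum.inr a) * i (Sum.inl a)) = if a = c then -i (Sum.inl a) else 0 := by
    intro a
    by_cases hac : a = c <;>
    simp [mul_assoc, H.ie, H.ie_assoc, mul_sub, hac]
  simp [h]

theorem lam_mul_num_inl (d a : ι) : lam i * (e (Sum.inl d) * i (Sum.inl a)) -
    e (Sum.inl d) * i (Sum.inl a) * lam i = (-2 * Complex.I) • (i (Sum.inr d) * i (Sum.inl a)) := by
  have h1 : i (Sum.inl a) * lam i = lam i * i (Sum.inl a) := by
    rw [lam, smul_mul_assoc, mul_smul_comm, Finset.sum_mul, Finset.mul_sum]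
    congr 1
    refine Finset.sum_congr rfl fun x _ => ?_
    rw [H.ii_lr_assoc, H.ii (Sum.inl a) (Sum.inl x), mul_neg, neg_neg, mul_assoc]
  rw [mul_assoc (e _), h1, ← mul_assoc, ← mul_assoc, ← sub_mul, H.lam_mul_inl, smul_mul_assoc]

theorem lam_mul_num_inr (d a : ι) : lam i * (e (Sum.inr d) * i (Sum.inr a)) -
    e (Sum.inr d) * i (Sum.inr a) * lam i = (-2 * Complex.I) • (i (Sum.inr a) * i (Sum.inl d)) := by
  have h1 : i (Sum.inr a) * lam i = lam i * i (Sum.inr a) := by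
    rw [lam, smul_mul_assoc, mul_smul_comm, Finset.sum_mul, Finset.mul_sum]
    congr 1
    refine Finset.sum_congr rfl fun x _ => ?_
    rw [mul_assoc, H.ii_lr, ← mul_assoc, H.ii (Sum.inr a), mul_neg, neg_mul, mul_assoc]
  rw [mul_assoc (e _), h1, ← mul_assoc, ← mul_assoc, ← sub_mul, H.lam_mul_inr, smul_mul_assoc,
    H.ii_lr]
  module

/-- Applying the commutators with dz_c and dz̄_c in turn leaves, for each c, one minus two number
operators. The unit terms add up to the dimension. -/
theorem lam_mul_lef : lam i * lef e - lef e * lam i =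
    (Fintype.card ι : ℂ) • (1 : R) - ∑ a, e (Sum.inl a) * i (Sum.inl a) -
      ∑ a, e (Sum.inr a) * i (Sum.inr a) := by
  have h : ∀ c, lam i * (e (Sum.inl c) * e (Sum.inr c)) - e (Sum.inl c) * e (Sum.inr c) * lam i =
      (-2 * Complex.I) • (1 - e (Sum.inl c) * i (Sum.inl c) - e (Sum.inr c) * i (Sum.inr c)) := by
    intro c
    have h1 := H.lam_mul_inl c
    have h2 := H.lam_mul_inr c
    rw [sub_eq_iff_eq_add] at h1 h2
    rw [← mul_assoc, h1, add_mul, mul_assoc (e _) (lam i), h2, smul_mul_assoc, H.ie, mul_add,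
      mul_smul_comm, mul_assoc]
    simp only [if_true]
    module
  rw [lef, smul_mul_assoc, mul_smul_comm, ← smul_sub, Finset.sum_mul, Finset.mul_sum,
    ← Finset.sum_sub_distrib]
  simp only [h]
  rw [← Finset.smul_sum, smul_smul, Finset.sum_sub_distrib, Finset.sum_sub_distrib]
  rw [show Complex.I / 2 * (-2 * Complex.I) = 1 by linear_combination -Complex.I_mul_I, one_smul]
  simp [Algebra.smul_def]

theorem inl_mul_lef (a : ι) : i (Sum.inl a) * lef e =
    lef e * i (Sum.inl a) + (Complex.I / 2) • e (Sum.inr a) := by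
  have h : ∀ x, i (Sum.inl a) * (e (Sum.inl x) * e (Sum.inr x)) =
      e (Sum.inl x) * e (Sum.inr x) * i (Sum.inl a) + if x = a then e (Sum.inr x) else 0 := by
    intro x
    rw [H.ie_assoc, H.ie, if_neg (by simp : Sum.inl a ≠ Sum.inr x), zero_sub, mul_neg,
      sub_neg_eq_add, mul_assoc, add_comm]
    simp [eq_comm]
  rw [lef, smul_mul_assoc, mul_smul_comm, ← smul_add, Finset.sum_mul, Finset.mul_sum]
  simp only [h, Finset.sum_add_distrib, Finset.sum_ite_eq', Finset.mem_univ, if_true]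

theorem inr_mul_lef (a : ι) : i (Sum.inr a) * lef e =
    lef e * i (Sum.inr a) - (Complex.I / 2) • e (Sum.inl a) := by
  have h : ∀ x, i (Sum.inr a) * (e (Sum.inl x) * e (Sum.inr x)) =
      e (Sum.inl x) * e (Sum.inr x) * i (Sum.inr a) - if x = a then e (Sum.inl x) else 0 := by
    intro x
    rw [H.ie_assoc, H.ie, if_neg (by simp), zero_sub, mul_sub, mul_assoc, mul_ite, mul_one,
      mul_zero, neg_sub]
    simp [eq_comm]
  rw [lef, smul_mul_assoc, mul_smul_comm, ← smul_sub, Finset.sum_mul, Finset.mul_sum]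
  simp only [h, Finset.sum_sub_distrib, Finset.sum_ite_eq', Finset.mem_univ, if_true]

theorem comm_lef (d a c : ι) : i (Sum.inr d) * i (Sum.inl a) * i (Sum.inr c) * lef e -
      lef e * (i (Sum.inr d) * i (Sum.inl a) * i (Sum.inr c)) =
    (Complex.I / 2) • (i (Sum.inr d) * e (Sum.inr a) * i (Sum.inr c) -
      i (Sum.inr d) * i (Sum.inl a) * e (Sum.inl c) -
      e (Sum.inl d) * i (Sum.inl a) * i (Sum.inr c)) := by
  rw [mul_assoc _ _ (lef e), H.inr_mul_lef, mul_sub, ← mul_assoc _ (lef e), mul_assoc _ _ (lef e),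
    H.inl_mul_lef, mul_add, ← mul_assoc _ (lef e), H.inr_mul_lef]
  simp only [mul_smul_comm, add_mul, sub_mul, smul_mul_assoc, mul_assoc]
  module

/-- The identity for the coefficient of one derivative K c d a, shown by bringing both sides into
the order with creation operators on the left. The indices c and d play different roles: no Kähler
symmetry between them is assumed. -/
theorem kahler_term (c d a : ι) :
    i (Sum.inr c) * (e (Sum.inl d) * i (Sum.inl a)) + i (Sum.inr c) * (e (Sum.inr a) * i (Sum.inr d)) -
      (if d = a then i (Sum.inr c) else 0) =
    -(e (Sum.inl c) * (i (Sum.inr d) * i (Sum.inl a))) -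
      (i (Sum.inr d) * e (Sum.inr a) * i (Sum.inr c) -
      i (Sum.inr d) * i (Sum.inl a) * e (Sum.inl c) -
      e (Sum.inl d) * i (Sum.inl a) * i (Sum.inr c)) := by
  have h1 : i (Sum.inr c) * (e (Sum.inl d) * i (Sum.inl a)) =
      e (Sum.inl d) * i (Sum.inl a) * i (Sum.inr c) := by
    rw [H.ie_assoc, if_neg (by simp), zero_sub, mul_assoc, H.ii_lr, mul_neg]
  have h2 : i (Sum.inr d) * i (Sum.inl a) * e (Sum.inl c) =
      (if c = a then i (Sum.inr d) else 0) + e (Sum.inl c) * (i (Sum.inr d) * i (Sum.inl a)) := by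
    rw [mul_assoc, H.ie, mul_sub, H.ie_assoc, mul_ite, mul_one, mul_zero]
    simp [eq_comm]
  have h3 : ∀ c d, i (Sum.inr c) * (e (Sum.inr a) * i (Sum.inr d)) =
      (if c = a then i (Sum.inr d) else 0) - e (Sum.inr a) * (i (Sum.inr c) * i (Sum.inr d)) := by
    intro c d
    rw [H.ie_assoc]
    simp
  rw [h1, h2, h3, mul_assoc (i (Sum.inr d)), h3, H.ii (Sum.inr d) (Sum.inr c), mul_neg]
  abel

/-- The algebraic identity between the torsion of a Hermitian metric and the derivatives of the
adjoint Lefschetz operator, of the metric on forms, and of the volume. -/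
theorem kahler_identity (K : ι → ι → ι → ℂ) (S M : ι → R)
    (hS : ∀ c, S c = -∑ a, ∑ d, (K c d a • (e (Sum.inl d) * i (Sum.inl a)) +
      K c a d • (e (Sum.inr d) * i (Sum.inr a))))
    (hM : ∀ c, M c = ((-2 * Complex.I) • ∑ a, ∑ d, K c d a • (i (Sum.inr d) * i (Sum.inl a))) +
      lam i * S c - S c * lam i) :
    -((2 : ℂ) • ∑ c, i (Sum.inr c) * (S c + (∑ a, K c a a) • 1)) =
      Complex.I • (∑ c, e (Sum.inl c) * M c) -
        (((-4 * Complex.I) • ∑ c, ∑ a, ∑ d,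
            K c d a • (i (Sum.inr d) * i (Sum.inl a) * i (Sum.inr c))) * lef e -
          lef e * ((-4 * Complex.I) • ∑ c, ∑ a, ∑ d,
            K c d a • (i (Sum.inr d) * i (Sum.inl a) * i (Sum.inr c)))) := by
  -- The derivative of ω gives -2i. The commutator of Λ with S gives 2i from the dz part and, after
  -- renaming a and d, another 2i from the dz̄ part; in total 2i.
  have hM' : ∀ c, M c = (2 * Complex.I) • ∑ a, ∑ d, K c d a • (i (Sum.inr d) * i (Sum.inl a)) := by
    intro c
    have h1 : lam i * S c - S c * lam i =
        (4 * Complex.I) • ∑ a, ∑ d, K c d a • (i (Sum.inr d) * i (Sum.inl a)) := by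
      have h2 : lam i * S c - S c * lam i = (2 * Complex.I) • ∑ a, ∑ d,
          (K c d a • (i (Sum.inr d) * i (Sum.inl a)) +
            K c a d • (i (Sum.inr a) * i (Sum.inl d))) := by
        rw [hS, mul_neg, neg_mul, neg_sub_neg, Finset.mul_sum, Finset.sum_mul,
          ← Finset.sum_sub_distrib, Finset.smul_sum]
        refine Finset.sum_congr rfl fun a _ => ?_
        rw [Finset.mul_sum, Finset.sum_mul, ← Finset.sum_sub_distrib, Finset.smul_sum]
        refine Finset.sum_congr rfl fun d _ => ?_
        have h3 := H.lam_mul_num_inl d a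
        have h4 := H.lam_mul_num_inr d a
        rw [sub_eq_iff_eq_add] at h3 h4
        rw [mul_add, add_mul, mul_smul_comm, mul_smul_comm, smul_mul_assoc, smul_mul_assoc, h3, h4]
        module
      rw [h2]
      simp only [Finset.sum_add_distrib]
      rw [Finset.sum_comm (f := fun a d => K c a d • _)]
      module
    rw [hM, add_sub_assoc, h1]
    module
  have hR : ((-4 * Complex.I) • ∑ c, ∑ a, ∑ d,
      K c d a • (i (Sum.inr d) * i (Sum.inl a) * i (Sum.inr c))) * lef e -
      lef e * ((-4 * Complex.I) • ∑ c, ∑ a, ∑ d,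
        K c d a • (i (Sum.inr d) * i (Sum.inl a) * i (Sum.inr c))) =
      (2 : ℂ) • ∑ c, ∑ a, ∑ d, K c d a • (i (Sum.inr d) * e (Sum.inr a) * i (Sum.inr c) -
      i (Sum.inr d) * i (Sum.inl a) * e (Sum.inl c) -
      e (Sum.inl d) * i (Sum.inl a) * i (Sum.inr c)) := by
    simp only [Finset.smul_sum, Finset.mul_sum, Finset.sum_mul, ← Finset.sum_sub_distrib]
    refine Finset.sum_congr rfl fun c _ => Finset.sum_congr rfl fun a _ =>
      Finset.sum_congr rfl fun d _ => ?_
    simp only [smul_mul_assoc, mul_smul_comm, ← smul_sub, H.comm_lef]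
    match_scalars <;> (ring_nf; simp only [Complex.I_sq]; ring)
  -- The trace from the volume density is written as a double sum with a Kronecker delta, so that
  -- all terms have a common coefficient K c d a.
  have hL : ∀ c, i (Sum.inr c) * (S c + (∑ a, K c a a) • 1) =
      -∑ a, ∑ d, K c d a • (i (Sum.inr c) * (e (Sum.inl d) * i (Sum.inl a)) +
        i (Sum.inr c) * (e (Sum.inr a) * i (Sum.inr d)) - (if d = a then i (Sum.inr c) else 0)) := by
    intro c
    rw [hS]
    simp only [smul_sub, smul_add, smul_ite, smul_zero, Finset.sum_sub_distrib, Finset.sum_add_distrib,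
      Finset.sum_ite_eq', Finset.mem_univ, if_true, mul_add, mul_neg, Finset.mul_sum, mul_smul_comm,
      mul_one, Finset.sum_smul]
    rw [Finset.sum_comm (f := fun a d => K c a d • _)]
    abel
  rw [hR]
  simp only [hL, hM', H.kahler_term]
  simp only [Finset.smul_sum, Finset.mul_sum, ← Finset.sum_sub_distrib, ← Finset.sum_neg_distrib]
  refine Finset.sum_congr rfl fun c _ => Finset.sum_congr rfl fun a _ =>
    Finset.sum_congr rfl fun d _ => ?_
  simp only [mul_smul_comm]
  match_scalars <;> (ring_nf; try simp only [Complex.I_sq]; try ring)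

end CAR

/-! ### Rules for complex linear and antilinear parts. -/

section Parts
variable {E : Type*} [NormedAddCommGroup E] [NormedSpace ℂ E] [FiniteDimensional ℂ E] {M N : Type*} [AddCommGroup M]
  [Module ℂ M] [AddCommGroup N] [Module ℂ N]

theorem holPart_add (F G : E → M) (v : E) :
    holPart (fun w => F w + G w) v = holPart F v + holPart G v := by
  simp only [holPart]; module

theorem holPart_sum {ι : Type*} (s : Finset ι) (F : ι → E → M) (v : E) :
    holPart (fun w => ∑ i ∈ s, F i w) v = ∑ i ∈ s, holPart (F i) v := by
  simp only [holPart, Finset.smul_sum, ← Finset.sum_sub_distrib]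

theorem holPart_sub (F G : E → M) (v : E) :
    holPart (fun w => F w - G w) v = holPart F v - holPart G v := by
  simp only [holPart]; module

theorem holPart_const_smul (c : ℂ) (F : E → M) (v : E) :
    holPart (fun w => c • F w) v = c • holPart F v := by
  simp only [holPart]; module

theorem antiPart_const_smul (c : ℂ) (F : E → M) (v : E) :
    antiPart (fun w => c • F w) v = c • antiPart F v := by
  simp only [antiPart]; module

theorem holPart_const_mul (A : Module.End ℂ M) (F : E → Module.End ℂ M) (v : E) :
    holPart (fun w => A * F w) v = A * holPart F v :=
  holPart_map (LinearMap.mulLeft ℂ A) F v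

theorem holPart_mul_const (A : Module.End ℂ M) (F : E → Module.End ℂ M) (v : E) :
    holPart (fun w => F w * A) v = holPart F v * A :=
  holPart_map (LinearMap.mulRight ℂ A) F v

theorem holPart_apply (T : E → Module.End ℂ M) (x : M) (v : E) :
    holPart (fun w => T w x) v = holPart T v x :=
  holPart_map (LinearMap.applyₗ x) T v

theorem holPart_smul_const (f : E → ℂ) (x : M) (v : E) :
    holPart (fun w => f w • x) v = holPart f v • x := by
  simp only [holPart, smul_eq_mul]; module

theorem antiPart_sum {ι : Type*} (s : Finset ι) (F : ι → E → M) (v : E) :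
    antiPart (fun w => ∑ i ∈ s, F i w) v = ∑ i ∈ s, antiPart (F i) v := by
  simp only [antiPart, Finset.smul_sum, ← Finset.sum_add_distrib]

theorem antiPart_smul_const (f : E → ℂ) (x : M) (v : E) :
    antiPart (fun w => f w • x) v = antiPart f v • x := by
  simp only [antiPart, smul_eq_mul]; module

theorem conj_antiPart (f : E → ℂ) (v : E) :
    starRingEnd ℂ (antiPart f v) = holPart (fun w => starRingEnd ℂ (f w)) v := by
  simp only [antiPart, holPart, smul_eq_mul, map_mul, map_add, map_div₀, map_one, map_ofNat,
    Complex.conj_I]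
  ring

end Parts

/-! ### The adjoints of ω and ∂̄ω in a unitary frame, and the commutation relation for ∂̄. -/

section WedgeAdjoint
variable {E X : Type*} [NormedAddCommGroup E] [NormedSpace ℂ E] [FiniteDimensional ℂ E]
  [TopologicalSpace X] [ChartedSpace E X] [IsManifold 𝓘(ℂ, E) ∞ X] (g : HermitianMetric E X)

/-- The pointwise adjoint of the wedge multiplication by a form. -/
def wedgeAdj {m : ℕ} (γ : DiffForm E X m) : Module.End ℂ (Forms E X) :=
  (exists_wedge_adjoint g γ).choose

variable {g} {e : atlas E X} {z : E} (hz : z ∈ e.1.target)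
include hz

theorem fibInner_wedgeAdj {m : ℕ} (γ : DiffForm E X m) (α : Fib E) (u : Forms E X) :
    fibInner g e z (fibWedge m (γ.1 e z) α) (ev e z u) =
      fibInner g e z α (ev e z (wedgeAdj g γ u)) :=
  (exists_wedge_adjoint g γ).choose_spec e z hz α u

variable {ι : Type*} [Fintype ι] [DecidableEq ι]
  {b : Module.Basis ι ℂ E} (hb : g.IsOrthonormal e z (realFrame b))
include hb

omit hz in
theorem fibInner_creation_creation (a c : ι) (u v : Fib E) :
    fibInner g e z ((creation b (Sum.inl a) * creation b (Sum.inr c)) u) v =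
      4 * fibInner g e z u ((annihilation b (Sum.inr c) * annihilation b (Sum.inl a)) v) := by
  rw [Module.End.mul_apply, Module.End.mul_apply, fibInner_creation hb, fibInner_creation hb]
  simp only [Module.End.mul_apply, map_smul, LinearMap.map_smulₛₗ, smul_eq_mul, map_ofNat]
  ring

omit hz in
theorem fibInner_two_form (k : ι → ι → ℂ) (u v : Fib E) :
    fibInner g e z (((Complex.I / 2) • ∑ a, ∑ c,
        k a c • (creation b (Sum.inl a) * creation b (Sum.inr c))) u) v =
      fibInner g e z u (((-2 * Complex.I) • ∑ a, ∑ c, starRingEnd ℂ (k a c) •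
        (annihilation b (Sum.inr c) * annihilation b (Sum.inl a))) v) := by
  simp only [LinearMap.smul_apply, LinearMap.sum_apply, map_smul, map_sum, LinearMap.map_smulₛₗ, smul_eq_mul,
    fibInner_creation_creation hb, Complex.conj_conj, Finset.mul_sum]
  refine Finset.sum_congr rfl fun a _ => Finset.sum_congr rfl fun c _ => ?_
  simp only [map_mul, map_neg, map_ofNat, Complex.conj_I]
  ring

/-- The constant in `CAR.lam` is the conjugate of i/2 times the factor 4 from two adjoints of
creation operators. -/
theorem ev_wedgeAdj_form (u : Forms E X) :
    ev e z (wedgeAdj g g.form u) = CAR.lam (annihilation b) (ev e z u) := by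
  refine fibInner_left_injective (g := g) hz fun v => ?_
  rw [← fibInner_wedgeAdj hz, fibWedge_form g hb]
  have h := fibInner_two_form hb (fun a c : ι => if a = c then (1 : ℂ) else 0) v (ev e z u)
  simp only [apply_ite (starRingEnd ℂ), map_one, map_zero, ite_smul, one_smul, zero_smul,
    Finset.sum_ite_eq, Finset.mem_univ, if_true] at h
  exact h

/-- The derivative of the operator `Λ` in a unitary frame. -/
theorem fibDeriv_wedgeAdj_form (u : Forms E X) (w : E) :
    fibDeriv (fun z => ev e z (wedgeAdj g g.form u)) z w =
      CAR.lam (annihilation b) (fibDeriv (fun z => ev e z u) z w) +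
      (((-2 * Complex.I) • ∑ a, ∑ d, coeffDeriv g e z b w d a •
        (annihilation b (Sum.inr d) * annihilation b (Sum.inl a))) +
        CAR.lam (annihilation b) * fibMetricDeriv g e z (realFrame b) w -
        fibMetricDeriv g e z (realFrame b) w * CAR.lam (annihilation b)) (ev e z u) := by
  refine fibInner_left_injective (g := g) hz fun α => ?_
  have hlef : ∀ x y, fibInner g e z (fibWedge 2 (g.form.1 e z) x) y =
      fibInner g e z x (CAR.lam (annihilation b) y) := by
    intro x y
    rw [fibWedge_form g hb]
    have h := fibInner_two_form hb (fun a c : ι => if a = c then (1 : ℂ) else 0) x y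
    simp only [apply_ite (starRingEnd ℂ), map_one, map_zero, ite_smul, one_smul, zero_smul,
      Finset.sum_ite_eq, Finset.mem_univ, if_true] at h
    exact h
  have hω : DifferentiableAt ℝ (g.form.1 e) z := differentiableAt_of_contDiffOn hz (g.form.2.2.1 e)
  let T : ∀ k, Alt E 2 →ₗ[ℂ] Alt E k := fun k =>
    { toFun := fun γ => fibWedge 2 γ α k
      map_add' := fun γ γ' => by rw [map_add]; rfl
      map_smul' := fun c γ => by rw [map_smul]; rfl }
  have hU : FibDiffAt (fun z => fibWedge 2 (g.form.1 e z) α) z := fun k =>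
    alt_linear_differentiableAt (T k) hω
  have hU' : fibDeriv (fun z => fibWedge 2 (g.form.1 e z) α) z w =
      fibWedge 2 (fderiv ℝ (g.form.1 e) z w) α := Fib.ext fun k => alt_linear_fderiv (T k) hω w
  have hc : FibDiffAt (fun _ => α) z := fun k => differentiableAt_const _
  have hc' : fibDeriv (fun _ => α) z w = 0 := Fib.ext fun k => by
    rw [fibDeriv_apply]; simp
  -- The relation ⟨ω ∧ α, u⟩ = ⟨α, Λu⟩ with α constant is differentiated in a neighbourhood. The
  -- derivative of the metric appears on both sides, which produces its commutator with Λ.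
  have h1 : (fun z => fibInner g e z (fibWedge 2 (g.form.1 e z) α) (ev e z u)) =ᶠ[nhds z]
      fun z => fibInner g e z α (ev e z (wedgeAdj g g.form u)) :=
    Filter.eventually_of_mem (e.1.open_target.mem_nhds hz) fun z hz => fibInner_wedgeAdj hz _ _ _
  have h2 := congrArg (fun T => T w) (h1.fderiv_eq (𝕜 := ℝ))
  beta_reduce at h2
  rw [fderiv_fibInner g hz hb hU (fibDiffAt_ev hz u), fderiv_fibInner g hz hb hc
    (fibDiffAt_ev hz _), hU', hc', map_zero, LinearMap.zero_apply, zero_add,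
    fibMetricDeriv_symm g hz hb, hlef, hlef, fibMetricDeriv_symm g hz hb, ev_wedgeAdj_form hz hb,
    fibWedge_fderiv_form g hz (b := b), fibInner_two_form hb] at h2
  simp only [coeffDeriv_conj g hz] at h2
  rw [eq_sub_of_add_eq h2.symm]
  simp only [LinearMap.add_apply, LinearMap.sub_apply, Module.End.mul_apply, map_add, map_sub]
  ring

omit hz hb in
/-- The form `∂̄ω`. -/
def delbarMetric (g : HermitianMetric E X) : DiffForm E X 3 :=
  delbar E X (Forms.single 2 g.form) 3

omit hz hb in
theorem delbar_form (g : HermitianMetric E X) :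
    delbar E X (Forms.single 2 g.form) = Forms.single 3 (delbarMetric g) := delbar_single g.form

omit hb in
theorem fibWedge_delbarMetric : fibWedge 3 ((delbarMetric g).1 e z) =
    ∑ c, creation b (Sum.inr c) * ((Complex.I / 2) • ∑ a, ∑ d,
      antiPart (fun w => coeffDeriv g e z b w a d) (b c) •
        (creation b (Sum.inl a) * creation b (Sum.inr d))) := by
  have h1 : (delbarMetric g).1 e z =
      ∑ c, altExt (dzBar b c) 2 (antiPart (fderiv ℝ (g.form.1 e) z) (b c)) := by
    change ev e z (delbar E X (Forms.single 2 g.form)) 3 = _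
    rw [ev_delbar b hz, Fib.sum_apply]
    refine Finset.sum_congr rfl fun c _ => ?_
    refine congrArg (altExt (dzBar b c) 2) ?_
    have h2 : ∀ w, fibDeriv (fun z => ev e z (Forms.single 2 g.form)) z w 2 =
        fderiv ℝ (g.form.1 e) z w := by
      intro w
      rw [fibDeriv_apply]
      simp only [ev_single_same, Fib.single_same]
    simp only [antiPart, Fib.smul_apply, Fib.add_apply, h2]
  rw [h1, map_sum]
  refine Finset.sum_congr rfl fun c _ => ?_
  rw [fibWedge_altExt, ← antiPart_map]
  refine congrArg (creation b (Sum.inr c) * ·) ?_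
  simp only [fibWedge_fderiv_form g hz (b := b), antiPart_const_smul, antiPart_sum,
    antiPart_smul_const]

/-- The constant -4i is the -2i of a two-form times the factor 2 of the third creation operator.
Taking adjoints conjugates the coefficients, so antilinear parts of derivatives turn into complex
linear ones with a and d exchanged. -/
theorem ev_wedgeAdj_delbarMetric (u : Forms E X) : ev e z (wedgeAdj g (delbarMetric g) u) =
    ((-4 * Complex.I) • ∑ c, ∑ a, ∑ d, holPart (fun w => coeffDeriv g e z b w d a) (b c) •
      (annihilation b (Sum.inr d) * annihilation b (Sum.inl a) * annihilation b (Sum.inr c)))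
      (ev e z u) := by
  refine fibInner_left_injective (g := g) hz fun v => ?_
  rw [← fibInner_wedgeAdj hz, fibWedge_delbarMetric hz (b := b)]
  have h : ∀ (c : ι) (T : Module.End ℂ (Fib E)), fibInner g e z
      ((creation b (Sum.inr c) * T) v) (ev e z u) =
      fibInner g e z (T v) ((2 : ℂ) • annihilation b (Sum.inr c) (ev e z u)) := by
    intro c T
    rw [Module.End.mul_apply, fibInner_creation hb]
  rw [LinearMap.sum_apply, map_sum, LinearMap.sum_apply]
  simp only [h, fibInner_two_form hb, conj_antiPart, coeffDeriv_conj g hz]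
  rw [← map_sum]
  congr 1
  simp only [LinearMap.smul_apply, LinearMap.sum_apply, map_smul, Module.End.mul_apply,
    Finset.smul_sum]
  refine Finset.sum_congr rfl fun c _ => Finset.sum_congr rfl fun a _ =>
    Finset.sum_congr rfl fun d _ => ?_
  module

/-- Terms with derivatives of v agree because [Λ, dz_c] = -2iι and -i·(-2i) = -2. Terms with v
undifferentiated agree by `CAR.kahler_identity`, where K holds the derivatives of the metric
coefficients, S that of the metric on forms, and M that of Λ. -/
theorem frameDelbarAdjoint_eq (v : Forms E X) : frameDelbarAdjoint g e z b v =
    ev e z ((-Complex.I • (wedgeAdj g g.form * del E X - del E X * wedgeAdj g g.form) -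
      (wedgeAdj g (delbarMetric g) * wedge (Forms.single 2 g.form) -
        wedge (Forms.single 2 g.form) * wedgeAdj g (delbarMetric g)) :
          Module.End ℂ (Forms E X)) v) := by
  have H := car_frame b
  set K : ι → ι → ι → ℂ := fun c d a => holPart (fun w => coeffDeriv g e z b w d a) (b c) with hK
  set S : ι → Module.End ℂ (Fib E) := fun c => holPart (fibMetricDeriv g e z (realFrame b)) (b c)
    with hSdef
  set M : ι → Module.End ℂ (Fib E) := fun c => ((-2 * Complex.I) • ∑ a, ∑ d, K c d a •
      (annihilation b (Sum.inr d) * annihilation b (Sum.inl a))) +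
      CAR.lam (annihilation b) * S c - S c * CAR.lam (annihilation b) with hM
  have hS : ∀ c, S c = -∑ a, ∑ d, (K c d a • (creation b (Sum.inl d) * annihilation b (Sum.inl a)) +
      K c a d • (creation b (Sum.inr d) * annihilation b (Sum.inr a))) := by
    intro c
    have h0 : fibMetricDeriv g e z (realFrame b) = fun w => (-LinearMap.id :
        Module.End ℂ (Fib E) →ₗ[ℂ] Module.End ℂ (Fib E)) (∑ a, ∑ d,
        (coeffDeriv g e z b w d a • (creation b (Sum.inl d) * annihilation b (Sum.inl a)) +
        coeffDeriv g e z b w a d • (creation b (Sum.inr d) * annihilation b (Sum.inr a)))) :=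
      funext fun w => fibMetricDeriv_frame g hz w
    simp only [hSdef, h0]
    refine (holPart_map _ _ _).trans ?_
    simp only [holPart_sum, holPart_add, holPart_smul_const]
    rfl
  have htr : ∀ c, holPart (traceDeriv g e z b) (b c) = ∑ a, K c a a := by
    intro c
    have h0 : traceDeriv g e z b = fun w => ∑ a, coeffDeriv g e z b w a a :=
      funext fun w => traceDeriv_frame g hz w
    rw [h0, holPart_sum]
  have hid := CAR.kahler_identity H K S M hS fun c => rfl
  set W : Module.End ℂ (Fib E) := (-4 * Complex.I) • ∑ c, ∑ a, ∑ d, K c d a •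
    (annihilation b (Sum.inr d) * annihilation b (Sum.inl a) * annihilation b (Sum.inr c))
  have hW : ∀ u, ev e z (wedgeAdj g (delbarMetric g) u) = W (ev e z u) :=
    ev_wedgeAdj_delbarMetric hz hb
  clear_value W
  set V := ev e z v
  set V' : ι → Fib E := fun c => holPart (fibDeriv (fun z => ev e z v) z) (b c) with hV'
  have hder : ∀ c, holPart (fibDeriv (fun z => ev e z (wedgeAdj g g.form v)) z) (b c) =
      CAR.lam (annihilation b) (V' c) + M c V := by
    intro c
    rw [funext (fibDeriv_wedgeAdj_form hz hb v), holPart_add, holPart_map, holPart_apply,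
      holPart_sub, holPart_add, holPart_const_mul, holPart_mul_const, holPart_const_smul]
    simp only [holPart_sum, holPart_smul_const, hM, hK, hSdef, hV']
    rfl
  have hdel : ev e z (del E X (wedgeAdj g g.form v)) =
      ∑ c, creation b (Sum.inl c) (CAR.lam (annihilation b) (V' c) + M c V) := by
    rw [ev_del b hz]
    simp only [hder]
  have hΛ : ev e z (wedgeAdj g g.form (del E X v)) =
      ∑ c, CAR.lam (annihilation b) (creation b (Sum.inl c) (V' c)) := by
    rw [ev_wedgeAdj_form hz hb, ev_del b hz, map_sum]
  have hcomm : ∀ c, CAR.lam (annihilation b) (creation b (Sum.inl c) (V' c)) =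
      creation b (Sum.inl c) (CAR.lam (annihilation b) (V' c)) +
        (-2 * Complex.I) • annihilation b (Sum.inr c) (V' c) := by
    intro c
    have := LinearMap.congr_fun (H.lam_mul_inl c) (V' c)
    exact eq_add_of_sub_eq' this
  have hlef : fibWedge 2 (g.form.1 e z) = CAR.lef (creation b) := fibWedge_form g hb
  simp only [LinearMap.sub_apply, LinearMap.smul_apply, LinearMap.neg_apply, LinearMap.sum_apply,
    Module.End.mul_apply (M := Forms E X), map_sub, map_smul, hdel, hΛ, hcomm,
    hW, ev_wedge_single, hlef]
  rw [frameDelbarAdjoint]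
  simp only [htr]
  have e2 : -((2 : ℂ) • ∑ a, annihilation b (Sum.inr a) (V' a + S a V + (∑ x, K a x x) • V)) =
      -((2 : ℂ) • ∑ a, annihilation b (Sum.inr a) (V' a)) + (-((2 : ℂ) • ∑ c, annihilation b (Sum.inr c) *
        (S c + (∑ a, K c a a) • 1)) : Module.End ℂ (Fib E)) V := by
    simp only [LinearMap.neg_apply, LinearMap.smul_apply, LinearMap.sum_apply,
      Module.End.mul_apply, LinearMap.add_apply, Module.End.one_apply, add_assoc, map_add,
      Finset.sum_add_distrib]
    module
  refine e2.trans ?_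
  rw [hid]
  simp only [LinearMap.sub_apply, LinearMap.smul_apply, LinearMap.sum_apply,
    Module.End.mul_apply, map_add, Finset.sum_add_distrib, ← Finset.smul_sum, neg_smul]
  have e3 : Complex.I • (-2 * Complex.I) • ∑ c, annihilation b (Sum.inr c) (V' c) =
      (2 : ℂ) • ∑ c, annihilation b (Sum.inr c) (V' c) := by
    rw [smul_smul]
    congr 1
    linear_combination -2 * Complex.I_mul_I
  simp only [smul_sub, smul_add, e3]
  abel

end WedgeAdjoint

/-! ### The formal adjoint of ∂̄. -/

section DelbarAdjoint
variable {E X : Type*} [NormedAddCommGroup E] [NormedSpace ℂ E] [FiniteDimensional ℂ E]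
  [MeasurableSpace E] [BorelSpace E] [TopologicalSpace X] [ChartedSpace E X]
  [IsManifold 𝓘(ℂ, E) ∞ X] [MeasurableSpace X] [BorelSpace X] [T2Space X]
  [SecondCountableTopology X] (g : HermitianMetric E X)

/-- The formal adjoint of `∂̄` on a Hermitian manifold. -/
def delbarAdjoint : Module.End ℂ (Forms E X) :=
  -Complex.I • (wedgeAdj g g.form * del E X - del E X * wedgeAdj g g.form) -
    (wedgeAdj g (delbarMetric g) * wedge (Forms.single 2 g.form) -
      wedge (Forms.single 2 g.form) * wedgeAdj g (delbarMetric g))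

/-- The unitary frame exists at each point separately. That suffices, since the integrand identity
is pointwise and the resulting operator is defined globally. -/
theorem isFormalAdjoint_delbar : IsFormalAdjoint g (delbar E X) (delbarAdjoint g) := by
  refine isFormalAdjoint_of_divergence isLocalOp_delbar fun e u v z hz => ?_
  obtain ⟨b, hb⟩ := HermitianMetric.exists_unitary_frame g e z hz
  rw [sum_fderiv_flux_frame g hz u v _ b, sum_antiPart_fderiv_flux g hz hb,
    frameDelbarAdjoint_eq hz hb]
  rfl

end DelbarAdjoint

/-! ### Pointwise adjoint operators. -/

section PointAdjoint
variable {E X : Type*} [NormedAddCommGroup E] [NormedSpace ℂ E] [FiniteDimensional ℂ E]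
  [TopologicalSpace X] [ChartedSpace E X] [IsManifold 𝓘(ℂ, E) ∞ X] {g : HermitianMetric E X}

/-- `B` is the pointwise adjoint of `A`. -/
def IsPointAdjoint (g : HermitianMetric E X) (A B : Module.End ℂ (Forms E X)) : Prop :=
  ∀ (e : atlas E X), ∀ z ∈ e.1.target, ∀ u v, fibInner g e z (ev e z (A u)) (ev e z v) =
      fibInner g e z (ev e z u) (ev e z (B v))

namespace IsPointAdjoint

theorem symm {A B : Module.End ℂ (Forms E X)} (h : IsPointAdjoint g A B) : IsPointAdjoint g B A :=
  fun e z hz u v => by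
    rw [← fibInner_conj hz, ← h e z hz, fibInner_conj hz]

theorem mul {A B A' B' : Module.End ℂ (Forms E X)} (h : IsPointAdjoint g A B)
    (h' : IsPointAdjoint g A' B') : IsPointAdjoint g (A * A') (B' * B) :=
  fun e z hz u v => by
    rw [Module.End.mul_apply, Module.End.mul_apply, h e z hz, h' e z hz]

theorem sub {A B A' B' : Module.End ℂ (Forms E X)} (h : IsPointAdjoint g A B)
    (h' : IsPointAdjoint g A' B') : IsPointAdjoint g (A - A') (B - B') :=
  fun e z hz u v => by
    rw [LinearMap.sub_apply, LinearMap.sub_apply, map_sub, map_sub, map_sub, map_sub,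
      LinearMap.sub_apply, h e z hz, h' e z hz]

end IsPointAdjoint

theorem isPointAdjoint_wedge {m : ℕ} (γ : DiffForm E X m) :
    IsPointAdjoint g (wedge (Forms.single m γ)) (wedgeAdj g γ) := fun e z hz u v => by
  rw [ev_wedge_single, fibInner_wedgeAdj hz]

theorem isPointAdjoint_mulFn (f : C^∞⟮𝓘(ℝ, E), X; 𝓘(ℝ, ℝ), ℝ⟯) :
    IsPointAdjoint g (mulFn f) (mulFn f) := fun e z hz u v => by
  rw [ev_mulFn, ev_mulFn, map_smul, LinearMap.map_smulₛₗ, Complex.conj_ofReal]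
  rfl

end PointAdjoint

/-! ### The operators that multiply (p,q)-forms by p and by q. -/

section Number
variable {E X : Type*} [NormedAddCommGroup E] [NormedSpace ℂ E] [FiniteDimensional ℂ E]

theorem fibConj_fibInt (v : E) (u : Fib E) : fibConj E (fibInt v u) = fibInt v (fibConj E u) := rfl

variable {ι : Type*} [Fintype ι] [DecidableEq ι] (b : Module.Basis ι ℂ E)

theorem fibConj_annihilation (s : ι ⊕ ι) (u : Fib E) :
    fibConj E (annihilation b s u) = annihilation b s.swap (fibConj E u) := by
  cases s <;>
  simp only [annihilation, Sum.elim_inl, Sum.elim_inr, Sum.swap_inl, Sum.swap_inr,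
    LinearMap.smul_apply, LinearMap.add_apply, LinearMap.sub_apply, LinearMap.map_smulₛₗ, map_add,
    map_sub, fibConj_fibInt, map_div₀, map_one, map_ofNat, Complex.conj_I] <;>
  module

theorem fibConj_numP (u : Fib E) : fibConj E (numP b u) = numQ b (fibConj E u) := by
  simp only [numP, numQ, LinearMap.sum_apply, map_sum, Module.End.mul_apply, fibConj_creation,
    fibConj_annihilation, Sum.swap_inl]

theorem numP_mul_annihilation_inr (c : ι) : numP b * annihilation b (Sum.inr c) =
    annihilation b (Sum.inr c) * numP b := by
  simp [numP, Finset.sum_mul, Finset.mul_sum, (car_frame b).num_mul_i]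

theorem numQ_mul_annihilation_inl (c : ι) : numQ b * annihilation b (Sum.inl c) =
    annihilation b (Sum.inl c) * numQ b := by
  simp [numQ, Finset.sum_mul, Finset.mul_sum, (car_frame b).num_mul_i]

theorem numQ_mul_annihilation_inr (c : ι) : numQ b * annihilation b (Sum.inr c) =
    annihilation b (Sum.inr c) * numQ b - annihilation b (Sum.inr c) := by
  simp only [numQ, Finset.sum_mul, Finset.mul_sum, (car_frame b).num_mul_i, Sum.inr.injEq,
    Finset.sum_sub_distrib]
  simp

/-- Every term of Λ removes one dz̄. -/
theorem numQ_mul_lam : numQ b * CAR.lam (annihilation b) =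
    CAR.lam (annihilation b) * numQ b - CAR.lam (annihilation b) := by
  rw [CAR.lam, mul_smul_comm, smul_mul_assoc, ← smul_sub, Finset.mul_sum, Finset.sum_mul,
    ← Finset.sum_sub_distrib]
  congr 1
  refine Finset.sum_congr rfl fun a _ => ?_
  rw [← mul_assoc, numQ_mul_annihilation_inr, sub_mul, mul_assoc, numQ_mul_annihilation_inl,
    mul_assoc]

variable [TopologicalSpace X] [ChartedSpace E X] [IsManifold 𝓘(ℂ, E) ∞ X]

variable (E X) in
/-- The operator that multiplies forms of type `(p,q)` by `p`. -/
def opP : Module.End ℂ (Forms E X) :=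
  ∑ p ∈ Finset.range (Module.finrank ℂ E + 1), ∑ q ∈ Finset.range (Module.finrank ℂ E + 1),
    (p : ℂ) • bidegree E X p q

theorem ev_opP (e : atlas E X) (z : E) (u : Forms E X) : ev e z (opP E X u) = numP b (ev e z u) := by
  rw [← sum_smul_fibBidegree_left b]
  simp only [opP, LinearMap.sum_apply, map_sum, LinearMap.smul_apply, map_smul, ev_bidegree]

theorem ev_conjOp_opP (e : atlas E X) (z : E) (u : Forms E X) :
    ev e z (conjOp (opP E X) u) = numQ b (ev e z u) := by
  rw [conjOp_apply, ev_conj, ev_opP b, ev_conj, fibConj_numP, fibConj_fibConj]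

theorem sum_bidegree : ∑ p ∈ Finset.range (Module.finrank ℂ E + 1),
    ∑ q ∈ Finset.range (Module.finrank ℂ E + 1), bidegree E X p q = 1 :=
  end_ext fun e z _ u => by
    have h := LinearMap.congr_fun (sum_fibBidegree (E := E)) (ev e z u)
    simp only [LinearMap.sum_apply] at h
    simp only [LinearMap.sum_apply, map_sum, ev_bidegree]
    exact h

theorem isPointAdjoint_opP (g : HermitianMetric E X) : IsPointAdjoint g (opP E X) (opP E X) :=
  fun e z hz u v => by
    obtain ⟨b, hb⟩ := g.exists_unitary_frame e z hz
    simp only [ev_opP b, numP, LinearMap.sum_apply, map_sum, Module.End.mul_apply,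
      fibInner_creation hb, fibInner_annihilation hb, map_smul, smul_smul]
    refine Finset.sum_congr rfl fun a _ => ?_
    norm_num

end Number

/-! ### The zero order operator η⁻¹ ∂̄η ∧ · and its commutation relations. -/

section TwistForm
variable {E X : Type*} [NormedAddCommGroup E] [NormedSpace ℂ E] [FiniteDimensional ℂ E]
  [TopologicalSpace X] [ChartedSpace E X] [IsManifold 𝓘(ℂ, E) ∞ X] (g : HermitianMetric E X)
  (η : C^∞⟮𝓘(ℝ, E), X; 𝓘(ℝ, ℝ), ℝ⟯) (f : C^∞⟮𝓘(ℝ, E), X; 𝓘(ℝ, ℝ), ℝ⟯)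

/-- The form `∂̄η`. -/
def delbarFn : DiffForm E X 1 := delbar E X (fnForm η) 1

theorem delbar_fnForm : delbar E X (fnForm η) = Forms.single 1 (delbarFn η) := delbar_single _

/-- The operator `f ∂̄η ∧ ·`. -/
def twist : Module.End ℂ (Forms E X) := mulFn f * wedge (delbar E X (fnForm η))

/-- The adjoint of `f ∂̄η ∧ ·`. -/
def twistAdj : Module.End ℂ (Forms E X) := wedgeAdj g (delbarFn η) * mulFn f

theorem isPointAdjoint_twist : IsPointAdjoint g (twist η f) (twistAdj g η f) := by
  rw [twist, delbar_fnForm]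
  exact (isPointAdjoint_mulFn f).mul (isPointAdjoint_wedge _)

theorem conjOp_twist : conjOp (twist (E := E) η f) = mulFn f * wedge (del E X (fnForm η)) := by
  rw [twist, conjOp_mul, conjOp_mulFn, conjOp_wedge, conjForm_delbar, conjForm_fnForm]

variable {g η f} {e : atlas E X} {z : E} (hz : z ∈ e.1.target) {ι : Type*} [Fintype ι]
  [DecidableEq ι] (b : Module.Basis ι ℂ E)

include hz in
theorem exists_delbarFn_coeff : ∃ α : ι → ℂ,
    (delbarFn η).1 e z = ∑ c, altExt (dzBar b c) 0 (α c • (ContinuousAlternatingMap.constOfIsEmpty ℝ E (Fin 0) (1 : ℂ))) := by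
  have h1 : (delbarFn η).1 e z =
      ∑ c, altExt (dzBar b c) 0 (antiPart (fibDeriv (fun z => ev e z (fnForm η)) z) (b c) 0) := by
    change ev e z (delbar E X (fnForm η)) 1 = _
    rw [ev_delbar b hz, Fib.sum_apply]
    rfl
  refine ⟨fun c => antiPart (fibDeriv (fun z => ev e z (fnForm η)) z) (b c) 0 ![], ?_⟩
  rw [h1]
  refine Finset.sum_congr rfl fun c _ => congrArg _ ?_
  ext v
  rw [Subsingleton.elim v ![]]
  simp

include hz in
-- At a point the twist is a combination of the dz̄_c, so its relations with Λ, L, P and Q follow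
-- from those of single creation and annihilation operators.
theorem exists_twist_coeff (f : C^∞⟮𝓘(ℝ, E), X; 𝓘(ℝ, ℝ), ℝ⟯) : ∃ α : ι → ℂ,
    (f (e.1.symm z) : ℂ) • fibWedge 1 ((delbarFn η).1 e z) =
      ∑ c, α c • creation b (Sum.inr c) := by
  obtain ⟨α, hα⟩ := exists_delbarFn_coeff (η := η) hz b
  refine ⟨fun c => (f (e.1.symm z) : ℂ) * α c, ?_⟩
  rw [hα, map_sum, Finset.smul_sum]
  refine Finset.sum_congr rfl fun c _ => ?_
  rw [fibWedge_altExt, map_smul, fibWedge_zero]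
  simp only [mul_smul_comm, smul_smul]
  simp [creation]

variable {b} {α : ι → ℂ} (hα : (f (e.1.symm z) : ℂ) • fibWedge 1 ((delbarFn η).1 e z) =
      ∑ c, α c • creation b (Sum.inr c))
include hα

theorem ev_twist (u : Forms E X) :
    ev e z (twist η f u) = (∑ c, α c • creation b (Sum.inr c)) (ev e z u) := by
  rw [← hα, twist, delbar_fnForm, Module.End.mul_apply, ev_mulFn, ev_wedge_single]
  rfl

theorem ev_conjOp_twist (u : Forms E X) : ev e z (conjOp (twist η f) u) =
      (∑ c, starRingEnd ℂ (α c) • creation b (Sum.inl c)) (ev e z u) := by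
  rw [conjOp_apply, ev_conj, ev_twist hα, LinearMap.sum_apply, LinearMap.sum_apply, map_sum]
  simp only [LinearMap.smul_apply, LinearMap.map_smulₛₗ, fibConj_creation, ev_conj,
    fibConj_fibConj, Sum.swap_inr]

include hz

theorem ev_twistAdj (hb : g.IsOrthonormal e z (realFrame b)) (u : Forms E X) :
    ev e z (twistAdj g η f u) =
      (∑ c, (2 * starRingEnd ℂ (α c)) • annihilation b (Sum.inr c)) (ev e z u) := by
  refine fibInner_left_injective (g := g) hz fun x => ?_
  have h : fibInner g e z x (ev e z (twistAdj g η f u)) =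
      fibInner g e z (((f (e.1.symm z) : ℂ) • fibWedge 1 ((delbarFn η).1 e z)) x) (ev e z u) := by
    rw [twistAdj, Module.End.mul_apply, ← fibInner_wedgeAdj hz, ev_mulFn, LinearMap.map_smulₛₗ,
      Complex.conj_ofReal, LinearMap.smul_apply, map_smul]
    rfl
  rw [h, hα]
  simp only [LinearMap.sum_apply, map_sum, LinearMap.smul_apply, map_smul, fibInner_creation hb,
    LinearMap.map_smulₛₗ, smul_eq_mul, map_mul, map_ofNat, Complex.conj_conj]
  exact Finset.sum_congr rfl fun c _ => by ring

omit hα hz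

section Relations
variable (g η f)

/-- For each c, the commutator of Λ with dz_c is -2i times a contraction, and the adjoint of dz̄_c
is twice that contraction. -/
theorem wedgeAdj_conj_twist : wedgeAdj g g.form * conjOp (twist η f) =
    conjOp (twist η f) * wedgeAdj g g.form - Complex.I • twistAdj g η f :=
  end_ext fun e z hz u => by
    obtain ⟨b, hb⟩ := g.exists_unitary_frame e z hz
    obtain ⟨α, hα⟩ := exists_twist_coeff (η := η) hz b f
    have h := fun c => eq_add_of_sub_eq' (LinearMap.congr_fun ((car_frame b).lam_mul_inl c) (ev e z u))
    simp only [Module.End.mul_apply, LinearMap.smul_apply] at h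
    simp only [Module.End.mul_apply, LinearMap.sub_apply, LinearMap.smul_apply, map_sub, map_smul,
      ev_wedgeAdj_form hz hb, ev_conjOp_twist hα, ev_twistAdj hz hα hb, LinearMap.sum_apply,
      map_sum, h, Finset.smul_sum, ← Finset.sum_sub_distrib]
    refine Finset.sum_congr rfl fun c _ => ?_
    module

/-- The source of the factor n in the theorem. -/
theorem wedgeAdj_mul_lefschetz : wedgeAdj g g.form * wedge (Forms.single 2 g.form) =
    wedge (Forms.single 2 g.form) * wedgeAdj g g.form + (Module.finrank ℂ E : ℂ) • 1 -
      opP E X - conjOp (opP E X) :=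
  end_ext fun e z hz u => by
    obtain ⟨b, hb⟩ := g.exists_unitary_frame e z hz
    have h := eq_add_of_sub_eq' (LinearMap.congr_fun (car_frame b).lam_mul_lef (ev e z u))
    have hlef : fibWedge 2 (g.form.1 e z) = CAR.lef (creation b) := fibWedge_form g hb
    simp only [Module.End.mul_apply] at h
    simp only [Module.End.mul_apply, LinearMap.sub_apply, LinearMap.add_apply,
      LinearMap.smul_apply, map_sub, map_add, map_smul, ev_wedgeAdj_form hz hb, ev_wedge_single,
      hlef, ev_opP b, ev_conjOp_opP b, h, Fintype.card_fin, numP, numQ, Module.End.one_apply]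
    abel

theorem conjOp_opP_mul_wedgeAdj : conjOp (opP E X) * wedgeAdj g g.form =
    wedgeAdj g g.form * conjOp (opP E X) - wedgeAdj g g.form :=
  end_ext fun e z hz u => by
    obtain ⟨b, hb⟩ := g.exists_unitary_frame e z hz
    have h := LinearMap.congr_fun (numQ_mul_lam b) (ev e z u)
    simp only [Module.End.mul_apply, LinearMap.sub_apply] at h
    simp only [Module.End.mul_apply, LinearMap.sub_apply, map_sub, ev_wedgeAdj_form hz hb,
      ev_conjOp_opP b, h]

theorem conjOp_opP_mul_twistAdj : conjOp (opP E X) * twistAdj g η f =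
    twistAdj g η f * conjOp (opP E X) - twistAdj g η f :=
  end_ext fun e z hz u => by
    obtain ⟨b, hb⟩ := g.exists_unitary_frame e z hz
    obtain ⟨α, hα⟩ := exists_twist_coeff (η := η) hz b f
    have h := fun c => LinearMap.congr_fun (numQ_mul_annihilation_inr b c) (ev e z u)
    simp only [Module.End.mul_apply, LinearMap.sub_apply] at h
    simp only [Module.End.mul_apply, LinearMap.sub_apply, LinearMap.smul_apply, map_sub, map_smul,
      ev_conjOp_opP b, ev_twistAdj hz hα hb, LinearMap.sum_apply, map_sum, h, smul_sub,
      Finset.sum_sub_distrib]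

theorem opP_mul_twistAdj : opP E X * twistAdj g η f = twistAdj g η f * opP E X :=
  end_ext fun e z hz u => by
    obtain ⟨b, hb⟩ := g.exists_unitary_frame e z hz
    obtain ⟨α, hα⟩ := exists_twist_coeff (η := η) hz b f
    have h := fun c => LinearMap.congr_fun (numP_mul_annihilation_inr b c) (ev e z u)
    simp only [Module.End.mul_apply] at h
    simp only [Module.End.mul_apply, LinearMap.smul_apply, map_smul,
      ev_opP b, ev_twistAdj hz hα hb, LinearMap.sum_apply, map_sum, h]

theorem twistAdj_mul_lefschetz : twistAdj g η f * wedge (Forms.single 2 g.form) =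
    wedge (Forms.single 2 g.form) * twistAdj g η f - Complex.I • conjOp (twist η f) :=
  end_ext fun e z hz u => by
    obtain ⟨b, hb⟩ := g.exists_unitary_frame e z hz
    obtain ⟨α, hα⟩ := exists_twist_coeff (η := η) hz b f
    have h := fun c => LinearMap.congr_fun ((car_frame b).inr_mul_lef c) (ev e z u)
    have hlef : fibWedge 2 (g.form.1 e z) = CAR.lef (creation b) := fibWedge_form g hb
    simp only [Module.End.mul_apply, LinearMap.sub_apply, LinearMap.smul_apply] at h
    simp only [Module.End.mul_apply, LinearMap.sub_apply, LinearMap.smul_apply, map_sub, map_smul,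
      ev_conjOp_twist hα, ev_twistAdj hz hα hb, LinearMap.sum_apply, ev_wedge_single, hlef,
      map_sum, h, Finset.smul_sum, ← Finset.sum_sub_distrib]
    refine Finset.sum_congr rfl fun c _ => ?_
    module

theorem mulFn_mul_wedgeAdj : mulFn f * wedgeAdj g g.form = wedgeAdj g g.form * mulFn f :=
  end_ext fun e z hz u => by
    obtain ⟨b, hb⟩ := g.exists_unitary_frame e z hz
    simp only [Module.End.mul_apply, ev_mulFn, ev_wedgeAdj_form hz hb, map_smul]

theorem conjOp_wedgeAdj_form : conjOp (wedgeAdj g g.form) = wedgeAdj g g.form :=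
  end_ext fun e z hz u => by
    obtain ⟨b, hb⟩ := g.exists_unitary_frame e z hz
    rw [conjOp_apply, ev_conj, ev_wedgeAdj_form hz hb, ev_wedgeAdj_form hz hb, ev_conj, CAR.lam]
    simp only [LinearMap.smul_apply, LinearMap.sum_apply, LinearMap.map_smulₛₗ, map_sum,
      Module.End.mul_apply, fibConj_annihilation, fibConj_fibConj, Sum.swap_inl, Sum.swap_inr,
      map_mul, map_neg, map_ofNat, Complex.conj_I, Finset.smul_sum]
    refine Finset.sum_congr rfl fun a _ => ?_
    have h := LinearMap.congr_fun ((car_frame b).ii_lr a a) (ev e z u)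
    simp only [Module.End.mul_apply, LinearMap.neg_apply] at h
    rw [h]
    module

theorem isOfBidegree_form (e : atlas E X) (z : E) : IsOfBidegree 1 1 (g.form.1 e z) := by
  refine ⟨rfl, fun c v => ?_⟩
  have h1 : ∀ u : Fin 2 → E, g.form.1 e z u = altBilin (g.form.1 e z) (u 0) (u 1) := by
    intro u
    rw [altBilin_apply]
    congr 1
    funext i
    fin_cases i <;> rfl
  have h2 : ∀ x : E, c • x = c.re • x + c.im • Complex.I • x := by
    intro x
    conv_lhs => rw [← Complex.re_add_im c, add_smul, mul_smul]
    simp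
  have h3 : altBilin (g.form.1 e z) (v 0) (Complex.I • v 1) =
      -altBilin (g.form.1 e z) (Complex.I • v 0) (v 1) := by
    rw [← HermitianMetric.form_I_smul, smul_smul, Complex.I_mul_I, neg_one_smul, map_neg]
  rw [h1, h1 v]
  simp only [h2, map_add, map_smul, LinearMap.add_apply, LinearMap.smul_apply, h3,
    HermitianMetric.form_I_smul, pow_one, Complex.mul_conj, Complex.normSq_apply]
  simp only [Complex.real_smul]
  push_cast
  ring

/-- As ω has type (1,1), the twisted operator sends it to ∂̄ω - η⁻¹ ∂̄η ∧ ω. The hypothesis on the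
dimension puts p = q = 1 into the range of the sums in `opP`. -/
theorem opP_form (hn : 1 ≤ Module.finrank ℂ E) :
    opP E X (Forms.single 2 g.form) = Forms.single 2 g.form := forms_ext fun e z hz => by
  have h : ∀ p q, fibBidegree E p q (Fib.single 2 (g.form.1 e z)) =
      if p = 1 ∧ q = 1 then Fib.single 2 (g.form.1 e z) else 0 := by
    intro p q
    refine Fib.ext fun k => ?_
    rw [fibBidegree_apply]
    by_cases hk : k = 2
    · subst hk
      rw [Fib.single_same, altBidegree_of_isOfBidegree (isOfBidegree_form g e z)]
      split_ifs
      · rw [Fib.single_same]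
      · rfl
    · rw [Fib.single_ne hk, map_zero]
      split_ifs
      · rw [Fib.single_ne hk]
      · rfl
  simp only [opP, LinearMap.sum_apply, map_sum, LinearMap.smul_apply, map_smul, ev_bidegree,
    ev_single_same, h]
  rw [Finset.sum_eq_single 1, Finset.sum_eq_single 1]
  · simp
  · intro q _ hq
    simp [hq]
  · intro h1
    exact absurd (Finset.mem_range.2 (by omega)) h1
  · intro p _ hp
    simp [hp]
  · intro h1
    exact absurd (Finset.mem_range.2 (by omega)) h1

/-- The form `f ∂̄η ∧ ω`. -/
def twistForm : DiffForm E X 3 := twist η f (Forms.single 2 g.form) 3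

theorem twist_form : twist η f (Forms.single 2 g.form) = Forms.single 3 (twistForm g η f) := by
  refine single_of_ev fun e z hz k hk => ?_
  obtain ⟨α, hα⟩ := exists_twist_coeff (η := η) hz (Module.finBasis ℂ E) f
  rw [ev_twist hα, LinearMap.sum_apply, Fib.sum_apply]
  refine Finset.sum_eq_zero fun c _ => ?_
  rw [LinearMap.smul_apply, creation_eq, ev_single_same, fibExt_single,
    Fib.smul_apply, Fib.single_ne hk, alt_smul_zero]

theorem wedge_twist_form : wedge (twist η f (Forms.single 2 g.form)) =
    twist η f * wedge (Forms.single 2 g.form) := end_ext fun e z hz u => by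
  obtain ⟨α, hα⟩ := exists_twist_coeff (η := η) hz (Module.finBasis ℂ E) f
  rw [twist_form, ev_wedge_single, Module.End.mul_apply, ev_twist hα, ev_wedge_single]
  have h : (twistForm g η f).1 e z =
      ∑ c, α c • altExt (dzBar (Module.finBasis ℂ E) c) 2 (g.form.1 e z) := by
    change ev e z (twist η f (Forms.single 2 g.form)) 3 = _
    rw [ev_twist hα, LinearMap.sum_apply, Fib.sum_apply]
    refine Finset.sum_congr rfl fun c _ => ?_
    rw [LinearMap.smul_apply, Fib.smul_apply, ev_single_same]
    change α c • altExt _ 2 (Fib.single 2 (g.form.1 e z) 2) = _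
    rw [Fib.single_same]
  rw [h]
  simp only [map_sum, map_smul, fibWedge_altExt]
  simp only [LinearMap.sum_apply, LinearMap.smul_apply]
  rfl

end Relations
end TwistForm

/-! ### The adjoint of the twisted operator and the twisted commutation relation. -/

section TwistedAdjoint
variable {E X : Type*} [NormedAddCommGroup E] [NormedSpace ℂ E] [FiniteDimensional ℂ E]
  [TopologicalSpace X] [ChartedSpace E X] [IsManifold 𝓘(ℂ, E) ∞ X] {g : HermitianMetric E X}

/-- An operator with a pointwise adjoint has order zero: if u vanishes at z, then ⟨Au, Au⟩ = ⟨u,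
BAu⟩ = 0 there. -/
theorem IsPointAdjoint.isLocalOp {A B : Module.End ℂ (Forms E X)} (h : IsPointAdjoint g A B) :
    IsLocalOp A := fun u e z hz h0 => by
  refine eq_zero_of_fibInner_self (g := g) hz ?_
  rw [h e z hz, h0.self_of_nhds, map_zero]
  rfl

theorem twistedDelbar_eq (η : C^∞⟮𝓘(ℝ, E), X; 𝓘(ℝ, ℝ), ℝ⟯)
    (hη : (∀ x, 0 < η x) ∨ ∀ x, η x < 0) : twistedDelbar (E := E) η hη =
      delbar E X - twist η (invFn η (ne_zero_of_sign hη)) * opP E X := by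
  have h := congrArg (delbar E X * ·) (sum_bidegree (E := E) (X := X))
  simp only [mul_one, Finset.mul_sum] at h
  simp only [twistedDelbar, sub_mul, Finset.sum_sub_distrib, opP, Finset.mul_sum, h, smul_mul_assoc,
    mul_smul_comm]
  rfl

variable [MeasurableSpace E] [BorelSpace E] [MeasurableSpace X] [BorelSpace X]

theorem IsPointAdjoint.isFormalAdjoint {A B : Module.End ℂ (Forms E X)} (h : IsPointAdjoint g A B) :
    IsFormalAdjoint g A B := isFormalAdjoint_of_pointwise h

variable [T2Space X] (g)

theorem isFormalAdjoint_lefschetz : IsFormalAdjoint g (lefschetz g) (wedgeAdj g g.form) :=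
  (isPointAdjoint_wedge g.form).isFormalAdjoint

theorem lefschetzAdjoint_eq : lefschetzAdjoint g = wedgeAdj g g.form :=
  (isFormalAdjoint_lefschetz g).formalAdjoint_eq

variable (η : C^∞⟮𝓘(ℝ, E), X; 𝓘(ℝ, ℝ), ℝ⟯) (hη : (∀ x, 0 < η x) ∨ ∀ x, η x < 0)

/-- The formal adjoint of the twisted torsion operator. -/
def twistedTorsionAdj : Module.End ℂ (Forms E X) :=
  (wedgeAdj g (delbarMetric g) -
      wedgeAdj g g.form * twistAdj g η (invFn η (ne_zero_of_sign hη))) * lefschetz g -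
    lefschetz g * (wedgeAdj g (delbarMetric g) -
      wedgeAdj g g.form * twistAdj g η (invFn η (ne_zero_of_sign hη)))

theorem isFormalAdjoint_twistedTorsion (hn : 1 ≤ Module.finrank ℂ E) :
    IsFormalAdjoint g (twistedTorsion g η hη) (twistedTorsionAdj g η hη) := by
  have h1 : wedge (twistedDelbar η hη (Forms.single 2 g.form)) =
      wedge (Forms.single 3 (delbarMetric g)) -
        twist η (invFn η (ne_zero_of_sign hη)) * wedge (Forms.single 2 g.form) := by
    rw [twistedDelbar_eq, LinearMap.sub_apply, Module.End.mul_apply, opP_form g hn, delbar_form,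
      sub_eq_add_neg, wedge_add, ← neg_one_smul ℂ, wedge_smul, wedge_twist_form]
    module
  have h2 : (-1 : ℂ) ^ ((-2 : ℤ) * 3) = 1 := by norm_num [zpow_neg]
  rw [twistedTorsion, gradedBracket, h2, one_smul, lefschetzAdjoint_eq, h1]
  have h3 := ((isPointAdjoint_wedge (g := g) (delbarMetric g)).sub
    ((isPointAdjoint_twist g η (invFn η (ne_zero_of_sign hη))).mul
      (isPointAdjoint_wedge g.form)))
  have h4 := (isPointAdjoint_wedge (g := g) g.form).symm
  exact ((h4.mul h3).sub (h3.mul h4)).isFormalAdjoint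

variable [SecondCountableTopology X]

/-- The formal adjoint of the twisted operator. -/
def twistedDelbarAdj : Module.End ℂ (Forms E X) :=
  delbarAdjoint g - opP E X * twistAdj g η (invFn η (ne_zero_of_sign hη))

theorem isFormalAdjoint_twistedDelbar :
    IsFormalAdjoint g (twistedDelbar η hη) (twistedDelbarAdj g η hη) := by
  have h := (isPointAdjoint_twist g η (invFn η (ne_zero_of_sign hη))).mul (isPointAdjoint_opP g)
  rw [twistedDelbar_eq]
  exact (isFormalAdjoint_delbar g).sub h.isFormalAdjoint isLocalOp_delbar h.isLocalOp

/-- The commutation relation between `Λ` and the conjugate of the twisted operator. -/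
theorem twistedDelbarAdj_eq : twistedDelbarAdj g η hη =
    -Complex.I • (wedgeAdj g g.form * conjOp (twistedDelbar η hη) -
      conjOp (twistedDelbar η hη) * wedgeAdj g g.form) - twistedTorsionAdj g η hη +
    (Module.finrank ℂ E : ℂ) • Complex.I •
      (conjOp (twist η (invFn η (ne_zero_of_sign hη))) * wedgeAdj g g.form -
        wedgeAdj g g.form * conjOp (twist η (invFn η (ne_zero_of_sign hη)))) := by
  rw [twistedDelbarAdj, delbarAdjoint, twistedTorsionAdj, twistedDelbar_eq, conjOp_sub, conjOp_mul,
    conjOp_delbar, lefschetz]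
  set f := invFn η (ne_zero_of_sign hη)
  have r1 := wedgeAdj_conj_twist g η f
  have r2 := wedgeAdj_mul_lefschetz g
  have r3 := conjOp_opP_mul_wedgeAdj g
  have r4 := conjOp_opP_mul_twistAdj g η f
  have r5 := opP_mul_twistAdj g η f
  have r6 := twistAdj_mul_lefschetz g η f
  set P := opP E X
  set Q := conjOp P
  set A := twistAdj g η f
  set C := conjOp (twist (E := E) η f)
  set Λ := wedgeAdj g g.form
  set L := wedge (Forms.single 2 g.form)
  set B := wedgeAdj g (delbarMetric g)
  set d := del E X
  clear_value P Q A C Λ L B d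
  -- Moving L to the left through A and then through Λ yields the term nA. The correction n i[C, Λ]
  -- equals -nA and cancels it, while the other terms, with [Λ, CQ], leave -PA, the zero order part
  -- of the adjoint.
  have s1 : Λ * A * L = L * Λ * A + (Module.finrank ℂ E : ℂ) • A - P * A - Q * A -
      Complex.I • (C * Λ) - A := by
    rw [mul_assoc, r6, mul_sub, ← mul_assoc, r2, mul_smul_comm, r1]
    simp only [add_mul, sub_mul, smul_mul_assoc, one_mul, smul_sub, smul_smul, Complex.I_mul_I]
    module
  have s2 : C * Q * Λ = C * Λ * Q - C * Λ := by
    rw [mul_assoc, r3, mul_sub, mul_assoc]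
  have s3 : Λ * (C * Q) = C * Λ * Q - Complex.I • (A * Q) := by
    rw [← mul_assoc, r1, sub_mul, smul_mul_assoc]
  simp only [mul_sub, sub_mul, s1, s2, s3, r1, r4, r5, mul_assoc L]
  match_scalars <;> (ring_nf; try simp only [Complex.I_sq]; try ring)

end TwistedAdjoint

end TwistedBKN

end

theorem proposition4p4 {E X : Type*} [NormedAddCommGroup E] [NormedSpace ℂ E]
    [FiniteDimensional ℂ E] [MeasurableSpace E] [BorelSpace E]
    [TopologicalSpace X] [T2Space X] [SecondCountableTopology X]
    [ChartedSpace E X] [IsManifold 𝓘(ℂ, E) ∞ X] [MeasurableSpace X] [BorelSpace X]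
    (n : ℕ) (hn : Module.finrank ℂ E = n) (hn2 : 2 ≤ n) (g : HermitianMetric E X)
    (η : C^∞⟮𝓘(ℝ, E), X; 𝓘(ℝ, ℝ), ℝ⟯) (hη : (∀ x, 0 < η x) ∨ ∀ x, η x < 0) :
    ((∃! B, IsFormalAdjoint g (lefschetz g) B) ∧
      (∃! B, IsFormalAdjoint g (twistedDelbar η hη) B) ∧
      (∃! B, IsFormalAdjoint g (conjOp (twistedDelbar η hη)) B) ∧
      (∃! B, IsFormalAdjoint g (twistedTorsion g η hη) B) ∧
      (∃! B, IsFormalAdjoint g (conjOp (twistedTorsion g η hη)) B)) ∧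
    twistedLaplacianDelbar g η hη =
      twistedLaplacianDel g η hη +
      Complex.I • gradedBracket 2 (-2)
        (gradedBracket 1 1 (twistedDelbar η hη) (conjOp (twistedDelbar η hη)))
        (lefschetzAdjoint g) +
      gradedBracket 1 (-1) (conjOp (twistedDelbar η hη))
        (formalAdjoint g (conjOp (twistedTorsion g η hη))) -
      gradedBracket 1 (-1) (twistedDelbar η hη) (formalAdjoint g (twistedTorsion g η hη)) +
      (n : ℂ) • gradedBracket 1 (-1) (twistedDelbar η hη)
        (Complex.I • (mulFn (invFn η (ne_zero_of_sign hη)) *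
          gradedBracket 1 (-2) (wedge (del E X (fnForm η))) (lefschetzAdjoint g))) +
      (n : ℂ) • gradedBracket 1 (-1) (conjOp (twistedDelbar η hη))
        (Complex.I • (mulFn (invFn η (ne_zero_of_sign hη)) *
          gradedBracket 1 (-2) (wedge (delbar E X (fnForm η))) (lefschetzAdjoint g))) := by
  have hτ := isFormalAdjoint_twistedTorsion g η hη (by omega)
  have hD := isFormalAdjoint_twistedDelbar g η hη
  refine ⟨⟨(isFormalAdjoint_lefschetz g).existsUnique, hD.existsUnique, hD.conjOp.existsUnique,
    hτ.existsUnique, hτ.conjOp.existsUnique⟩, ?_⟩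
  rw [twistedLaplacianDelbar, twistedLaplacianDel, hτ.formalAdjoint_eq,
    hτ.conjOp.formalAdjoint_eq, hD.formalAdjoint_eq, hD.conjOp.formalAdjoint_eq,
    lefschetzAdjoint_eq]
  -- The function 1/η commutes with Λ, so it can be moved inside the bracket and combined with ∂η or
  -- ∂̄η into the twist.
  have h1 : ∀ T : Module.End ℂ (Forms E X), mulFn (invFn η (ne_zero_of_sign hη)) *
      gradedBracket 1 (-2) T (wedgeAdj g g.form) =
      mulFn (invFn η (ne_zero_of_sign hη)) * T * wedgeAdj g g.form -
        wedgeAdj g g.form * (mulFn (invFn η (ne_zero_of_sign hη)) * T) := by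
    intro T
    have h2 : (-1 : ℂ) ^ ((1 : ℤ) * -2) = 1 := by norm_num [zpow_neg]
    rw [gradedBracket, h2, one_smul, mul_sub, ← mul_assoc, ← mul_assoc, ← mul_assoc,
      mulFn_mul_wedgeAdj]
  have hI := twistedDelbarAdj_eq g η hη
  -- Λ is a real operator, so conjugation turns the relation for D⋆ into one for the adjoint of D̄,
  -- with i replaced by -i.
  have hII := congrArg conjOp hI
  simp only [conjOp_add, conjOp_sub, conjOp_smul, conjOp_mul, conjOp_conjOp, conjOp_wedgeAdj_form,
    map_neg, Complex.conj_I, Complex.conj_natCast, neg_neg] at hII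
  rw [h1, h1, ← conjOp_twist, hII, hI, hn,
    show mulFn (invFn η (ne_zero_of_sign hη)) * wedge (delbar E X (fnForm η)) =
      twist η (invFn η (ne_zero_of_sign hη)) from rfl]
  set D := twistedDelbar (E := E) η hη
  set Dc := conjOp D
  set A := twist (E := E) η (invFn η (ne_zero_of_sign hη))
  set Ac := conjOp A
  set Λ := wedgeAdj g g.form
  set τ := twistedTorsionAdj g η hη
  set τc := conjOp τ
  clear_value D Dc A Ac Λ τ τc
  have h5 : (-1 : ℂ) ^ ((1 : ℤ) * 1) = -1 := by norm_num
  -- With both adjoints inserted, what remains is an identity between words in D, D̄, Λ and the zero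
  -- order operators: the graded Jacobi identity for D, D̄, Λ, written out.
  simp only [gradedBracket, h5, one_smul, sub_neg_eq_add, mul_add, add_mul,
    mul_sub, sub_mul, mul_smul_comm, smul_mul_assoc, smul_add, smul_sub, mul_assoc, neg_smul,
    mul_neg, neg_mul]
  module
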